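/- Let $p>1$, $\mathbb T=\mathbb R/2\pi\mathbb Z$, $\omega_p=\frac{4}{(p-1)(p+3)}$, and for $\omega>0$ let $$R_\omega(x)=\omega^{\frac1{p-1}}\Big(\frac{p+1}{2}\Big)^{\frac1{p-1}}\operatorname{sech}^{\frac{2}{p-1}}\Big(\frac{p-1}{2}\sqrt\omega\,x\Big).$$ All functions are real-valued, and $\langle\cdot,\cdot\rangle$ is the inner product of $L^2(\mathbb R\times\mathbb T)$. Put $\Psi(x,y)=R_{\omega_p}(x)^{\frac{p+1}{2}}\cos y\,/\,\|R_{\omega_p}^{\frac{p+1}{2}}\cos y\|_{L^2(\mathbb R\times\mathbb T)}$, $P_\perp u=u-\langle u,\Psi\rangle\Psi$, and $\mathcal F(\omega,u)=-\partial_x^2u-\partial_y^2u+\omega u-|u|^{p-1}u$ for $u\in H^2(\mathbb R\times\mathbb T)$. Let $X_2$ be the space of all $u\in H^2(\mathbb R\times\mathbb T)$ with $u(x,y)=u(-x,y)=u(x,-y)$ and $\langle u,\Psi\rangle=0$. For $r>0$, $\omega>0$ and $a\in(-1,1)$ let $S_r(\omega,a)$ be the set of all functions $\varphi=R_{\omega_p}+a\Psi+h$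 with $h\in X_2$, $\|h\|_{H^2}<r$ and $P_\perp\mathcal F(\omega,\varphi)=0$ (the solutions of the auxiliary equation of the Lyapunov--Schmidt reduction near $R_{\omega_p}$). For $\varphi\in S_r(\omega,a)$ put $$\mathbf L_+=-\partial_x^2-\partial_y^2+\omega-p|\varphi|^{p-1},\qquad \text{with domain } H^2(\mathbb R\times\mathbb T).$$ Then there are $r_0>0$, $\delta_0\in(0,\omega_p)$ and $\varepsilon_1>0$, depending only on $p$, such that for every $0<\varepsilon<\varepsilon_1$ there are $a_\varepsilon\in(0,1)$ and $C_1(\varepsilon)>1$, depending only on $p$ and $\varepsilon$, with the following two properties. (1) If $|\omega-\omega_p|<\delta_0$, $|a|<a_\varepsilon$ and $\varphi\in S_{r_0}(\omega,a)$, then $$\frac1{C_1(\varepsilon)}e^{-(\sqrt\omega+\varepsilon)|x|}\le\varphi(x,y)\le C_1(\varepsilon)e^{-(\sqrt\omega-\varepsilon)|x|}\qquad\text{on }\mathbb R\times\mathbb T.$$ (2) For all $A>0$, $B>0$ and $\alpha>0$ there is $C_\varepsilon>0$, depending only on $p,A,B,\alpha$ and $\varepsilon$, such that the following holds. Let $|\omega-\omega_p|<\delta_0$,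 $|a|<a_\varepsilon$, $\alpha<\sqrt\omega$ and $\varphi\in S_{r_0}(\omega,a)$, and let $v\in H^2(\mathbb R\times\mathbb T)$ be a solution of $\mathbf L_+v=G$, where $|G(x,y)|\le Ae^{-\alpha|x|}$ on $\mathbb R\times\mathbb T$ and $\|v\|_{L^\infty(\mathbb R\times\mathbb T)}\le B$. Then $$|v(x,y)|\le C_\varepsilon e^{-(\alpha-\varepsilon)|x|}\qquad\text{on }\mathbb R\times\mathbb T.$$ (Pointwise relations between elements of $L^2$ are meant almost everywhere.) -/

import Mathlib

open MeasureTheory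

noncomputable section

namespace LineSoliton

/-! Functions on `ℝ × 𝕋`, `𝕋 = ℝ / 2πℤ`, are represented by functions on `ℝ × ℝ` which are
`2π`-periodic in the second variable; integrals over `ℝ × 𝕋` are integrals over
`ℝ × (0, 2π]`. Elements of `L²(ℝ × 𝕋)` are such functions up to a.e. equality. -/

/-- `u` is `2π`-periodic in the second variable, i.e. a function on `ℝ × 𝕋`. -/
def PeriodicY (u : ℝ × ℝ → ℝ) : Prop :=
  ∀ x y : ℝ, u (x, y + 2 * Real.pi) = u (x, y)

/-- The product measure `dx dy` on `ℝ × 𝕋` (on the fundamental domain `ℝ × (0, 2π]`). -/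
def cyl : Measure (ℝ × ℝ) :=
  (volume : Measure (ℝ × ℝ)).restrict (Set.univ ×ˢ Set.Ioc 0 (2 * Real.pi))

/-- `u ∈ L²(ℝ × 𝕋)`. -/
def MemL2 (u : ℝ × ℝ → ℝ) : Prop :=
  PeriodicY u ∧ MemLp u 2 cyl

/-- The inner product of `L²(ℝ × 𝕋)` (real-valued functions). -/
def inner2 (u v : ℝ × ℝ → ℝ) : ℝ := ∫ z, u z * v z ∂cyl

/-- The norm of `L²(ℝ × 𝕋)`. -/
def norm2 (u : ℝ × ℝ → ℝ) : ℝ := Real.sqrt (inner2 u u)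

/-- Test functions: the elements of `C_c^∞(ℝ × 𝕋)`. -/
structure IsTest (ζ : ℝ × ℝ → ℝ) : Prop where
  smooth : ContDiff ℝ (⊤ : ℕ∞) ζ
  periodic : PeriodicY ζ
  support : ∃ M : ℝ, ∀ x y : ℝ, M ≤ |x| → ζ (x, y) = 0

/-- `w` is the weak derivative of `u` in the direction `e`, on `ℝ × 𝕋`. -/
def HasWeakDeriv (e : ℝ × ℝ) (u w : ℝ × ℝ → ℝ) : Prop :=
  ∀ ζ : ℝ × ℝ → ℝ, IsTest ζ →
    ∫ z, u z * fderiv ℝ ζ z e ∂cyl = - ∫ z, w z * ζ z ∂cyl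

/-- `u` has a weak derivative in the direction `e` that belongs to `L²(ℝ × 𝕋)`. -/
def WeakDiff (e : ℝ × ℝ) (u : ℝ × ℝ → ℝ) : Prop :=
  ∃ w : ℝ × ℝ → ℝ, MemL2 w ∧ HasWeakDeriv e u w

open Classical in
/-- The weak derivative of `u` in the direction `e` (unique up to a.e. equality), where there is
one in `L²(ℝ × 𝕋)`. -/
def wd (e : ℝ × ℝ) (u : ℝ × ℝ → ℝ) : ℝ × ℝ → ℝ :=
  if h : WeakDiff e u then h.choose else 0

/-- The weak partial derivative `∂ₓ`. -/
def dx (u : ℝ × ℝ → ℝ) : ℝ × ℝ → ℝ := wd (1, 0) u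

/-- The weak partial derivative `∂ᵧ`. -/
def dy (u : ℝ × ℝ → ℝ) : ℝ × ℝ → ℝ := wd (0, 1) u

/-- `u ∈ H¹(ℝ × 𝕋)`. -/
def MemH1 (u : ℝ × ℝ → ℝ) : Prop :=
  MemL2 u ∧ WeakDiff (1, 0) u ∧ WeakDiff (0, 1) u

/-- `u ∈ H²(ℝ × 𝕋)`. -/
def MemH2 (u : ℝ × ℝ → ℝ) : Prop :=
  MemH1 u ∧ MemH1 (dx u) ∧ MemH1 (dy u)

/-- The norm of `H²(ℝ × 𝕋)`. -/
def normH2 (u : ℝ × ℝ → ℝ) : ℝ :=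
  Real.sqrt (norm2 u ^ 2 + norm2 (dx u) ^ 2 + norm2 (dy u) ^ 2
    + norm2 (dx (dx u)) ^ 2 + norm2 (dx (dy u)) ^ 2 + norm2 (dy (dy u)) ^ 2)

/-- `𝓕(ω, u) = -∂ₓ²u - ∂ᵧ²u + ω u - |u|^(p-1) u`. -/
def nlF (p ω : ℝ) (u : ℝ × ℝ → ℝ) : ℝ × ℝ → ℝ := fun z =>
  - dx (dx u) z - dy (dy u) z + ω * u z - |u z| ^ (p - 1) * u z

/-- The line soliton
`R_ω(x) = ω^(1/(p-1)) ((p+1)/2)^(1/(p-1)) sech^(2/(p-1)) ((p-1)/2 √ω x)`. -/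
def soliton (p ω x : ℝ) : ℝ :=
  ω ^ (1 / (p - 1)) * ((p + 1) / 2) ^ (1 / (p - 1))
    * (1 / Real.cosh ((p - 1) / 2 * Real.sqrt ω * x)) ^ (2 / (p - 1))

/-- The bifurcation frequency `ω_p = 4 / ((p-1)(p+3))`. -/
def omegaP (p : ℝ) : ℝ := 4 / ((p - 1) * (p + 3))

/-- `ψ_{ω_p}(x) cos y`, the `L²(ℝ × 𝕋)`-normalization of `R_{ω_p}^((p+1)/2) cos y`. -/
def psiCos (p : ℝ) : ℝ × ℝ → ℝ := fun z =>
  soliton p (omegaP p) z.1 ^ ((p + 1) / 2) * Real.cos z.2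
    / norm2 (fun w => soliton p (omegaP p) w.1 ^ ((p + 1) / 2) * Real.cos w.2)

/-- `u(x, y) = u(-x, y) = u(x, -y)` (a.e.). -/
def IsSym (u : ℝ × ℝ → ℝ) : Prop :=
  ∀ᵐ z ∂cyl, u (-z.1, z.2) = u z ∧ u (z.1, -z.2) = u z

/-- The space `X₂` of the symmetric `H²`-functions that are orthogonal to `ψ_{ω_p} cos y`. -/
def MemX2 (p : ℝ) (h : ℝ × ℝ → ℝ) : Prop :=
  MemH2 h ∧ IsSym h ∧ inner2 h (psiCos p) = 0

/-- The orthogonal projection `P_⊥`. -/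
def projPerp (p : ℝ) (u : ℝ × ℝ → ℝ) : ℝ × ℝ → ℝ := fun z =>
  u z - inner2 u (psiCos p) * psiCos p z

/-- `φ = R_{ω_p} + a ψ_{ω_p} cos y + h`. -/
def phi (p a : ℝ) (h : ℝ × ℝ → ℝ) : ℝ × ℝ → ℝ := fun z =>
  soliton p (omegaP p) z.1 + a * psiCos p z + h z

/-- `h` is a solution in the ball of radius `r` of `X₂` of the auxiliary equation
`𝓕_⊥(ω, a, h) = P_⊥ 𝓕(ω, R_{ω_p} + a ψ_{ω_p} cos y + h) = 0`. -/
def IsAuxSol (p r ω a : ℝ) (h : ℝ × ℝ → ℝ) : Prop :=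
  MemX2 p h ∧ normH2 h < r ∧ projPerp p (nlF p ω (phi p a h)) =ᵐ[cyl] 0

/-- The linearized operator `-∂ₓ² - ∂ᵧ² + ω - p |φ|^(p-1)`, with domain `H²(ℝ × 𝕋)`. -/
def LPlus (p ω : ℝ) (φ v : ℝ × ℝ → ℝ) : ℝ × ℝ → ℝ := fun z =>
  - dx (dx v) z - dy (dy v) z + ω * v z - p * |φ z| ^ (p - 1) * v z

end LineSoliton

end

/-! With c = ⟨F(ω,φ),Ψ⟩ the auxiliary equation reads (ω - Δ)φ = |φ|^(p-1) φ + cΨ. The embedding of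
H² into L^∞ (`MemH2.ae_abs_le`) keeps φ uniformly close to R_{ω_p}, so |φ|^(p-1) is small for large
|x|. Also Ψ decays at rate √ω_p + b with b = (p-1)√ω_p/2, strictly faster than any rate at issue.
Upper bounds, for φ and for solutions of L₊v = G, then follow by comparison with multiples of
sech(αx) through the maximum principle for ω - Δ: `ae_nonpos_of_weak_subsolution`,
`IsReg.ae_abs_le_sech`.

The lower bound uses the barrier σ sech(lx) with l > √ω, fed by the source |φ|^(p-1) φ on a bounded
range of x (`IsReg.sech_le_ae`). Since cos y changes sign, cΨ may push φ down, and c must be small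
compared with σ. The decisive estimate is |c| ≤ C|a|, uniformly in ω (`exists_abs_multiplier_le`);
no uniqueness or smoothness of the reduction is used.

For that estimate, subtract from φ its mean in y and expand the rest d in cosines. The choice of ω_p
gives -∂² + ω_p - pR_{ω_p}^(p-1) = A*A - 1 with A = ∂ + s b tanh(bx), whose kernel is spanned by
sech(bx)^s, the profile of Ψ (`mul_soliton_rpow`). Mode k ≠ 0 of φ solves (A*A + k² - 1)φ_k = E_k +
cΨ_k, where |E| ≤ s₀|d|. For |k| ≥ 2 the operator is at least 3. For k = ±1 pairing with the kernel
bounds c by E, while the spectral gap (`exists_gap`) bounds φ_k by E and by ⟨φ,Ψ⟩ = a. Parseval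
gives ‖d‖ ≲ ‖E‖ + |a|; smallness of s₀ gives ‖d‖ ≲ |a|, hence |c| ≲ |a|.

The radius r₀ and the width δ₀ must not depend on ε. So bounds with fixed, non-sharp rates come
first (`exists_uniform_estimates`). They make φ small outside, and bounded below inside, any range
of x, however large ε forces it to be. The sharp rates follow by repeating the comparison; only a_ε
shrinks with ε (`exists_sharp_lower`). -/

open MeasureTheory

noncomputable section

namespace LineSoliton

open Filter Topology
open scoped ENNReal Convolution

set_option linter.unusedSectionVars false

/-! ### Distributional derivatives and mollification. -/

section WeakDerivatives

open scoped ContDiff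

variable {E : Type*} [NormedAddCommGroup E] [NormedSpace ℝ E] [FiniteDimensional ℝ E]
  [MeasureSpace E] [BorelSpace E] [(volume : Measure E).IsAddHaarMeasure]

/-- `w` is the distributional derivative of `u` in the direction `e`, on the whole space `E`. -/
def IsWD (e : E) (u w : E → ℝ) : Prop :=
  ∀ ζ : E → ℝ, ContDiff ℝ ∞ ζ → HasCompactSupport ζ →
    ∫ z, u z * fderiv ℝ ζ z e = - ∫ z, w z * ζ z

lemma integrable_mul_test {u ζ : E → ℝ} (hu : LocallyIntegrable u volume) (hζ : Continuous ζ)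
    (hc : HasCompactSupport ζ) : Integrable (fun z => u z * ζ z) := by
  have := hu.integrable_smul_right_of_hasCompactSupport hζ hc
  simpa [smul_eq_mul] using this

lemma contDiff_fderiv_apply {ζ : E → ℝ} (hζ : ContDiff ℝ ∞ ζ) (e : E) :
    ContDiff ℝ ∞ (fun z => fderiv ℝ ζ z e) :=
  (hζ.fderiv_right (m := ∞) (by simp)).clm_apply contDiff_const

lemma hasCompactSupport_fderiv_apply {ζ : E → ℝ} (hc : HasCompactSupport ζ) (e : E) :
    HasCompactSupport (fun z => fderiv ℝ ζ z e) :=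
  hc.fderiv_apply ℝ e

lemma IsWD.add {e : E} {u w u' w' : E → ℝ} (h : IsWD e u w) (h' : IsWD e u' w')
    (hu : LocallyIntegrable u volume) (hw : LocallyIntegrable w volume)
    (hu' : LocallyIntegrable u' volume) (hw' : LocallyIntegrable w' volume) :
    IsWD e (fun z => u z + u' z) (fun z => w z + w' z) := by
  intro ζ hζ hc
  have hd := (contDiff_fderiv_apply hζ e).continuous
  have hdc := hasCompactSupport_fderiv_apply hc e
  simp_rw [add_mul]
  rw [integral_add (integrable_mul_test hu hd hdc) (integrable_mul_test hu' hd hdc),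
    integral_add (integrable_mul_test hw hζ.continuous hc)
      (integrable_mul_test hw' hζ.continuous hc), h ζ hζ hc, h' ζ hζ hc]
  ring

lemma IsWD.const_mul {e : E} {u w : E → ℝ} (h : IsWD e u w) (c : ℝ) :
    IsWD e (fun z => c * u z) (fun z => c * w z) := by
  intro ζ hζ hc
  simp_rw [mul_assoc, integral_const_mul, h ζ hζ hc]
  ring

lemma IsWD.of_contDiff {e : E} {u w : E → ℝ} (hu : Differentiable ℝ u) (hw : Continuous w)
    (h : ∀ z, fderiv ℝ u z e = w z) : IsWD e u w := by
  intro ζ hζ hc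
  have hd := (contDiff_fderiv_apply hζ e).continuous
  have hdc := hasCompactSupport_fderiv_apply hc e
  rw [integral_mul_fderiv_eq_neg_fderiv_mul_of_integrable]
  · simp_rw [h]
  · simp_rw [h]
    exact integrable_mul_test hw.locallyIntegrable hζ.continuous hc
  · exact integrable_mul_test hu.continuous.locallyIntegrable hd hdc
  · exact integrable_mul_test hu.continuous.locallyIntegrable hζ.continuous hc
  · exact fun x _ => hu x
  · exact fun x _ => hζ.differentiable (by simp) x

/-- Smooth bump functions with supports shrinking to the origin. -/
def bumpSeq (n : ℕ) : ContDiffBump (0 : E) where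
  rIn := 1 / (2 * ((n : ℝ) + 1))
  rOut := 1 / ((n : ℝ) + 1)
  rIn_pos := by positivity
  rIn_lt_rOut := by
    apply one_div_lt_one_div_of_lt <;> nlinarith [(Nat.cast_nonneg n : (0 : ℝ) ≤ n)]

/-- The mollifier kernels: nonnegative, smooth, compactly supported, of integral one. -/
def kern (n : ℕ) : E → ℝ := (bumpSeq (E := E) n).normed volume

/-- The mollification of `u`. -/
def moll (n : ℕ) (u : E → ℝ) : E → ℝ := fun z => ∫ t, kern n (z - t) * u t

lemma kern_nonneg (n : ℕ) (z : E) : 0 ≤ kern n z := (bumpSeq n).nonneg_normed z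

lemma kern_contDiff (n : ℕ) : ContDiff ℝ ∞ (kern n : E → ℝ) :=
  (bumpSeq n).contDiff_normed

lemma kern_hasCompactSupport (n : ℕ) : HasCompactSupport (kern n : E → ℝ) :=
  (bumpSeq n).hasCompactSupport_normed

lemma integral_kern (n : ℕ) : ∫ t : E, kern n t = 1 := (bumpSeq n).integral_normed

lemma integrable_kern (n : ℕ) : Integrable (kern n : E → ℝ) :=
  (kern_contDiff n).continuous.integrable_of_hasCompactSupport (kern_hasCompactSupport n)

lemma moll_eq_convolution (n : ℕ) (u : E → ℝ) :
    moll n u = (kern n ⋆[ContinuousLinearMap.lsmul ℝ ℝ, volume] u) := by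
  ext z
  rw [convolution_eq_swap]
  rfl

lemma kern_sub_contDiff (n : ℕ) (z : E) : ContDiff ℝ ∞ (fun t : E => kern n (z - t)) :=
  (kern_contDiff n).comp (contDiff_const.sub contDiff_id)

lemma kern_sub_hasCompactSupport (n : ℕ) (z : E) :
    HasCompactSupport (fun t : E => kern n (z - t)) :=
  (kern_hasCompactSupport n).comp_homeomorph (Homeomorph.subLeft z)

lemma integrable_kern_sub_mul {u : E → ℝ} (hu : LocallyIntegrable u volume) (n : ℕ) (z : E) :
    Integrable (fun t => kern n (z - t) * u t) := by
  simpa [mul_comm] using integrable_mul_test hu (kern_sub_contDiff n z).continuous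
    (kern_sub_hasCompactSupport n z)

lemma moll_contDiff {u : E → ℝ} (hu : LocallyIntegrable u volume) (n : ℕ) :
    ContDiff ℝ ∞ (moll n u) := by
  rw [moll_eq_convolution]
  exact (kern_hasCompactSupport n).contDiff_convolution_left _ (kern_contDiff n) hu

/-- Differentiation falls on the kernel, and `t ↦ kern n (z - t)` is an admissible test function.
The sign from the reflection cancels the sign of integration by parts. -/
lemma fderiv_moll {e : E} {u w : E → ℝ} (hu : LocallyIntegrable u volume) (h : IsWD e u w)
    (n : ℕ) (z : E) : fderiv ℝ (moll n u) z e = moll n w z := by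
  have h1 := (kern_hasCompactSupport (E := E) n).hasFDerivAt_convolution_left
      (ContinuousLinearMap.lsmul ℝ ℝ : ℝ →L[ℝ] ℝ →L[ℝ] ℝ)
      ((kern_contDiff (E := E) n).of_le (by exact_mod_cast le_top)) hu z
  rw [← moll_eq_convolution] at h1
  rw [h1.fderiv, convolution_eq_swap]
  have hint : Integrable (fun t => (ContinuousLinearMap.precompL E
      (ContinuousLinearMap.lsmul ℝ ℝ : ℝ →L[ℝ] ℝ →L[ℝ] ℝ)) (fderiv ℝ (kern n) (z - t)) (u t)) := by
    have := ((kern_hasCompactSupport (E := E) n).fderiv ℝ).convolutionExists_left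
      (ContinuousLinearMap.precompL E (ContinuousLinearMap.lsmul ℝ ℝ : ℝ →L[ℝ] ℝ →L[ℝ] ℝ))
      ((kern_contDiff (E := E) n).continuous_fderiv (by simp)) hu z
    exact this.integrable_swap
  rw [ContinuousLinearMap.integral_apply hint]
  have h2 := h _ (kern_sub_contDiff n z) (kern_sub_hasCompactSupport n z)
  have h3 : ∀ t, fderiv ℝ (fun t : E => kern n (z - t)) t e = - fderiv ℝ (kern n) (z - t) e := by
    intro t
    have hd : HasFDerivAt (kern n : E → ℝ) (fderiv ℝ (kern n) (z - t)) (z - t) :=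
      ((kern_contDiff (E := E) n).differentiable (by simp) _).hasFDerivAt
    have := hd.comp t ((hasFDerivAt_const z t).sub (hasFDerivAt_id t))
    have h4 := this.fderiv
    simp only [Function.comp_def] at h4
    erw [h4]
    simp
  simp_rw [h3] at h2
  simp only [moll]
  calc _ = ∫ t, -(u t * -fderiv ℝ (kern n) (z - t) e) := by
        congr 1; ext t; simp [ContinuousLinearMap.precompL_apply]; ring
    _ = _ := by
        rw [integral_neg, h2, neg_neg]; congr 1; ext t; ring

lemma moll_tendsto_ae {u : E → ℝ} (hu : LocallyIntegrable u volume) :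
    ∀ᵐ z : E, Tendsto (fun n => moll n u z) atTop (𝓝 (u z)) := by
  simp_rw [moll_eq_convolution]
  -- Outer radii are twice the inner ones; the a.e. convergence theorem needs this ratio bounded.
  refine ContDiffBump.ae_convolution_tendsto_right_of_locallyIntegrable (K := 2) ?_ ?_ hu
  · exact tendsto_one_div_add_atTop_nhds_zero_nat
  · refine Eventually.of_forall fun n => ?_
    simp only [bumpSeq]
    field_simp
    exact le_refl _

lemma integral_kern_sub (n : ℕ) (z : E) : ∫ t, kern n (z - t) = 1 := by
  rw [integral_sub_left_eq_self (fun t : E => kern n t) volume z]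
  exact integral_kern n

lemma moll_mono {u v : E → ℝ} (hu : LocallyIntegrable u volume) (hv : LocallyIntegrable v volume)
    (h : ∀ᵐ z, u z ≤ v z) (n : ℕ) (z : E) : moll n u z ≤ moll n v z := by
  refine integral_mono_ae (integrable_kern_sub_mul hu n z) (integrable_kern_sub_mul hv n z) ?_
  filter_upwards [h] with t ht using mul_le_mul_of_nonneg_left ht (kern_nonneg n _)

lemma moll_const (c : ℝ) (n : ℕ) (z : E) : moll n (fun _ => c) z = c := by
  simp only [moll]
  rw [integral_mul_const, integral_kern_sub, one_mul]

end WeakDerivatives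

/-! ### Maximum principle for ω - Δ on the plane. -/

/-- The second derivative at a local maximum is nonpositive. -/
lemma second_deriv_nonpos_of_isLocalMax {q q' : ℝ → ℝ} {s q₂ : ℝ}
    (h1 : ∀ t, HasDerivAt q (q' t) t) (h2 : HasDerivAt q' q₂ s) (hm : IsLocalMax q s) :
    q₂ ≤ 0 := by
  by_contra! hpos
  have hd : deriv q = q' := funext fun t => (h1 t).deriv
  have h0 : deriv q s = 0 := hm.deriv_eq_zero
  -- A positive second derivative would make `s` a local minimum as well, so `q` would be constant
  -- near `s`.
  have hmin : IsLocalMin q s :=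
    isLocalMin_of_deriv_deriv_pos (by rw [hd, h2.deriv]; exact hpos) h0
      (h1 s).continuousAt
  have hev : q =ᶠ[𝓝 s] fun _ => q s := by
    filter_upwards [hm, hmin] with t ht1 ht2 using le_antisymm ht1 ht2
  have h3 : deriv q =ᶠ[𝓝 s] deriv (fun _ => q s) := hev.deriv
  have h4 := h3.deriv_eq
  rw [hd, h2.deriv] at h4
  simp at h4
  linarith

/-- Classical maximum principle for `ω - Δ` on the plane, for functions bounded from above. -/
lemma nonpos_of_classical_subsolution {ω B : ℝ} (hω : 0 < ω) {U Ux Uy Uxx Uyy : ℝ × ℝ → ℝ}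
    (hU : Continuous U) (hB : ∀ z, U z ≤ B)
    (hx : ∀ x y, HasDerivAt (fun t => U (t, y)) (Ux (x, y)) x)
    (hxx : ∀ x y, HasDerivAt (fun t => Ux (t, y)) (Uxx (x, y)) x)
    (hy : ∀ x y, HasDerivAt (fun t => U (x, t)) (Uy (x, y)) y)
    (hyy : ∀ x y, HasDerivAt (fun t => Uy (x, t)) (Uyy (x, y)) y)
    (hsub : ∀ z, ω * U z - Uxx z - Uyy z ≤ 0) (z : ℝ × ℝ) : U z ≤ 0 := by
  -- The quadratic penalty forces a maximum to exist. There `Uxx, Uyy ≤ 2δ`, so `ω U ≤ 4δ`, which is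
  -- the term `4 / ω`. Small `δ` concludes.
  have key : ∀ δ : ℝ, 0 < δ → U z ≤ δ * (z.1 ^ 2 + z.2 ^ 2 + 4 / ω) := by
    intro δ hδ
    set V : ℝ × ℝ → ℝ := fun z => U z - δ * (z.1 ^ 2 + z.2 ^ 2) with hV
    have hVc : Continuous V := by fun_prop
    have hlim : Tendsto V (cocompact (ℝ × ℝ)) atBot := by
      have h1 : Tendsto (fun z : ℝ × ℝ => B - δ * ‖z‖ ^ 2) (cocompact (ℝ × ℝ)) atBot := by
        have h2 : Tendsto (fun z : ℝ × ℝ => δ * ‖z‖ ^ 2) (cocompact (ℝ × ℝ)) atTop :=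
          Tendsto.const_mul_atTop hδ
            ((tendsto_pow_atTop two_ne_zero).comp (tendsto_norm_cocompact_atTop (E := ℝ × ℝ)))
        simpa [sub_eq_add_neg] using
          tendsto_atBot_add_const_left _ B (tendsto_neg_atTop_atBot.comp h2)
      refine tendsto_atBot_mono (fun z => ?_) h1
      have h3 : ‖z‖ ^ 2 ≤ z.1 ^ 2 + z.2 ^ 2 := by
        rw [Prod.norm_def]
        rcases max_cases ‖z.1‖ ‖z.2‖ with h | h <;> rw [h.1] <;>
          simp only [Real.norm_eq_abs, sq_abs] <;> nlinarith [sq_nonneg z.1, sq_nonneg z.2]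
      have := hB z
      have := mul_le_mul_of_nonneg_left h3 hδ.le
      simp only [hV]
      linarith
    obtain ⟨m, hm⟩ := hVc.exists_forall_ge hlim
    obtain ⟨x, y⟩ := m
    have hsq : ∀ c t : ℝ, HasDerivAt (fun t : ℝ => δ * (t ^ 2 + c)) (δ * (2 * t)) t := by
      intro c t
      simpa using (((hasDerivAt_id t).pow 2).add_const c).const_mul δ
    have hlin : ∀ t : ℝ, HasDerivAt (fun t : ℝ => δ * (2 * t)) (δ * 2) t := by
      intro t
      simpa using ((hasDerivAt_id t).const_mul 2).const_mul δ
    have hxx' : Uxx (x, y) - δ * 2 ≤ 0 := by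
      refine second_deriv_nonpos_of_isLocalMax (q := fun t => U (t, y) - δ * (t ^ 2 + y ^ 2))
        (q' := fun t => Ux (t, y) - δ * (2 * t)) (s := x)
        (fun t => (hx t y).sub (hsq _ t)) ((hxx x y).sub (hlin x)) ?_
      exact Eventually.of_forall fun t => hm (t, y)
    have hyy' : Uyy (x, y) - δ * 2 ≤ 0 := by
      refine second_deriv_nonpos_of_isLocalMax (q := fun t => U (x, t) - δ * (t ^ 2 + x ^ 2))
        (q' := fun t => Uy (x, t) - δ * (2 * t)) (s := y)
        (fun t => (hy x t).sub (hsq _ t)) ((hyy x y).sub (hlin y)) ?_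
      refine Eventually.of_forall fun t => ?_
      have := hm (x, t)
      simp only [hV] at this
      simp only
      linarith
    have h5 : U (x, y) ≤ δ * (4 / ω) := by
      have := hsub (x, y)
      have h6 : ω * U (x, y) ≤ 4 * δ := by linarith
      rw [← mul_div_assoc, le_div_iff₀ hω]
      linarith
    have h7 := hm z
    simp only [hV] at h7
    have : 0 ≤ δ * (x ^ 2 + y ^ 2) := by positivity
    nlinarith
  by_contra! hpos
  set Q := z.1 ^ 2 + z.2 ^ 2 + 4 / ω with hQ
  have hQpos : 0 < Q := by positivity
  have := key (U z / (2 * Q)) (by positivity)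
  rw [div_mul_eq_mul_div, mul_comm 2 Q, ← div_div, mul_div_assoc, div_self hQpos.ne'] at this
  linarith

/-- The derivative of a smooth function on the plane along the first variable. -/
lemma hasDerivAt_fst {f : ℝ × ℝ → ℝ} (hf : Differentiable ℝ f) (x y : ℝ) :
    HasDerivAt (fun t => f (t, y)) (fderiv ℝ f (x, y) (1, 0)) x :=
  (hf (x, y)).hasFDerivAt.comp_hasDerivAt x ((hasDerivAt_id x).prodMk (hasDerivAt_const x y))

/-- The derivative of a smooth function on the plane along the second variable. -/
lemma hasDerivAt_snd {f : ℝ × ℝ → ℝ} (hf : Differentiable ℝ f) (x y : ℝ) :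
    HasDerivAt (fun t => f (x, t)) (fderiv ℝ f (x, y) (0, 1)) y :=
  (hf (x, y)).hasFDerivAt.comp_hasDerivAt y ((hasDerivAt_const y x).prodMk (hasDerivAt_id y))

/-- Weak maximum principle for `ω - Δ` on the plane, for bounded functions. -/
lemma ae_nonpos_of_weak_subsolution {ω B : ℝ} (hω : 0 < ω) {u ux uy uxx uyy : ℝ × ℝ → ℝ}
    (lu : LocallyIntegrable u volume) (lux : LocallyIntegrable ux volume)
    (luy : LocallyIntegrable uy volume) (luxx : LocallyIntegrable uxx volume)
    (luyy : LocallyIntegrable uyy volume)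
    (hx : IsWD (1, 0) u ux) (hxx : IsWD (1, 0) ux uxx)
    (hy : IsWD (0, 1) u uy) (hyy : IsWD (0, 1) uy uyy)
    (hB : ∀ᵐ z, u z ≤ B) (hsub : ∀ᵐ z, ω * u z - uxx z - uyy z ≤ 0) :
    ∀ᵐ z, u z ≤ 0 := by
  have dd : ∀ {f : ℝ × ℝ → ℝ}, LocallyIntegrable f volume → ∀ n, Differentiable ℝ (moll n f) :=
    fun hf n => (moll_contDiff hf n).differentiable (by simp)
  -- Mollification commutes with the constant-coefficient operator, and a nonnegative kernel of mass
  -- one preserves both the upper bound and the inequality. The mollified function is thus a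
  -- classical subsolution.
  have hn : ∀ n z, moll n u z ≤ 0 := by
    intro n
    refine nonpos_of_classical_subsolution (B := B) hω (Ux := moll n ux) (Uy := moll n uy)
      (Uxx := moll n uxx) (Uyy := moll n uyy) (moll_contDiff lu n).continuous ?_ ?_ ?_ ?_ ?_ ?_
    · intro z
      exact (moll_mono lu (locallyIntegrable_const B) hB n z).trans (moll_const B n z).le
    · intro x y; rw [← fderiv_moll lu hx n]; exact hasDerivAt_fst (dd lu n) x y
    · intro x y; rw [← fderiv_moll lux hxx n]; exact hasDerivAt_fst (dd lux n) x y
    · intro x y; rw [← fderiv_moll lu hy n]; exact hasDerivAt_snd (dd lu n) x y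
    · intro x y; rw [← fderiv_moll luy hyy n]; exact hasDerivAt_snd (dd luy n) x y
    · intro z
      have h1 : moll n (fun z => ω * u z - uxx z - uyy z) z ≤ moll n (fun _ => (0 : ℝ)) z :=
        moll_mono (((lu.smul ω).sub luxx).sub luyy) (locallyIntegrable_const 0) hsub n z
      rw [moll_const] at h1
      have h2 : moll n (fun z => ω * u z - uxx z - uyy z) z
          = ω * moll n u z - moll n uxx z - moll n uyy z := by
        simp only [moll]
        have i1 := (integrable_kern_sub_mul lu n z).const_mul ω
        have i2 : Integrable fun t => ω * (kern n (z - t) * u t) - kern n (z - t) * uxx t :=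
          i1.sub (integrable_kern_sub_mul luxx n z)
        rw [← integral_const_mul, ← integral_sub i1 (integrable_kern_sub_mul luxx n z),
          ← integral_sub i2 (integrable_kern_sub_mul luyy n z)]
        congr 1; ext t; ring
      linarith
  filter_upwards [moll_tendsto_ae lu] with z hz
  exact le_of_tendsto hz (Eventually.of_forall fun n => hn n z)

/-! ### Young's inequality, L² pairings and integration by parts in L²(ℝ). -/

/-- Cauchy–Schwarz with a weight. -/
lemma sq_lintegral_mul_le {X : Type*} [MeasurableSpace X] {μ : Measure X} {k f : X → ℝ≥0∞}
    (hk : AEMeasurable k μ) (hf : AEMeasurable f μ) :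
    (∫⁻ t, k t * f t ∂μ) ^ 2 ≤ (∫⁻ t, k t ∂μ) * ∫⁻ t, k t * f t ^ 2 ∂μ := by
  have h := ENNReal.lintegral_mul_le_Lp_mul_Lq μ Real.HolderConjugate.two_two
    (hk.pow_const (1 / 2 : ℝ)) ((hk.pow_const (1 / 2 : ℝ)).mul hf)
  have e1 : ∀ a : ℝ≥0∞, (a ^ (1 / 2 : ℝ)) ^ (2 : ℝ) = a := by
    intro a; rw [← ENNReal.rpow_mul]; norm_num
  have e2 : ∀ a : ℝ≥0∞, a ^ (1 / 2 : ℝ) * a ^ (1 / 2 : ℝ) = a := by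
    intro a; rw [← ENNReal.rpow_add_of_nonneg _ _ (by norm_num) (by norm_num)]; norm_num
  simp only [Pi.mul_apply, ← mul_assoc, e2] at h
  simp only [ENNReal.mul_rpow_of_nonneg _ _ (by norm_num : (0 : ℝ) ≤ 2), e1] at h
  calc (∫⁻ t, k t * f t ∂μ) ^ 2
      ≤ ((∫⁻ t, k t ∂μ) ^ (1 / 2 : ℝ) * (∫⁻ t, k t * f t ^ (2 : ℝ) ∂μ) ^ (1 / 2 : ℝ)) ^ 2 := by
        gcongr
    _ = _ := by
        rw [mul_pow]
        simp only [← ENNReal.rpow_two, e1]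

/-- Young's inequality for the convolution of an integrable kernel with a square integrable
function. -/
lemma lintegral_sq_convolution_le {k f : ℝ → ℝ≥0∞} (hk : Measurable k)
    (hf : AEMeasurable f) :
    ∫⁻ x, (∫⁻ t, k (x - t) * f t) ^ 2 ≤ (∫⁻ t, k t) ^ 2 * ∫⁻ t, f t ^ 2 := by
  have hk' : ∀ x, ∫⁻ t, k (x - t) = ∫⁻ t, k t := fun x =>
    lintegral_sub_left_eq_self (fun t => k t) x
  have hm : AEMeasurable (Function.uncurry fun x t => k (x - t) * f t ^ 2)
      ((volume : Measure ℝ).prod volume) := by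
    refine AEMeasurable.mul (f := fun q : ℝ × ℝ => k (q.1 - q.2))
      (g := fun q : ℝ × ℝ => f q.2 ^ 2) ?_ ?_
    · exact (hk.comp (measurable_fst.sub measurable_snd)).aemeasurable
    · exact (hf.pow_const 2).comp_snd
  calc ∫⁻ x, (∫⁻ t, k (x - t) * f t) ^ 2
      ≤ ∫⁻ x, (∫⁻ t, k t) * ∫⁻ t, k (x - t) * f t ^ 2 := by
        refine lintegral_mono fun x => ?_
        rw [← hk' x]
        exact sq_lintegral_mul_le (hk.comp (measurable_const.sub measurable_id)).aemeasurable hf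
    _ = (∫⁻ t, k t) * ∫⁻ x, ∫⁻ t, k (x - t) * f t ^ 2 :=
        lintegral_const_mul'' _ hm.lintegral_prod_right'
    _ = (∫⁻ t, k t) * ∫⁻ t, ∫⁻ x, k (x - t) * f t ^ 2 := by
        rw [lintegral_lintegral_swap hm]
    _ = (∫⁻ t, k t) * ∫⁻ t, (∫⁻ x, k x) * f t ^ 2 := by
        congr 1
        refine lintegral_congr fun t => ?_
        rw [lintegral_mul_const (f := fun x => k (x - t)) _
            (hk.comp (measurable_id.sub measurable_const)),
          lintegral_sub_right_eq_self (fun x => k x) t]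
    _ = _ := by
        rw [lintegral_const_mul'' _ (hf.pow_const 2), sq, mul_assoc]

section L2

variable {X : Type*} [MeasurableSpace X] {μ : Measure X}

lemma integrable_mul_L2 {f g : X → ℝ} (hf : MemLp f 2 μ) (hg : MemLp g 2 μ) :
    Integrable (fun x => f x * g x) μ := hf.integrable_mul hg

lemma memLp_two_of_lintegral_sq {f : X → ℝ} (hm : AEStronglyMeasurable f μ)
    (h : ∫⁻ x, ENNReal.ofReal |f x| ^ 2 ∂μ < ∞) : MemLp f 2 μ := by
  rw [memLp_two_iff_integrable_sq hm]
  refine ⟨hm.pow 2, ?_⟩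
  rw [hasFiniteIntegral_iff_ofReal (Eventually.of_forall fun x => sq_nonneg _)]
  convert h using 3 with x
  rw [← ENNReal.ofReal_pow (abs_nonneg _), sq_abs]

lemma ofReal_integral_sq {f : X → ℝ} (hf : MemLp f 2 μ) :
    ENNReal.ofReal (∫ x, f x ^ 2 ∂μ) = ∫⁻ x, ENNReal.ofReal |f x| ^ 2 ∂μ := by
  rw [ofReal_integral_eq_lintegral_ofReal hf.integrable_sq
    (Eventually.of_forall fun x => sq_nonneg _)]
  refine lintegral_congr fun x => ?_
  rw [← ENNReal.ofReal_pow (abs_nonneg _), sq_abs]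

/-- Cauchy–Schwarz. -/
lemma sq_integral_mul_le {f g : X → ℝ} (hf : MemLp f 2 μ) (hg : MemLp g 2 μ) :
    (∫ x, f x * g x ∂μ) ^ 2 ≤ (∫ x, f x ^ 2 ∂μ) * ∫ x, g x ^ 2 ∂μ := by
  have h0 : ∀ t : ℝ, 0 ≤ (∫ x, g x ^ 2 ∂μ) * (t * t) + (2 * ∫ x, f x * g x ∂μ) * t
      + ∫ x, f x ^ 2 ∂μ := by
    intro t
    have : (∫ x, g x ^ 2 ∂μ) * (t * t) + (2 * ∫ x, f x * g x ∂μ) * t + ∫ x, f x ^ 2 ∂μ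
        = ∫ x, (f x + t * g x) ^ 2 ∂μ := by
      have i1 := (hg.integrable_sq).const_mul (t * t)
      have i2 := (integrable_mul_L2 hf hg).const_mul (2 * t)
      have i3 := hf.integrable_sq
      have i12 : Integrable (fun x => t * t * g x ^ 2 + 2 * t * (f x * g x)) μ := i1.add i2
      have : ∀ x, (f x + t * g x) ^ 2
          = t * t * g x ^ 2 + 2 * t * (f x * g x) + f x ^ 2 := fun x => by ring
      simp_rw [this]
      rw [integral_add i12 i3, integral_add i1 i2, integral_const_mul, integral_const_mul]
      ring
    rw [this]
    exact integral_nonneg fun x => sq_nonneg _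
  have := discrim_le_zero h0
  rw [discrim] at this
  nlinarith

lemma abs_integral_mul_le {f g : X → ℝ} (hf : MemLp f 2 μ) (hg : MemLp g 2 μ) :
    |∫ x, f x * g x ∂μ| ≤ √(∫ x, f x ^ 2 ∂μ) * √(∫ x, g x ^ 2 ∂μ) := by
  rw [← Real.sqrt_mul (integral_nonneg fun x => sq_nonneg _)]
  exact Real.abs_le_sqrt (sq_integral_mul_le hf hg)

lemma tendsto_integral_mul {f g : X → ℝ} {F G : ℕ → X → ℝ} (hf : MemLp f 2 μ) (hg : MemLp g 2 μ)
    (hF : ∀ n, MemLp (F n) 2 μ) (hG : ∀ n, MemLp (G n) 2 μ)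
    (cF : Tendsto (fun n => ∫ x, (F n x - f x) ^ 2 ∂μ) atTop (𝓝 0))
    (cG : Tendsto (fun n => ∫ x, (G n x - g x) ^ 2 ∂μ) atTop (𝓝 0)) :
    Tendsto (fun n => ∫ x, F n x * G n x ∂μ) atTop (𝓝 (∫ x, f x * g x ∂μ)) := by
  rw [tendsto_iff_norm_sub_tendsto_zero]
  have key : ∀ n, ‖(∫ x, F n x * G n x ∂μ) - ∫ x, f x * g x ∂μ‖
      ≤ √(∫ x, (F n x - f x) ^ 2 ∂μ) * √(∫ x, (G n x - g x) ^ 2 ∂μ)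
        + √(∫ x, (F n x - f x) ^ 2 ∂μ) * √(∫ x, g x ^ 2 ∂μ)
        + √(∫ x, f x ^ 2 ∂μ) * √(∫ x, (G n x - g x) ^ 2 ∂μ) := by
    intro n
    have hF' : MemLp (fun x => F n x - f x) 2 μ := (hF n).sub hf
    have hG' : MemLp (fun x => G n x - g x) 2 μ := (hG n).sub hg
    have j1 : Integrable (fun x => (F n x - f x) * (G n x - g x)) μ := hF'.integrable_mul hG'
    have j2 : Integrable (fun x => (F n x - f x) * g x) μ := hF'.integrable_mul hg
    have j3 : Integrable (fun x => f x * (G n x - g x)) μ := hf.integrable_mul hG'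
    have j12 : Integrable (fun x => (F n x - f x) * (G n x - g x) + (F n x - f x) * g x) μ :=
      j1.add j2
    have e : (∫ x, F n x * G n x ∂μ) - ∫ x, f x * g x ∂μ
        = (∫ x, (F n x - f x) * (G n x - g x) ∂μ) + (∫ x, (F n x - f x) * g x ∂μ)
          + ∫ x, f x * (G n x - g x) ∂μ := by
      rw [← integral_sub (integrable_mul_L2 (hF n) (hG n)) (integrable_mul_L2 hf hg),
        ← integral_add j1 j2, ← integral_add j12 j3]
      congr 1; ext x; ring
    rw [e, Real.norm_eq_abs]
    refine (abs_add_three _ _ _).trans ?_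
    gcongr
    · exact abs_integral_mul_le hF' hG'
    · exact abs_integral_mul_le hF' hg
    · exact abs_integral_mul_le hf hG'
  have sF := (Real.continuous_sqrt.tendsto 0).comp cF
  have sG := (Real.continuous_sqrt.tendsto 0).comp cG
  simp only [Real.sqrt_zero] at sF sG
  have lim := ((sF.mul sG).add (sF.mul_const (√(∫ x, g x ^ 2 ∂μ)))).add
    (sG.const_mul (√(∫ x, f x ^ 2 ∂μ)))
  simp only [mul_zero, zero_mul, add_zero] at lim
  exact squeeze_zero (fun n => norm_nonneg _) key lim

end L2

/-- Young's inequality with a kernel of mass one: mollification is a contraction of L²(ℝ). -/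
lemma moll_sq_le {f : ℝ → ℝ} (hf : MemLp f 2) (n : ℕ) :
    MemLp (moll n f) 2 ∧ ∫ x, moll n f x ^ 2 ≤ ∫ x, f x ^ 2 := by
  have hloc := hf.locallyIntegrable (by norm_num)
  have hk1 : ∫⁻ t : ℝ, ENNReal.ofReal (kern n t) = 1 := by
    rw [← ofReal_integral_eq_lintegral_ofReal (integrable_kern n)
      (Eventually.of_forall fun t => kern_nonneg n t), integral_kern, ENNReal.ofReal_one]
  have hpt : ∀ x, ENNReal.ofReal |moll n f x|
      ≤ ∫⁻ t, ENNReal.ofReal (kern n (x - t)) * ENNReal.ofReal |f t| := by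
    intro x
    refine (ENNReal.ofReal_le_ofReal (abs_integral_le_integral_abs)).trans ?_
    rw [ofReal_integral_eq_lintegral_ofReal (integrable_kern_sub_mul hloc n x).abs
      (Eventually.of_forall fun t => abs_nonneg _)]
    refine lintegral_mono fun t => ?_
    rw [abs_mul, abs_of_nonneg (kern_nonneg n _), ENNReal.ofReal_mul (kern_nonneg n _)]
  have hle : ∫⁻ x, ENNReal.ofReal |moll n f x| ^ 2 ≤ ∫⁻ x, ENNReal.ofReal |f x| ^ 2 := by
    calc _ ≤ ∫⁻ x, (∫⁻ t, ENNReal.ofReal (kern n (x - t)) * ENNReal.ofReal |f t|) ^ 2 :=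
          lintegral_mono fun x => by gcongr; exact hpt x
      _ ≤ _ := lintegral_sq_convolution_le (k := fun t => ENNReal.ofReal (kern n t))
          ((kern_contDiff n).continuous.measurable.ennreal_ofReal)
          (hf.aestronglyMeasurable.aemeasurable.abs.ennreal_ofReal)
      _ = _ := by rw [hk1]; simp
  rw [← ofReal_integral_sq hf] at hle
  have hm : MemLp (moll n f) 2 :=
    memLp_two_of_lintegral_sq (moll_contDiff hloc n).continuous.aestronglyMeasurable
      (hle.trans_lt ENNReal.ofReal_lt_top)
  refine ⟨hm, ?_⟩
  rw [← ofReal_integral_sq hm] at hle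
  exact (ENNReal.ofReal_le_ofReal_iff (integral_nonneg fun x => sq_nonneg _)).1 hle

/-- Mollifications converge in `L²(ℝ)`. -/
lemma moll_tendsto_L2 {f : ℝ → ℝ} (hf : MemLp f 2) :
    Tendsto (fun n => ∫ x, (moll n f x - f x) ^ 2) atTop (𝓝 0) := by
  have hloc := hf.locallyIntegrable (by norm_num)
  have hS : ∀ n, MemLp (fun x => moll n f x + f x) 2 := fun n => (moll_sq_le hf n).1.add hf
  -- Convergence follows from a.e. convergence and contractivity alone. The parallelogram law gives
  -- ‖fₙ - f‖² ≤ 4‖f‖² - ‖fₙ + f‖², and Fatou's lemma gives liminf ‖fₙ + f‖² ≥ 4‖f‖².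
  have hfatou : ENNReal.ofReal (4 * ∫ x, f x ^ 2)
      ≤ liminf (fun n => ENNReal.ofReal (∫ x, (moll n f x + f x) ^ 2)) atTop := by
    simp_rw [ofReal_integral_sq (hS _)]
    have e : ENNReal.ofReal (4 * ∫ x, f x ^ 2)
        = ∫⁻ x, liminf (fun n => ENNReal.ofReal |moll n f x + f x| ^ 2) atTop := by
      rw [← integral_const_mul, ofReal_integral_eq_lintegral_ofReal (hf.integrable_sq.const_mul 4)
        (Eventually.of_forall fun x => by positivity)]
      refine lintegral_congr_ae ?_
      filter_upwards [moll_tendsto_ae hloc] with x hx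
      have : Tendsto (fun n => ENNReal.ofReal |moll n f x + f x| ^ 2) atTop
          (𝓝 (ENNReal.ofReal |f x + f x| ^ 2)) :=
        ((ENNReal.continuous_pow 2).tendsto _).comp
          ((ENNReal.continuous_ofReal.tendsto _).comp ((hx.add_const (f x)).abs))
      rw [this.liminf_eq, ← ENNReal.ofReal_pow (abs_nonneg _), sq_abs]
      congr 1; ring
    rw [e]
    refine lintegral_liminf_le' fun n => ?_
    exact ((hS n).aestronglyMeasurable.aemeasurable.abs.ennreal_ofReal).pow_const 2
  have hD : ∀ n, ∫ x, (moll n f x - f x) ^ 2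
      ≤ 4 * (∫ x, f x ^ 2) - ∫ x, (moll n f x + f x) ^ 2 := by
    intro n
    have hmn := moll_sq_le hf n
    have i1 : Integrable (fun x => 2 * moll n f x ^ 2) := hmn.1.integrable_sq.const_mul 2
    have i2 : Integrable (fun x => 2 * f x ^ 2) := hf.integrable_sq.const_mul 2
    have i3 : Integrable (fun x => (moll n f x + f x) ^ 2) := (hS n).integrable_sq
    have i12 : Integrable (fun x => 2 * moll n f x ^ 2 + 2 * f x ^ 2) := i1.add i2
    have : ∀ x, (moll n f x - f x) ^ 2
        = 2 * moll n f x ^ 2 + 2 * f x ^ 2 - (moll n f x + f x) ^ 2 := fun x => by ring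
    simp_rw [this]
    rw [integral_sub i12 i3, integral_add i1 i2, integral_const_mul, integral_const_mul]
    linarith [hmn.2]
  rw [Metric.tendsto_atTop']
  intro ε hε
  have hI : 0 ≤ ∫ x, f x ^ 2 := integral_nonneg fun x => sq_nonneg _
  have hev : ∀ᶠ n in atTop, 4 * (∫ x, f x ^ 2) - ε < ∫ x, (moll n f x + f x) ^ 2 := by
    rcases lt_or_ge (4 * (∫ x, f x ^ 2) - ε) 0 with hneg | hnn
    · exact Eventually.of_forall fun n => hneg.trans_le (integral_nonneg fun x => sq_nonneg _)
    · have hlt : ENNReal.ofReal (4 * (∫ x, f x ^ 2) - ε) < ENNReal.ofReal (4 * ∫ x, f x ^ 2) := by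
        rw [ENNReal.ofReal_lt_ofReal_iff (by linarith)]; linarith
      filter_upwards [eventually_lt_of_lt_liminf (hlt.trans_le hfatou)] with n hn
      exact (ENNReal.ofReal_lt_ofReal_iff_of_nonneg hnn).1 hn
  obtain ⟨N, hN⟩ := eventually_atTop.1 hev
  refine ⟨N, fun n hn => ?_⟩
  have := hN n hn.le
  rw [Real.dist_eq, sub_zero, abs_of_nonneg (integral_nonneg fun x => sq_nonneg _)]
  linarith [hD n]

/-- Integration by parts for weakly differentiable functions in `L²(ℝ)`. -/
lemma IsWD.integral_mul_eq {f f' v v' : ℝ → ℝ} (hf : MemLp f 2) (hf' : MemLp f' 2)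
    (hv : MemLp v 2) (hv' : MemLp v' 2) (wf : IsWD (1 : ℝ) f f') (wv : IsWD (1 : ℝ) v v') :
    ∫ x, f' x * v x = - ∫ x, f x * v' x := by
  have lf := hf.locallyIntegrable (by norm_num)
  have lv := hv.locallyIntegrable (by norm_num)
  have dm : ∀ {u u' : ℝ → ℝ}, LocallyIntegrable u volume → IsWD (1 : ℝ) u u' → ∀ n x,
      HasDerivAt (moll n u) (moll n u' x) x := by
    intro u u' lu wu n x
    have h1 := ((moll_contDiff lu n).differentiable (by simp) x).hasDerivAt
    have h2 := fderiv_moll lu wu n x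
    rw [fderiv_apply_one_eq_deriv] at h2
    rwa [h2] at h1
  have hn : ∀ n, ∫ x, moll n f' x * moll n v x = - ∫ x, moll n f x * moll n v' x := by
    intro n
    have := integral_mul_deriv_eq_deriv_mul_of_integrable (u := moll n f) (v := moll n v)
      (u' := moll n f') (v' := moll n v') (fun x _ => dm lf wf n x) (fun x _ => dm lv wv n x)
      ((moll_sq_le hf n).1.integrable_mul (moll_sq_le hv' n).1)
      ((moll_sq_le hf' n).1.integrable_mul (moll_sq_le hv n).1)
      ((moll_sq_le hf n).1.integrable_mul (moll_sq_le hv n).1)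
    linarith
  have t1 := tendsto_integral_mul hf' hv (fun n => (moll_sq_le hf' n).1)
    (fun n => (moll_sq_le hv n).1) (moll_tendsto_L2 hf') (moll_tendsto_L2 hv)
  have t2 := tendsto_integral_mul hf hv' (fun n => (moll_sq_le hf n).1)
    (fun n => (moll_sq_le hv' n).1) (moll_tendsto_L2 hf) (moll_tendsto_L2 hv')
  simp_rw [hn] at t1
  exact tendsto_nhds_unique t1 t2.neg

/-! ### Hyperbolic profiles, their derivatives and exponential bounds. -/

/-- `tanh (b x)`. -/
def th (b x : ℝ) : ℝ := Real.sinh (b * x) / Real.cosh (b * x)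

/-- `sech (b x) ^ s`. -/
def sechPow (b s x : ℝ) : ℝ := Real.cosh (b * x) ^ (-s)

lemma th_sq_le_one (b x : ℝ) : th b x ^ 2 ≤ 1 := by
  rw [th, div_pow, div_le_one (by have := Real.cosh_pos (b * x); positivity)]
  nlinarith [Real.cosh_sq (b * x)]

lemma one_sub_th_sq (b x : ℝ) : 1 - th b x ^ 2 = (1 / Real.cosh (b * x)) ^ 2 := by
  have h := Real.cosh_pos (b * x)
  rw [th]
  field_simp
  nlinarith [Real.cosh_sq (b * x)]

lemma abs_th_le_one (b x : ℝ) : |th b x| ≤ 1 := by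
  rw [← sq_le_one_iff_abs_le_one]; exact th_sq_le_one b x

lemma contDiff_cosh_mul {n : WithTop ℕ∞} (b : ℝ) : ContDiff ℝ n (fun x => Real.cosh (b * x)) :=
  Real.contDiff_cosh.comp (contDiff_const.mul contDiff_id)

lemma contDiff_th {n : WithTop ℕ∞} (b : ℝ) : ContDiff ℝ n (th b) :=
  (Real.contDiff_sinh.comp (contDiff_const.mul contDiff_id)).div (contDiff_cosh_mul b)
    fun _ => (Real.cosh_pos _).ne'

lemma contDiff_sechPow {n : WithTop ℕ∞} (b s : ℝ) : ContDiff ℝ n (sechPow b s) :=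
  (contDiff_cosh_mul b).rpow_const_of_ne fun _ => (Real.cosh_pos _).ne'

lemma hasDerivAt_cosh_mul (b x : ℝ) :
    HasDerivAt (fun x => Real.cosh (b * x)) (b * Real.sinh (b * x)) x := by
  have := (Real.hasDerivAt_cosh (b * x)).comp x ((hasDerivAt_id x).const_mul b)
  simpa [Function.comp_def, mul_comm] using this

lemma hasDerivAt_th (b x : ℝ) : HasDerivAt (th b) (b * (1 - th b x ^ 2)) x := by
  have h1 : HasDerivAt (fun x => Real.sinh (b * x)) (b * Real.cosh (b * x)) x := by
    have := (Real.hasDerivAt_sinh (b * x)).comp x ((hasDerivAt_id x).const_mul b)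
    simpa [Function.comp_def, mul_comm] using this
  have h := h1.div (hasDerivAt_cosh_mul b x) (Real.cosh_pos _).ne'
  refine h.congr_deriv ?_
  have := Real.cosh_pos (b * x)
  rw [th]
  field_simp

lemma sechPow_pos (b s x : ℝ) : 0 < sechPow b s x := Real.rpow_pos_of_pos (Real.cosh_pos _) _

lemma hasDerivAt_sechPow (b s x : ℝ) :
    HasDerivAt (sechPow b s) (-(s * b) * th b x * sechPow b s x) x := by
  have h := (hasDerivAt_cosh_mul b x).rpow_const (p := -s) (Or.inl (Real.cosh_pos (b * x)).ne')
  refine h.congr_deriv ?_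
  have hc := Real.cosh_pos (b * x)
  rw [sechPow, th, Real.rpow_sub_one hc.ne']
  field_simp

/-- The factor in front of `sechPow b s x` is the potential `pot b s x` below: sech(bx)^s is a
zero-energy solution. -/
lemma hasDerivAt_sechPow_deriv (b s x : ℝ) :
    HasDerivAt (fun x => -(s * b) * th b x * sechPow b s x)
      (((s * b) ^ 2 * th b x ^ 2 - s * b * b * (1 - th b x ^ 2)) * sechPow b s x) x := by
  have h := ((hasDerivAt_th b x).const_mul (-(s * b))).mul (hasDerivAt_sechPow b s x)
  refine h.congr_deriv ?_
  ring

lemma exp_abs_le_two_cosh (t : ℝ) : Real.exp |t| ≤ 2 * Real.cosh t := by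
  rw [Real.cosh_eq]; linarith [Real.exp_abs_le t]

lemma cosh_le_exp_abs (t : ℝ) : Real.cosh t ≤ Real.exp |t| := by
  rw [← Real.cosh_abs, Real.cosh_eq]
  have : Real.exp (-|t|) ≤ Real.exp |t| := Real.exp_le_exp.2 (by linarith [abs_nonneg t])
  linarith

lemma exp_le_sechPow {b s : ℝ} (hb : 0 ≤ b) (hs : 0 ≤ s) (x : ℝ) :
    Real.exp (-(s * b) * |x|) ≤ sechPow b s x := by
  rw [sechPow, Real.rpow_neg (Real.cosh_pos _).le]
  have h1 : Real.cosh (b * x) ^ s ≤ Real.exp (s * b * |x|) := by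
    calc Real.cosh (b * x) ^ s ≤ Real.exp |b * x| ^ s :=
          Real.rpow_le_rpow (Real.cosh_pos _).le (cosh_le_exp_abs _) hs
      _ = _ := by rw [← Real.exp_mul, abs_mul, abs_of_nonneg hb]; ring_nf
  rw [neg_mul, Real.exp_neg]
  exact inv_anti₀ (Real.rpow_pos_of_pos (Real.cosh_pos _) _) h1

lemma sechPow_le_exp {b s : ℝ} (hb : 0 ≤ b) (hs : 0 ≤ s) (x : ℝ) :
    sechPow b s x ≤ 2 ^ s * Real.exp (-(s * b) * |x|) := by
  rw [sechPow, Real.rpow_neg (Real.cosh_pos _).le]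
  have h1 : Real.exp (s * b * |x|) ≤ 2 ^ s * Real.cosh (b * x) ^ s := by
    rw [← Real.mul_rpow (by norm_num) (Real.cosh_pos _).le]
    calc Real.exp (s * b * |x|) = Real.exp |b * x| ^ s := by
          rw [← Real.exp_mul, abs_mul, abs_of_nonneg hb]; ring_nf
      _ ≤ _ := Real.rpow_le_rpow (Real.exp_pos _).le (exp_abs_le_two_cosh _) hs
  have h2 := Real.rpow_pos_of_pos (Real.cosh_pos (b * x)) s
  rw [neg_mul, Real.exp_neg, inv_eq_one_div, div_le_iff₀ h2]
  have h3 := Real.exp_pos (s * b * |x|)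
  rw [mul_assoc, mul_comm _ (Real.cosh _ ^ s), ← mul_assoc, ← div_eq_mul_inv, le_div_iff₀ h3]
  linarith

lemma sechPow_le_one {b s : ℝ} (hs : 0 ≤ s) (x : ℝ) : sechPow b s x ≤ 1 :=
  Real.rpow_le_one_of_one_le_of_nonpos (Real.one_le_cosh _) (by linarith)

lemma integrable_exp_neg_mul_abs {c : ℝ} (hc : 0 < c) :
    Integrable (fun x : ℝ => Real.exp (-c * |x|)) := by
  rw [← integrableOn_univ, ← Set.Iic_union_Ioi (a := (0 : ℝ)), integrableOn_union]
  constructor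
  · refine (integrableOn_exp_mul_Iic hc 0).congr_fun (fun x hx => ?_) measurableSet_Iic
    rw [abs_of_nonpos hx]; ring_nf
  · refine (integrableOn_exp_mul_Ioi (neg_lt_zero.2 hc) 0).congr_fun (fun x hx => ?_)
      measurableSet_Ioi
    simp only [abs_of_pos (Set.mem_Ioi.1 hx)]

lemma memLp_two_sechPow {b s : ℝ} (hb : 0 < b) (hs : 0 < s) : MemLp (sechPow b s) 2 := by
  rw [memLp_two_iff_integrable_sq (contDiff_sechPow (n := 0) b s).continuous.aestronglyMeasurable]
  have h := (integrable_exp_neg_mul_abs (mul_pos hs hb)).const_mul (2 ^ s)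
  refine h.mono' ((contDiff_sechPow (n := 0) b s).continuous.pow 2).aestronglyMeasurable
    (Eventually.of_forall fun x => ?_)
  have h1 := sechPow_pos b s x
  have h2 := sechPow_le_one (b := b) hs.le x
  rw [Real.norm_of_nonneg (by positivity)]
  exact le_trans (by nlinarith) (sechPow_le_exp hb.le hs.le x)

/-- Multiplication by a smooth function. -/
lemma IsWD.smooth_mul {u w m m' : ℝ → ℝ} (h : IsWD (1 : ℝ) u w)
    (lu : LocallyIntegrable u volume) (lw : LocallyIntegrable w volume)
    (hm : ContDiff ℝ (⊤ : ℕ∞) m) (hm' : ∀ x, HasDerivAt m (m' x) x) :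
    IsWD (1 : ℝ) (fun x => m x * u x) (fun x => m' x * u x + m x * w x) := by
  intro ζ hζ hc
  have hmd : m' = deriv m := funext fun x => (hm' x).deriv.symm
  have hm'c : Continuous m' := by
    rw [hmd]; exact hm.continuous_deriv (by simp)
  have hmζ : ContDiff ℝ (⊤ : ℕ∞) (fun x => m x * ζ x) := hm.mul hζ
  have hmc : HasCompactSupport (fun x => m x * ζ x) := hc.mul_left
  have key := h _ hmζ hmc
  have hd : ∀ x, fderiv ℝ (fun x => m x * ζ x) x 1 = m' x * ζ x + m x * fderiv ℝ ζ x 1 := by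
    intro x
    rw [fderiv_apply_one_eq_deriv, fderiv_apply_one_eq_deriv]
    exact ((hm' x).mul (hζ.differentiable (by simp) x).hasDerivAt).deriv
  simp_rw [hd] at key
  have i1 : Integrable (fun x => u x * (m' x * ζ x)) :=
    integrable_mul_test lu (hm'c.mul hζ.continuous) hc.mul_left
  have i2 : Integrable (fun x => u x * (m x * fderiv ℝ ζ x 1)) :=
    integrable_mul_test lu (hm.continuous.mul (contDiff_fderiv_apply hζ 1).continuous)
      (hasCompactSupport_fderiv_apply hc 1).mul_left
  have i3 : Integrable (fun x => w x * (m x * ζ x)) :=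
    integrable_mul_test lw hmζ.continuous hmc
  have e1 : ∫ x, u x * (m' x * ζ x + m x * fderiv ℝ ζ x 1)
      = (∫ x, u x * (m' x * ζ x)) + ∫ x, u x * (m x * fderiv ℝ ζ x 1) := by
    rw [← integral_add i1 i2]; congr 1; ext x; ring
  have e2 : ∫ x, (m' x * u x + m x * w x) * ζ x
      = (∫ x, u x * (m' x * ζ x)) + ∫ x, w x * (m x * ζ x) := by
    rw [← integral_add i1 i3]; congr 1; ext x; ring
  have e3 : ∫ x, m x * u x * fderiv ℝ ζ x 1 = ∫ x, u x * (m x * fderiv ℝ ζ x 1) := by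
    congr 1; ext x; ring
  rw [e1] at key
  rw [e2, e3]
  linarith

/-- The tail integral is a weak primitive. -/
lemma IsWD.tail_integral {q : ℝ → ℝ} (hq : Integrable q) :
    IsWD (1 : ℝ) (fun x => ∫ t in Set.Ioi x, q t) (fun x => - q x) := by
  intro ζ hζ hc
  have hd : Integrable (fun x => deriv ζ x) :=
    (hζ.continuous_deriv (by simp)).integrable_of_hasCompactSupport hc.deriv
  have hprod : Integrable (fun z : ℝ × ℝ => deriv ζ z.1 * q z.2)
      ((volume : Measure ℝ).prod volume) := hd.mul_prod hq
  have hset : MeasurableSet {z : ℝ × ℝ | z.1 < z.2} :=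
    measurableSet_lt measurable_fst measurable_snd
  -- Fubini on the half-plane `x < t`: integrating `q` first gives the tail integral, integrating
  -- `deriv ζ` first gives `ζ t`.
  have hswap := integral_integral_swap (μ := (volume : Measure ℝ)) (ν := (volume : Measure ℝ))
    (f := fun x t => Set.indicator {z : ℝ × ℝ | z.1 < z.2} (fun z => deriv ζ z.1 * q z.2) (x, t))
    (hprod.indicator hset)
  have e1 : ∀ x, ∫ t, Set.indicator {z : ℝ × ℝ | z.1 < z.2} (fun z => deriv ζ z.1 * q z.2) (x, t)
      = (∫ t in Set.Ioi x, q t) * fderiv ℝ ζ x 1 := by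
    intro x
    rw [fderiv_apply_one_eq_deriv, mul_comm, ← integral_const_mul,
      ← integral_indicator measurableSet_Ioi]
    congr 1
  have e2 : ∀ t, ∫ x, Set.indicator {z : ℝ × ℝ | z.1 < z.2} (fun z => deriv ζ z.1 * q z.2) (x, t)
      = q t * ζ t := by
    intro t
    have h1 : ∫ x in Set.Iic t, deriv ζ x = ζ t :=
      HasCompactSupport.integral_Iic_deriv_eq (hζ.of_le (by exact_mod_cast le_top)) hc t
    rw [← h1, integral_Iic_eq_integral_Iio, mul_comm, ← integral_mul_const,
      ← integral_indicator measurableSet_Iio]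
    congr 1
  simp_rw [e1, e2] at hswap
  rw [hswap]
  simp [integral_neg]

lemma continuous_tail_integral {q : ℝ → ℝ} (hq : Integrable q) :
    Continuous (fun x => ∫ t in Set.Ioi x, q t) := by
  have h : (fun x => ∫ t in Set.Ioi x, q t)
      = fun x => (∫ t in Set.Ioi 0, q t) - ∫ t in (0 : ℝ)..x, q t := by
    ext x
    rw [← intervalIntegral.integral_Ioi_sub_Ioi' hq.integrableOn hq.integrableOn]
    ring
  rw [h]
  exact continuous_const.sub (intervalIntegral.continuous_primitive
    (fun _ _ => hq.intervalIntegrable) 0)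

lemma memLp_bdd_mul {X : Type*} [MeasurableSpace X] {μ : Measure X} {m f : X → ℝ} {C : ℝ}
    (hf : MemLp f 2 μ) (hm : AEStronglyMeasurable m μ) (hC : ∀ᵐ x ∂μ, |m x| ≤ C) :
    MemLp (fun x => m x * f x) 2 μ := by
  refine MemLp.of_le_mul (c := C) hf (hm.mul hf.aestronglyMeasurable) ?_
  filter_upwards [hC] with x hx
  rw [norm_mul]
  exact mul_le_mul_of_nonneg_right hx (norm_nonneg _)

lemma le_of_sq_le_mul {a c : ℝ} (hc : 0 ≤ c) (h : a ^ 2 ≤ c * a) : a ≤ c := by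
  by_contra! hlt
  nlinarith

/-! ### The factored operator A*A: spectral gap, high modes and resonant mode. -/

section GroundState

variable {b s : ℝ}

lemma continuous_th (b : ℝ) : Continuous (th b) := (contDiff_th (n := 0) b).continuous

lemma continuous_sechPow (b s : ℝ) : Continuous (sechPow b s) :=
  (contDiff_sechPow (n := 0) b s).continuous

lemma memLp_th_mul {f : ℝ → ℝ} (hf : MemLp f 2) (c : ℝ) :
    MemLp (fun x => c * th b x * f x) 2 :=
  memLp_bdd_mul (C := |c|) hf (continuous_const.mul (continuous_th b)).aestronglyMeasurable
    (Eventually.of_forall fun x => by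
      rw [abs_mul]; exact mul_le_of_le_one_right (abs_nonneg _) (abs_th_le_one b x))

lemma memLp_dth_mul {f : ℝ → ℝ} (hf : MemLp f 2) (c : ℝ) :
    MemLp (fun x => c * (1 - th b x ^ 2) * f x) 2 := by
  refine memLp_bdd_mul (C := |c|) hf
    (continuous_const.mul (continuous_const.sub ((continuous_th b).pow 2))).aestronglyMeasurable
    (Eventually.of_forall fun x => ?_)
  rw [abs_mul]
  refine mul_le_of_le_one_right (abs_nonneg _) ?_
  rw [abs_le]
  constructor <;> nlinarith [th_sq_le_one b x, sq_nonneg (th b x)]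

lemma IsWD.th_mul {f f' : ℝ → ℝ} (hf : MemLp f 2) (hf' : MemLp f' 2) (w : IsWD (1 : ℝ) f f')
    (c : ℝ) : IsWD (1 : ℝ) (fun x => c * th b x * f x)
      (fun x => c * b * (1 - th b x ^ 2) * f x + c * th b x * f' x) := by
  refine w.smooth_mul (hf.locallyIntegrable (by norm_num)) (hf'.locallyIntegrable (by norm_num))
    (contDiff_const.mul (contDiff_th b)) fun x => ?_
  exact ((hasDerivAt_th b x).const_mul c).congr_deriv (by ring)

lemma isWD_sechPow (b s : ℝ) :
    IsWD (1 : ℝ) (sechPow b s) (fun x => -(s * b) * th b x * sechPow b s x) := by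
  refine IsWD.of_contDiff ((contDiff_sechPow (n := 1) b s).differentiable (by simp))
    ((continuous_const.mul (continuous_th b)).mul (continuous_sechPow b s)) fun x => ?_
  rw [fderiv_apply_one_eq_deriv]
  exact (hasDerivAt_sechPow b s x).deriv

/-- Spectral gap of `A = ∂ + s b tanh (b x)` above its kernel, spanned by `sech (b x) ^ s`. -/
lemma exists_gap (hb : 0 < b) (hs : 0 < s) : ∃ C : ℝ, 0 < C ∧ ∀ f f' : ℝ → ℝ, MemLp f 2 →
    MemLp f' 2 → IsWD (1 : ℝ) f f' → ∫ x, f x * sechPow b s x = 0 →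
    ∫ x, f x ^ 2 ≤ C * ∫ x, (f' x + s * b * th b x * f x) ^ 2 := by
  -- Dominates g(t)/g(x), with g = sech(b·)^s, whenever `t` lies beyond `x` as seen from the origin.
  -- The gap constant is the square of its L¹ norm.
  set κ : ℝ → ℝ := fun t => 2 ^ s * Real.exp (-(s * b) * |t|) with hκ
  have hκpos : ∀ t, 0 ≤ κ t := fun t => by positivity
  have hκi : Integrable κ := (integrable_exp_neg_mul_abs (mul_pos hs hb)).const_mul _
  have hκc : Continuous κ := by fun_prop
  have hκ0 : 0 < ∫ t, κ t := by
    refine (integral_pos_iff_support_of_nonneg hκpos hκi).2 ?_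
    have : Function.support κ = Set.univ := by
      ext t; simp only [Function.mem_support, Set.mem_univ, iff_true, hκ]; positivity
    rw [this]; simp
  refine ⟨(∫ t, κ t) ^ 2, by positivity, ?_⟩
  intro f f' hf hf' w horth
  set g := sechPow b s with hg
  have hgL : MemLp g 2 := memLp_two_sechPow hb hs
  set q : ℝ → ℝ := fun t => g t * f t with hq
  have hqi : Integrable q := integrable_mul_L2 hgL hf
  have hq0 : ∫ t, q t = 0 := by rw [← horth]; congr 1; ext t; rw [hq]; ring
  set Φ : ℝ → ℝ := fun x => ∫ t in Set.Ioi x, q t with hΦ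
  -- The explicit solution k = g⁻¹ ∫_x^∞ g f of A*k = f, where A* = -∂ + s b tanh(bx).
  set k : ℝ → ℝ := fun x => sechPow b (-s) x * Φ x with hk
  have hinv : ∀ x, sechPow b (-s) x * g x = 1 := by
    intro x
    rw [hg, sechPow, sechPow, ← Real.rpow_add (Real.cosh_pos _)]; simp
  have hratio : ∀ x t, |t| = |x| + |x - t| → sechPow b (-s) x * g t ≤ κ (x - t) := by
    intro x t hxt
    have h1 : g t ≤ 2 ^ s * Real.exp (-(s * b) * |t|) := sechPow_le_exp hb.le hs.le t
    have h2 : Real.exp (-(s * b) * |x|) ≤ g x := exp_le_sechPow hb.le hs.le x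
    have h3 : g t ≤ κ (x - t) * g x := by
      refine h1.trans ?_
      rw [hκ]
      simp only
      rw [mul_assoc]
      refine mul_le_mul_of_nonneg_left ?_ (by positivity)
      calc Real.exp (-(s * b) * |t|)
          = Real.exp (-(s * b) * |x - t|) * Real.exp (-(s * b) * |x|) := by
            rw [← Real.exp_add, hxt]; ring_nf
        _ ≤ _ := mul_le_mul_of_nonneg_left h2 (Real.exp_pos _).le
    calc sechPow b (-s) x * g t ≤ sechPow b (-s) x * (κ (x - t) * g x) :=
          mul_le_mul_of_nonneg_left h3 (sechPow_pos _ _ _).le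
      _ = κ (x - t) * (sechPow b (-s) x * g x) := by ring
      _ = _ := by rw [hinv, mul_one]
  have hκm : ∀ x, AEMeasurable (fun t => ENNReal.ofReal (κ (x - t)) * ENNReal.ofReal |f t|) := by
    intro x
    exact ((hκc.comp (continuous_const.sub continuous_id)).measurable.ennreal_ofReal.aemeasurable).mul
      hf.aestronglyMeasurable.aemeasurable.abs.ennreal_ofReal
  have bound : ∀ x (S : Set ℝ), MeasurableSet S → (∀ t ∈ S, |t| = |x| + |x - t|) →
      ENNReal.ofReal |sechPow b (-s) x * ∫ t in S, q t|
        ≤ ∫⁻ t, ENNReal.ofReal (κ (x - t)) * ENNReal.ofReal |f t| := by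
    intro x S hS hxt
    rw [← integral_const_mul]
    refine (ENNReal.ofReal_le_ofReal abs_integral_le_integral_abs).trans ?_
    rw [ofReal_integral_eq_lintegral_ofReal ((hqi.integrableOn.const_mul _).abs)
      (Eventually.of_forall fun t => abs_nonneg _)]
    refine le_trans ?_ (setLIntegral_le_lintegral S _)
    refine setLIntegral_mono' hS fun t ht => ?_
    rw [← ENNReal.ofReal_mul (hκpos _), hq]
    refine ENNReal.ofReal_le_ofReal ?_
    simp only
    rw [← mul_assoc, abs_mul, abs_of_pos (mul_pos (sechPow_pos _ _ _) (sechPow_pos _ _ _))]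
    exact mul_le_mul_of_nonneg_right (hratio x t (hxt t ht)) (abs_nonneg _)
  have hkb : ∀ x, ENNReal.ofReal |k x|
      ≤ ∫⁻ t, ENNReal.ofReal (κ (x - t)) * ENNReal.ofReal |f t| := by
    intro x
    rcases le_total 0 x with hx | hx
    · refine bound x (Set.Ioi x) measurableSet_Ioi fun t ht => ?_
      have : x < t := ht
      rw [abs_of_nonneg hx, abs_of_pos (hx.trans_lt this), abs_of_neg (sub_neg.2 this)]; ring
    -- For `x ≤ 0` the integral over `t > x` crosses the origin and `κ` does not dominate it.
    -- Orthogonality to g trades it for the integral over `t ≤ x`.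
    · have h1 : Φ x = - ∫ t in Set.Iic x, q t := by
        have := intervalIntegral.integral_Iic_add_Ioi (f := q) (μ := volume) (b := x)
          hqi.integrableOn hqi.integrableOn
        rw [hq0] at this
        simp only [hΦ]; linarith
      have h2 : |k x| = |sechPow b (-s) x * ∫ t in Set.Iic x, q t| := by
        simp only [hk, h1]; rw [mul_neg, abs_neg]
      rw [h2]
      refine bound x (Set.Iic x) measurableSet_Iic fun t ht => ?_
      have : t ≤ x := ht
      rw [abs_of_nonpos hx, abs_of_nonpos (this.trans hx), abs_of_nonneg (sub_nonneg.2 this)]; ring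
  have hkc : Continuous k := (continuous_sechPow b (-s)).mul (continuous_tail_integral hqi)
  have hle : ∫⁻ x, ENNReal.ofReal |k x| ^ 2 ≤ ENNReal.ofReal ((∫ t, κ t) ^ 2 * ∫ x, f x ^ 2) := by
    calc _ ≤ ∫⁻ x, (∫⁻ t, ENNReal.ofReal (κ (x - t)) * ENNReal.ofReal |f t|) ^ 2 :=
          lintegral_mono fun x => by gcongr; exact hkb x
      _ ≤ _ := lintegral_sq_convolution_le (k := fun t => ENNReal.ofReal (κ t))
          hκc.measurable.ennreal_ofReal
          (hf.aestronglyMeasurable.aemeasurable.abs.ennreal_ofReal)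
      _ = _ := by
          rw [ENNReal.ofReal_mul (by positivity), ofReal_integral_sq hf,
            ENNReal.ofReal_pow hκ0.le, ofReal_integral_eq_lintegral_ofReal hκi
            (Eventually.of_forall hκpos)]
  have hkL : MemLp k 2 :=
    memLp_two_of_lintegral_sq hkc.aestronglyMeasurable (hle.trans_lt ENNReal.ofReal_lt_top)
  have hfn : 0 ≤ ∫ x, f x ^ 2 := integral_nonneg fun x => sq_nonneg _
  rw [← ofReal_integral_sq hkL, ENNReal.ofReal_le_ofReal_iff (by positivity)] at hle
  have hkw : IsWD (1 : ℝ) k (fun x => s * b * th b x * k x - f x) := by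
    have h1 := (IsWD.tail_integral hqi).smooth_mul
      (continuous_tail_integral hqi).locallyIntegrable hqi.neg.locallyIntegrable
      (contDiff_sechPow b (-s)) (hasDerivAt_sechPow b (-s))
    convert h1 using 2 with x
    simp only [hk, hΦ, hq]
    linear_combination f x * hinv x
  have hkwL : MemLp (fun x => s * b * th b x * k x - f x) 2 := (memLp_th_mul hkL (s * b)).sub hf
  have ibp := IsWD.integral_mul_eq hf hf' hkL hkwL w hkw
  have huL : MemLp (fun x => f' x + s * b * th b x * f x) 2 := hf'.add (memLp_th_mul hf (s * b))
  -- Duality: ‖f‖² = ⟨f, A*k⟩ = ⟨Af, k⟩ ≤ ‖Af‖‖k‖, while ‖k‖ ≤ ‖κ‖₁‖f‖ by Young's inequality.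
  have e1 : ∫ x, f x ^ 2 = ∫ x, (f' x + s * b * th b x * f x) * k x := by
    have i1 : Integrable (fun x => f' x * k x) := integrable_mul_L2 hf' hkL
    have i2 : Integrable (fun x => s * b * th b x * f x * k x) :=
      integrable_mul_L2 (memLp_th_mul hf (s * b)) hkL
    have i3 : Integrable (fun x => f x * (s * b * th b x * k x - f x)) :=
      integrable_mul_L2 hf hkwL
    have h1 : ∫ x, (f' x + s * b * th b x * f x) * k x
        = (∫ x, f' x * k x) + ∫ x, s * b * th b x * f x * k x := by
      rw [← integral_add i1 i2]; congr 1; ext x; ring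
    have h2 : ∫ x, f x ^ 2 = (∫ x, s * b * th b x * f x * k x)
        - ∫ x, f x * (s * b * th b x * k x - f x) := by
      rw [← integral_sub i2 i3]; congr 1; ext x; ring
    linarith
  have cs := sq_integral_mul_le huL hkL
  rw [← e1] at cs
  have hun : 0 ≤ ∫ x, (f' x + s * b * th b x * f x) ^ 2 := integral_nonneg fun x => sq_nonneg _
  refine le_of_sq_le_mul (by positivity) (cs.trans ?_)
  calc _ ≤ (∫ x, (f' x + s * b * th b x * f x) ^ 2) * ((∫ t, κ t) ^ 2 * ∫ x, f x ^ 2) :=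
        mul_le_mul_of_nonneg_left hle hun
    _ = _ := by ring

/-- The potential `W² - W'`, `W = s b tanh (b x)`. -/
def pot (b s x : ℝ) : ℝ := (s * b * th b x) ^ 2 - s * b * b * (1 - th b x ^ 2)

lemma memLp_pot_mul {f : ℝ → ℝ} (hf : MemLp f 2) : MemLp (fun x => pot b s x * f x) 2 := by
  have h := (memLp_th_mul (b := b) (memLp_th_mul (b := b) hf (s * b)) (s * b)).sub
    (memLp_dth_mul (b := b) hf (s * b * b))
  refine h.congr_norm ?_ (Eventually.of_forall fun x => ?_)
  · have : Continuous (pot b s) := by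
      have := continuous_th b
      unfold pot; fun_prop
    exact this.aestronglyMeasurable.mul hf.aestronglyMeasurable
  · simp only [Pi.sub_apply, pot]; ring_nf

/-- The energy identity for `A* A = -∂² + W² - W'`. -/
lemma energy_identity {f f₁ f₂ : ℝ → ℝ} (hf : MemLp f 2) (hf₁ : MemLp f₁ 2) (hf₂ : MemLp f₂ 2)
    (w₁ : IsWD (1 : ℝ) f f₁) (w₂ : IsWD (1 : ℝ) f₁ f₂) :
    ∫ x, (-f₂ x + pot b s x * f x) * f x = ∫ x, (f₁ x + s * b * th b x * f x) ^ 2 := by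
  have hWf := memLp_th_mul (b := b) hf (s * b)
  have hWf₁ := memLp_th_mul (b := b) hf₁ (s * b)
  have hdf := memLp_dth_mul (b := b) hf (s * b * b)
  have hv : MemLp (fun x => s * b * b * (1 - th b x ^ 2) * f x + s * b * th b x * f₁ x) 2 :=
    hdf.add hWf₁
  have a1 := IsWD.integral_mul_eq hf₁ hf₂ hf hf₁ w₂ w₁
  have a2 := IsWD.integral_mul_eq hf hf₁ hWf hv w₁ (IsWD.th_mul (b := b) hf hf₁ w₁ (s * b))
  have i1 : Integrable (fun x => f₂ x * f x) := integrable_mul_L2 hf₂ hf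
  have i2 : Integrable (fun x => f₁ x * f₁ x) := integrable_mul_L2 hf₁ hf₁
  have i3 : Integrable (fun x => f₁ x * (s * b * th b x * f x)) := integrable_mul_L2 hf₁ hWf
  have i4 : Integrable (fun x =>
      f x * (s * b * b * (1 - th b x ^ 2) * f x + s * b * th b x * f₁ x)) :=
    integrable_mul_L2 hf hv
  have i5 : Integrable (fun x => (-f₂ x + pot b s x * f x) * f x) :=
    integrable_mul_L2 (hf₂.neg.add (memLp_pot_mul hf)) hf
  have i6 : Integrable (fun x => (f₁ x + s * b * th b x * f x) ^ 2) := (hf₁.add hWf).integrable_sq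
  have key : ∫ x, ((f₁ x + s * b * th b x * f x) ^ 2 - (-f₂ x + pot b s x * f x) * f x)
      = (∫ x, f₂ x * f x) + (∫ x, f₁ x * f₁ x) + ((∫ x, f₁ x * (s * b * th b x * f x))
        + ∫ x, f x * (s * b * b * (1 - th b x ^ 2) * f x + s * b * th b x * f₁ x)) := by
    rw [← integral_add i3 i4, ← integral_add i1 i2, ← integral_add (by exact i1.add i2)
      (by exact i3.add i4)]
    congr 1; ext x; rw [pot]; ring
  rw [integral_sub i6 i5] at key
  linarith

/-- The range of `A* A` is orthogonal to `sech (b x) ^ s`. -/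
lemma integral_mul_ground_eq_zero (hb : 0 < b) (hs : 0 < s) {f f₁ f₂ : ℝ → ℝ} (hf : MemLp f 2)
    (hf₁ : MemLp f₁ 2) (hf₂ : MemLp f₂ 2)
    (w₁ : IsWD (1 : ℝ) f f₁) (w₂ : IsWD (1 : ℝ) f₁ f₂) :
    ∫ x, (-f₂ x + pot b s x * f x) * sechPow b s x = 0 := by
  have hg : MemLp (sechPow b s) 2 := memLp_two_sechPow hb hs
  have hg₁ := memLp_th_mul (b := b) hg (-(s * b))
  have wg := isWD_sechPow b s
  have wg₁ := IsWD.th_mul (b := b) hg hg₁ wg (-(s * b))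
  have hg₂ : MemLp (fun x => -(s * b) * b * (1 - th b x ^ 2) * sechPow b s x
      + -(s * b) * th b x * (-(s * b) * th b x * sechPow b s x)) 2 :=
    (memLp_dth_mul hg _).add (memLp_th_mul hg₁ _)
  have a1 := IsWD.integral_mul_eq hf₁ hf₂ hg hg₁ w₂ wg
  have a2 := IsWD.integral_mul_eq hf hf₁ hg₁ hg₂ w₁ wg₁
  have i1 : Integrable (fun x => f₂ x * sechPow b s x) := integrable_mul_L2 hf₂ hg
  have i2 : Integrable (fun x => pot b s x * f x * sechPow b s x) :=
    integrable_mul_L2 (memLp_pot_mul hf) hg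
  have e1 : ∫ x, (-f₂ x + pot b s x * f x) * sechPow b s x
      = (∫ x, pot b s x * f x * sechPow b s x) - ∫ x, f₂ x * sechPow b s x := by
    rw [← integral_sub i2 i1]; congr 1; ext x; ring
  have e2 : ∫ x, f x * (-(s * b) * b * (1 - th b x ^ 2) * sechPow b s x
      + -(s * b) * th b x * (-(s * b) * th b x * sechPow b s x))
      = ∫ x, pot b s x * f x * sechPow b s x := by
    congr 1; ext x; rw [pot]; ring
  rw [e1]
  linarith

/-- `A* A + m` is bounded below by `m`. -/
lemma sq_le_of_high_mode {m : ℝ} (hm : 3 ≤ m) {f f₁ f₂ E : ℝ → ℝ} (hf : MemLp f 2)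
    (hf₁ : MemLp f₁ 2) (hf₂ : MemLp f₂ 2) (hE : MemLp E 2)
    (w₁ : IsWD (1 : ℝ) f f₁) (w₂ : IsWD (1 : ℝ) f₁ f₂)
    (heq : ∀ᵐ x, -f₂ x + (m + pot b s x) * f x = E x) :
    ∫ x, f x ^ 2 ≤ ∫ x, E x ^ 2 := by
  have h1 := energy_identity (b := b) (s := s) hf hf₁ hf₂ w₁ w₂
  have i5 : Integrable (fun x => (-f₂ x + pot b s x * f x) * f x) :=
    integrable_mul_L2 (hf₂.neg.add (memLp_pot_mul hf)) hf
  have i6 : Integrable (fun x => m * f x ^ 2) := hf.integrable_sq.const_mul m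
  have h2 : ∫ x, E x * f x = (∫ x, (-f₂ x + pot b s x * f x) * f x) + m * ∫ x, f x ^ 2 := by
    rw [← integral_const_mul, ← integral_add i5 i6]
    refine integral_congr_ae ?_
    filter_upwards [heq] with x hx
    rw [← hx]; ring
  have h3 : 0 ≤ ∫ x, (f₁ x + s * b * th b x * f x) ^ 2 := integral_nonneg fun x => sq_nonneg _
  have h4 := sq_integral_mul_le hE hf
  have h5 : 0 ≤ ∫ x, f x ^ 2 := integral_nonneg fun x => sq_nonneg _
  have h6 : 0 ≤ ∫ x, E x ^ 2 := integral_nonneg fun x => sq_nonneg _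
  refine le_of_sq_le_mul h6 (le_trans ?_ h4)
  have h7 : ∫ x, f x ^ 2 ≤ ∫ x, E x * f x := by rw [h2, h1]; nlinarith
  exact pow_le_pow_left₀ h5 h7 2

/-- The resonant mode: control of the multiplier and of the solution modulo the kernel. -/
lemma exists_resonant_mode_bound (hb : 0 < b) (hs : 0 < s) : ∃ K : ℝ, 0 < K ∧
    ∀ (γ : ℝ) (f f₁ f₂ E : ℝ → ℝ), MemLp f 2 → MemLp f₁ 2 → MemLp f₂ 2 → MemLp E 2 →
    IsWD (1 : ℝ) f f₁ → IsWD (1 : ℝ) f₁ f₂ →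
    (∀ᵐ x, -f₂ x + pot b s x * f x = E x + γ * sechPow b s x) →
    γ ^ 2 ≤ K * ∫ x, E x ^ 2 ∧
    ∫ x, f x ^ 2 ≤ K * ((∫ x, E x ^ 2) + (∫ x, f x * sechPow b s x) ^ 2) := by
  obtain ⟨C, hC, gap⟩ := exists_gap hb hs
  have hg : MemLp (sechPow b s) 2 := memLp_two_sechPow hb hs
  set G := ∫ x, sechPow b s x ^ 2 with hG
  have hGpos : 0 < G := by
    refine (integral_pos_iff_support_of_nonneg (fun x => sq_nonneg _) hg.integrable_sq).2 ?_
    have : Function.support (fun x => sechPow b s x ^ 2) = Set.univ := by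
      ext t
      have := sechPow_pos b s t
      simp only [Function.mem_support, Set.mem_univ, iff_true]; positivity
    rw [this]; simp
  -- The part of `f` orthogonal to the kernel costs `4 * C ^ 2`; the multiplier and the part along
  -- the kernel cost `1 / G` each.
  refine ⟨4 * C ^ 2 + 1 / G, by positivity, ?_⟩
  intro γ f f₁ f₂ E hf hf₁ hf₂ hE w₁ w₂ heq
  have hE2 : 0 ≤ ∫ x, E x ^ 2 := integral_nonneg fun x => sq_nonneg _
  -- Solvability: the right-hand side lies in the range of A*A, hence is orthogonal to its kernel.
  -- This determines γ from `E`.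
  have horth : (∫ x, E x * sechPow b s x) + γ * G = 0 := by
    rw [← integral_mul_ground_eq_zero (b := b) (s := s) hb hs hf hf₁ hf₂ w₁ w₂, hG,
      ← integral_const_mul, ← integral_add (integrable_mul_L2 hE hg)
      (hg.integrable_sq.const_mul γ)]
    refine integral_congr_ae ?_
    filter_upwards [heq] with x hx
    rw [hx]; ring
  have hcs := sq_integral_mul_le hE hg
  have hγ : γ ^ 2 * G ≤ ∫ x, E x ^ 2 := by
    have h1 : (∫ x, E x * sechPow b s x) = -(γ * G) := by linarith
    rw [h1, ← hG] at hcs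
    have : γ ^ 2 * G * G ≤ (∫ x, E x ^ 2) * G := by nlinarith
    exact le_of_mul_le_mul_right this hGpos
  constructor
  · have h1 : γ ^ 2 ≤ 1 / G * ∫ x, E x ^ 2 := by
      rw [one_div, ← div_eq_inv_mul, le_div_iff₀ hGpos]; exact hγ
    have : 0 ≤ 4 * C ^ 2 * ∫ x, E x ^ 2 := by positivity
    nlinarith
  · set F : ℝ → ℝ := fun x => E x + γ * sechPow b s x with hF
    have hFL : MemLp F 2 := hE.add (hg.const_mul γ)
    have hFsq : ∫ x, F x ^ 2 ≤ 4 * ∫ x, E x ^ 2 := by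
      have i1 : Integrable (fun x => 2 * E x ^ 2) := hE.integrable_sq.const_mul 2
      have i2 : Integrable (fun x => 2 * γ ^ 2 * sechPow b s x ^ 2) :=
        hg.integrable_sq.const_mul _
      have : ∫ x, F x ^ 2 ≤ ∫ x, (2 * E x ^ 2 + 2 * γ ^ 2 * sechPow b s x ^ 2) := by
        refine integral_mono hFL.integrable_sq (by exact i1.add i2) fun x => ?_
        simp only [hF]
        nlinarith [sq_nonneg (E x - γ * sechPow b s x)]
      rw [integral_add i1 i2, integral_const_mul, integral_const_mul, ← hG] at this
      nlinarith
    -- Removing the component along the kernel does not change Af, so the gap applied to `k` bounds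
    -- ‖k‖² by C⟨F, k⟩.
    set t := (∫ x, f x * sechPow b s x) / G with ht
    have htG : t * G = ∫ x, f x * sechPow b s x := by rw [ht]; field_simp
    set k : ℝ → ℝ := fun x => f x + (-t) * sechPow b s x with hk
    have hkL : MemLp k 2 := hf.add (hg.const_mul (-t))
    have hk'L : MemLp (fun x => f₁ x + (-t) * (-(s * b) * th b x * sechPow b s x)) 2 :=
      hf₁.add ((memLp_th_mul hg _).const_mul (-t))
    have ll : ∀ {u : ℝ → ℝ}, MemLp u 2 → LocallyIntegrable u volume := fun h =>
      h.locallyIntegrable (by norm_num)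
    have wk : IsWD (1 : ℝ) k (fun x => f₁ x + (-t) * (-(s * b) * th b x * sechPow b s x)) :=
      w₁.add ((isWD_sechPow b s).const_mul (-t)) (ll hf) (ll hf₁) (ll (hg.const_mul (-t)))
        (ll ((memLp_th_mul hg _).const_mul (-t)))
    have hfg : Integrable (fun x => f x * sechPow b s x) := integrable_mul_L2 hf hg
    have hk0 : ∫ x, k x * sechPow b s x = 0 := by
      have : ∫ x, k x * sechPow b s x = (∫ x, f x * sechPow b s x) + (-t) * G := by
        rw [hG, ← integral_const_mul, ← integral_add hfg (hg.integrable_sq.const_mul (-t))]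
        congr 1; ext x; simp only [hk]; ring
      rw [this, ← htG]; ring
    have hgap := gap k _ hkL hk'L wk hk0
    have hu : ∀ x, f₁ x + (-t) * (-(s * b) * th b x * sechPow b s x) + s * b * th b x * k x
        = f₁ x + s * b * th b x * f x := by intro x; simp only [hk]; ring
    simp_rw [hu] at hgap
    rw [← energy_identity hf hf₁ hf₂ w₁ w₂] at hgap
    have hFg : ∫ x, F x * sechPow b s x = 0 := by
      rw [← horth, hG, ← integral_const_mul, ← integral_add (integrable_mul_L2 hE hg)
        (hg.integrable_sq.const_mul γ)]
      congr 1; ext x; simp only [hF]; ring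
    have hFk : ∫ x, (-f₂ x + pot b s x * f x) * f x = ∫ x, F x * k x := by
      have h1 : ∫ x, (-f₂ x + pot b s x * f x) * f x = ∫ x, F x * f x := by
        refine integral_congr_ae ?_
        filter_upwards [heq] with x hx
        rw [hx]
      have h2 : ∫ x, F x * k x = (∫ x, F x * f x) + (-t) * ∫ x, F x * sechPow b s x := by
        rw [← integral_const_mul, ← integral_add (integrable_mul_L2 hFL hf)
          ((integrable_mul_L2 hFL hg).const_mul (-t))]
        congr 1; ext x; simp only [hk]; ring
      rw [h1, h2, hFg, mul_zero, add_zero]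
    rw [hFk] at hgap
    have hcs2 := sq_integral_mul_le hFL hkL
    have hk2 : 0 ≤ ∫ x, k x ^ 2 := integral_nonneg fun x => sq_nonneg _
    have hksq : ∫ x, k x ^ 2 ≤ 4 * C ^ 2 * ∫ x, E x ^ 2 := by
      refine le_of_sq_le_mul (by positivity) ?_
      have h1 : (∫ x, k x ^ 2) ^ 2 ≤ (C * ∫ x, F x * k x) ^ 2 := pow_le_pow_left₀ hk2 hgap 2
      have h2 : (∫ x, F x ^ 2) * (∫ x, k x ^ 2) ≤ 4 * (∫ x, E x ^ 2) * ∫ x, k x ^ 2 :=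
        mul_le_mul_of_nonneg_right hFsq hk2
      calc _ ≤ C ^ 2 * (∫ x, F x * k x) ^ 2 := by rw [← mul_pow]; exact h1
        _ ≤ C ^ 2 * (4 * (∫ x, E x ^ 2) * ∫ x, k x ^ 2) :=
            mul_le_mul_of_nonneg_left (hcs2.trans h2) (by positivity)
        _ = _ := by ring
    have hfk : ∫ x, f x ^ 2 = (∫ x, k x ^ 2) + t ^ 2 * G := by
      have h1 : ∫ x, f x ^ 2 = (∫ x, k x ^ 2) + (2 * t * (∫ x, k x * sechPow b s x) + t ^ 2 * G) := by
        have j1 : Integrable (fun x => 2 * t * (k x * sechPow b s x)) :=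
          (integrable_mul_L2 hkL hg).const_mul _
        have j2 : Integrable (fun x => t ^ 2 * sechPow b s x ^ 2) := hg.integrable_sq.const_mul _
        rw [hG, ← integral_const_mul, ← integral_const_mul, ← integral_add j1 j2,
          ← integral_add hkL.integrable_sq (by exact j1.add j2)]
        congr 1; ext x; simp only [hk]; ring
      rw [h1, hk0]; ring
    have ht2 : t ^ 2 * G = 1 / G * (∫ x, f x * sechPow b s x) ^ 2 := by
      rw [← htG]; field_simp
    rw [hfk, ht2]
    have : 0 ≤ 1 / G * ∫ x, E x ^ 2 := by positivity
    have : 0 ≤ 4 * C ^ 2 * (∫ x, f x * sechPow b s x) ^ 2 := by positivity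
    nlinarith

end GroundState

/-! ### Periodic functions: from the cylinder to the plane. -/

section Periodic

/-- The translation by `k` periods. -/
def shift (k : ℤ) : ℝ × ℝ := (0, k * (2 * Real.pi))

/-- The `k`-th period strip. -/
def strip (k : ℤ) : Set (ℝ × ℝ) :=
  Set.univ ×ˢ Set.Ioc (k * (2 * Real.pi)) (k * (2 * Real.pi) + 2 * Real.pi)

lemma measurableSet_strip (k : ℤ) : MeasurableSet (strip k) :=
  MeasurableSet.univ.prod measurableSet_Ioc

lemma mem_strip {k : ℤ} {z : ℝ × ℝ} : z ∈ strip k ↔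
    k * (2 * Real.pi) < z.2 ∧ z.2 ≤ k * (2 * Real.pi) + 2 * Real.pi := by
  simp [strip]

lemma cyl_eq : cyl = volume.restrict (strip 0) := by simp [cyl, strip]

lemma iUnion_strip : ⋃ k, strip k = Set.univ := by
  refine Set.eq_univ_of_forall fun z => ?_
  rw [Set.mem_iUnion]
  have hm := sub_toIocDiv_zsmul_mem_Ioc Real.two_pi_pos 0 z.2
  refine ⟨toIocDiv Real.two_pi_pos 0 z.2, mem_strip.2 ?_⟩
  simp only [zsmul_eq_mul, Set.mem_Ioc, zero_add] at hm
  exact ⟨by linarith [hm.1], by linarith [hm.2]⟩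

lemma pairwise_disjoint_strip : Pairwise (Function.onFun Disjoint strip) := by
  have key : ∀ i j : ℤ, i < j → Disjoint (strip i) (strip j) := by
    intro i j hij
    rw [Set.disjoint_left]
    intro z hi hj
    rw [mem_strip] at hi hj
    have h1 : (i : ℝ) + 1 ≤ j := by exact_mod_cast hij
    nlinarith [Real.two_pi_pos]
  intro i j hij
  rcases lt_or_gt_of_ne hij with h | h
  · exact key i j h
  · exact (key j i h).symm

lemma PeriodicY.shift_eq {u : ℝ × ℝ → ℝ} (hu : PeriodicY u) (k : ℤ) (z : ℝ × ℝ) :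
    u (z + shift k) = u z := by
  have h : Function.Periodic (fun y => u (z.1, y)) (2 * Real.pi) := fun y => hu z.1 y
  have e : z + shift k = (z.1, z.2 + k * (2 * Real.pi)) := by ext <;> simp [shift]
  rw [e]
  exact h.int_mul k z.2

lemma measurePreserving_shift (k : ℤ) :
    MeasurePreserving (fun z : ℝ × ℝ => z + shift k) (volume.restrict (strip 0))
      (volume.restrict (strip k)) := by
  have h := (measurePreserving_add_right (volume : Measure (ℝ × ℝ)) (shift k)).restrict_preimage
    (measurableSet_strip k)
  convert h using 2
  ext z
  simp only [mem_strip, shift, Set.mem_preimage, Prod.snd_add]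
  constructor <;> rintro ⟨h1, h2⟩ <;> constructor <;> push_cast at * <;> linarith

lemma measurableEmbedding_shift (k : ℤ) :
    MeasurableEmbedding (fun z : ℝ × ℝ => z + shift k) :=
  measurableEmbedding_addRight (shift k)

lemma setIntegral_strip (F : ℝ × ℝ → ℝ) (k : ℤ) :
    ∫ z in strip k, F z = ∫ z, F (z + shift k) ∂cyl := by
  rw [cyl_eq]
  exact ((measurePreserving_shift k).integral_comp (measurableEmbedding_shift k) F).symm

lemma setLIntegral_strip (F : ℝ × ℝ → ℝ≥0∞) (k : ℤ) :
    ∫⁻ z in strip k, F z = ∫⁻ z, F (z + shift k) ∂cyl := by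
  rw [cyl_eq]
  exact ((measurePreserving_shift k).lintegral_comp_emb (measurableEmbedding_shift k) F).symm

/-- The plane is a countable union of translates of the fundamental strip, and each translation
preserves measure. -/
lemma ae_volume_of_ae_cyl {P : ℝ × ℝ → Prop} (hP : ∀ z k, P (z + shift k) → P z)
    (h : ∀ᵐ z ∂cyl, P z) : ∀ᵐ z, P z := by
  rw [cyl_eq] at h
  rw [← Measure.restrict_univ (μ := (volume : Measure (ℝ × ℝ))), ← iUnion_strip,
    ae_restrict_iUnion_iff]
  intro k
  have h1 : ∀ᵐ z ∂(volume.restrict (strip k)), P (z + shift (-k)) := by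
    have h2 : MeasurePreserving (fun z : ℝ × ℝ => z + shift (-k)) (volume.restrict (strip k))
        (volume.restrict (strip 0)) := by
      have h := (measurePreserving_add_right (volume : Measure (ℝ × ℝ))
        (shift (-k))).restrict_preimage (measurableSet_strip 0)
      convert h using 2
      ext z
      simp only [mem_strip, shift, Set.mem_preimage, Prod.snd_add]
      constructor <;> rintro ⟨h1, h2⟩ <;> constructor <;> push_cast at * <;> linarith
    exact h2.quasiMeasurePreserving.ae h
  filter_upwards [h1] with z hz using hP _ _ hz

lemma ae_cyl_of_ae_volume {P : ℝ × ℝ → Prop} (h : ∀ᵐ z, P z) : ∀ᵐ z ∂cyl, P z :=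
  ae_restrict_of_ae h

lemma aestronglyMeasurable_of_cyl {u : ℝ × ℝ → ℝ} (hu : PeriodicY u)
    (hm : AEStronglyMeasurable u cyl) : AEStronglyMeasurable u volume := by
  obtain ⟨v, hv, huv⟩ := hm
  rw [← Measure.restrict_univ (μ := (volume : Measure (ℝ × ℝ))), ← iUnion_strip,
    aestronglyMeasurable_iUnion_iff]
  intro k
  rw [cyl_eq] at huv
  have h1 := (measurePreserving_shift k).map_eq
  rw [← h1, (measurableEmbedding_shift k).aestronglyMeasurable_map_iff]
  refine ⟨v, hv, ?_⟩
  filter_upwards [huv] with z hz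
  rw [Function.comp, hu.shift_eq, hz]

/-- The unit square with lower left corner `z`. -/
def box (z : ℝ × ℝ) : Set (ℝ × ℝ) := Set.Icc z.1 (z.1 + 1) ×ˢ Set.Icc z.2 (z.2 + 1)

lemma volume_box (z : ℝ × ℝ) : volume (box z) = 1 := by
  rw [box, Measure.volume_eq_prod, Measure.prod_prod]; simp

lemma box_subset (z : ℝ × ℝ) : ∃ k : ℤ, box z ⊆ strip k ∪ strip (k + 1) := by
  have h : z ∈ ⋃ k, strip k := by rw [iUnion_strip]; trivial
  obtain ⟨k, hk⟩ := Set.mem_iUnion.1 h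
  refine ⟨k, fun w hw => ?_⟩
  rw [mem_strip] at hk
  simp only [box, Set.mem_prod, Set.mem_Icc] at hw
  have hpi : (1 : ℝ) ≤ 2 * Real.pi := by linarith [Real.pi_gt_three]
  rcases le_or_gt w.2 (k * (2 * Real.pi) + 2 * Real.pi) with h1 | h1
  · left; exact mem_strip.2 ⟨by linarith [hw.2.1], h1⟩
  · right; refine mem_strip.2 ?_
    push_cast
    exact ⟨by linarith, by linarith [hw.2.2]⟩

/-- A unit box has measure one and, since 1 ≤ 2π, lies in two consecutive strips; this is the factor
2. -/
lemma sq_lintegral_box_le {w : ℝ × ℝ → ℝ} (hw : PeriodicY w) (hm : AEStronglyMeasurable w cyl)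
    (z : ℝ × ℝ) : (∫⁻ t in box z, ENNReal.ofReal |w t|) ^ 2
      ≤ 2 * ∫⁻ t, ENNReal.ofReal |w t| ^ 2 ∂cyl := by
  have hm' := aestronglyMeasurable_of_cyl hw hm
  have h1 := sq_lintegral_mul_le (μ := volume.restrict (box z)) (k := fun _ => (1 : ℝ≥0∞))
    (f := fun t => ENNReal.ofReal |w t|) aemeasurable_const
    hm'.restrict.aemeasurable.abs.ennreal_ofReal
  simp only [one_mul, lintegral_const, Measure.restrict_apply MeasurableSet.univ,
    Set.univ_inter, volume_box] at h1
  refine h1.trans ?_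
  obtain ⟨k, hk⟩ := box_subset z
  have h2 : ∀ j : ℤ, ∫⁻ t in strip j, ENNReal.ofReal |w t| ^ 2
      = ∫⁻ t, ENNReal.ofReal |w t| ^ 2 ∂cyl := by
    intro j
    rw [setLIntegral_strip]
    simp_rw [hw.shift_eq]
  calc _ ≤ ∫⁻ t in strip k ∪ strip (k + 1), ENNReal.ofReal |w t| ^ 2 := lintegral_mono_set hk
    _ ≤ (∫⁻ t in strip k, ENNReal.ofReal |w t| ^ 2)
        + ∫⁻ t in strip (k + 1), ENNReal.ofReal |w t| ^ 2 := lintegral_union_le _ _ _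
    _ = _ := by rw [h2, h2, two_mul]

lemma lintegral_box_le {w : ℝ × ℝ → ℝ} (hw : MemL2 w) (z : ℝ × ℝ) :
    ∫⁻ t in box z, ENNReal.ofReal |w t| ≤ ENNReal.ofReal (2 * norm2 w) := by
  have h1 := sq_lintegral_box_le hw.1 hw.2.aestronglyMeasurable z
  rw [← ofReal_integral_sq hw.2] at h1
  have h2 : norm2 w ^ 2 = ∫ t, w t ^ 2 ∂cyl := by
    rw [norm2, inner2, Real.sq_sqrt (integral_nonneg fun t => mul_self_nonneg _)]
    simp_rw [sq]
  have h0 : 0 ≤ norm2 w := Real.sqrt_nonneg _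
  rw [← h2] at h1
  have h3 : (2 : ℝ≥0∞) * ENNReal.ofReal (norm2 w ^ 2) ≤ ENNReal.ofReal (2 * norm2 w) ^ 2 := by
    rw [← ENNReal.ofReal_pow (by positivity), ← ENNReal.ofReal_ofNat, ← ENNReal.ofReal_mul (by norm_num)]
    exact ENNReal.ofReal_le_ofReal (by nlinarith [sq_nonneg (norm2 w)])
  exact (ENNReal.pow_le_pow_left_iff two_ne_zero).1 (h1.trans h3)

lemma MemL2.locallyIntegrable {w : ℝ × ℝ → ℝ} (hw : MemL2 w) : LocallyIntegrable w volume := by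
  intro z
  refine ⟨box (z.1 - 1 / 2, z.2 - 1 / 2), ?_, ?_⟩
  · refine prod_mem_nhds (Icc_mem_nhds (by simp) (by simp only; linarith))
      (Icc_mem_nhds (by simp) (by simp only; linarith))
  · refine ⟨(aestronglyMeasurable_of_cyl hw.1 hw.2.aestronglyMeasurable).restrict, ?_⟩
    rw [hasFiniteIntegral_iff_norm]
    exact (lintegral_box_le hw _).trans_lt ENNReal.ofReal_lt_top

end Periodic

/-! ### Periodization of test functions. -/

/-- The periodization of a compactly supported function. -/
def per (ζ : ℝ × ℝ → ℝ) : ℝ × ℝ → ℝ := fun z => ∑' k : ℤ, ζ (z + shift k)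

lemma exists_bound_of_hasCompactSupport {ζ : ℝ × ℝ → ℝ} (hc : HasCompactSupport ζ) :
    ∃ L : ℝ, 0 ≤ L ∧ ∀ z, L < |z.1| ∨ L < |z.2| → ζ z = 0 := by
  obtain ⟨L, hL⟩ := hc.isCompact.isBounded.exists_norm_le
  refine ⟨max L 0, le_max_right _ _, fun z hz => ?_⟩
  by_contra hne
  have h1 : z ∈ tsupport ζ := subset_tsupport _ hne
  have h2 := hL z h1
  rw [Prod.norm_def] at h2
  have h3 := le_max_left ‖z.1‖ ‖z.2‖
  have h4 := le_max_right ‖z.1‖ ‖z.2‖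
  simp only [Real.norm_eq_abs] at *
  have h5 := le_max_left L 0
  rcases hz with hz | hz <;> linarith

/-- Makes the periodization a finite sum with an index set uniform over |y| ≤ `Y`, so that sums
commute with derivatives and integrals. -/
lemma shift_eq_zero_of_large {ζ : ℝ × ℝ → ℝ} {L Y : ℝ}
    (hL : ∀ z : ℝ × ℝ, L < |z.1| ∨ L < |z.2| → ζ z = 0) {z : ℝ × ℝ} (hz : |z.2| ≤ Y) {k : ℤ}
    (hk : k ∉ Finset.Icc (-⌈L + Y⌉) ⌈L + Y⌉) : ζ (z + shift k) = 0 := by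
  refine hL _ (Or.inr ?_)
  simp only [Finset.mem_Icc, not_and_or, not_le] at hk
  have hpi := Real.pi_gt_three
  have h1 : L + Y < |(k : ℝ)| := by
    rcases hk with h | h
    · have : (k : ℝ) + 1 ≤ -⌈L + Y⌉ := by exact_mod_cast h
      have h2 := Int.le_ceil (L + Y)
      have := neg_le_abs (k : ℝ)
      linarith
    · have : (⌈L + Y⌉ : ℝ) + 1 ≤ k := by exact_mod_cast h
      have h2 := Int.le_ceil (L + Y)
      have := le_abs_self (k : ℝ)
      linarith
  have h2 : |(k : ℝ)| ≤ |(k : ℝ) * (2 * Real.pi)| := by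
    rw [abs_mul, abs_of_pos Real.two_pi_pos]
    nlinarith [abs_nonneg (k : ℝ)]
  have h3 : |(k : ℝ) * (2 * Real.pi)| ≤ |z.2 + k * (2 * Real.pi)| + |z.2| := by
    have := abs_add_le (z.2 + k * (2 * Real.pi)) (-z.2)
    rw [abs_neg, add_neg_cancel_comm] at this
    exact this
  simp only [shift, Prod.snd_add]
  linarith

lemma per_eq_sum {ζ : ℝ × ℝ → ℝ} {L Y : ℝ}
    (hL : ∀ z : ℝ × ℝ, L < |z.1| ∨ L < |z.2| → ζ z = 0) {z : ℝ × ℝ} (hz : |z.2| ≤ Y) :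
    per ζ z = ∑ k ∈ Finset.Icc (-⌈L + Y⌉) ⌈L + Y⌉, ζ (z + shift k) :=
  tsum_eq_sum fun _ hk => shift_eq_zero_of_large hL hz hk

lemma per_eventuallyEq {ζ : ℝ × ℝ → ℝ} {L : ℝ}
    (hL : ∀ z : ℝ × ℝ, L < |z.1| ∨ L < |z.2| → ζ z = 0) (z : ℝ × ℝ) :
    per ζ =ᶠ[𝓝 z] fun w => ∑ k ∈ Finset.Icc (-⌈L + (|z.2| + 1)⌉) ⌈L + (|z.2| + 1)⌉,
      ζ (w + shift k) := by
  have h : ∀ᶠ w : ℝ × ℝ in 𝓝 z, |w.2| < |z.2| + 1 :=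
    (continuous_snd.abs.tendsto z).eventually_lt_const (by simp)
  filter_upwards [h] with w hw using per_eq_sum hL hw.le

lemma contDiff_comp_shift {ζ : ℝ × ℝ → ℝ} (hζ : ContDiff ℝ (⊤ : ℕ∞) ζ) (k : ℤ) :
    ContDiff ℝ (⊤ : ℕ∞) (fun w => ζ (w + shift k)) :=
  hζ.comp (contDiff_id.add contDiff_const)

lemma isTest_per {ζ : ℝ × ℝ → ℝ} (hζ : ContDiff ℝ (⊤ : ℕ∞) ζ) (hc : HasCompactSupport ζ) :
    IsTest (per ζ) := by
  obtain ⟨L, hL0, hL⟩ := exists_bound_of_hasCompactSupport hc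
  refine ⟨?_, ?_, L + 1, ?_⟩
  · rw [contDiff_iff_contDiffAt]
    intro z
    refine ContDiffAt.congr_of_eventuallyEq ?_ (per_eventuallyEq hL z)
    exact ContDiffAt.sum fun k _ => (contDiff_comp_shift hζ k).contDiffAt
  · intro x y
    simp only [per]
    rw [← (Equiv.addRight (-1 : ℤ)).tsum_eq]
    refine tsum_congr fun k => ?_
    congr 1
    ext <;> simp [shift]; ring
  · intro x y hx
    simp only [per]
    refine (tsum_congr fun k => ?_).trans tsum_zero
    refine hL _ (Or.inl ?_)
    simp only [shift, Prod.fst_add, add_zero]; linarith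

lemma fderiv_per {ζ : ℝ × ℝ → ℝ} (hζ : ContDiff ℝ (⊤ : ℕ∞) ζ) (hc : HasCompactSupport ζ)
    (e z : ℝ × ℝ) : fderiv ℝ (per ζ) z e = per (fun w => fderiv ℝ ζ w e) z := by
  obtain ⟨L, hL0, hL⟩ := exists_bound_of_hasCompactSupport hc
  have hL' : ∀ z : ℝ × ℝ, L < |z.1| ∨ L < |z.2| → fderiv ℝ ζ z e = 0 := by
    intro z hz
    have : ζ =ᶠ[𝓝 z] fun _ => 0 := by
      rcases hz with h | h
      · filter_upwards [(continuous_fst.abs.tendsto z).eventually_const_lt h] with w hw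
          using hL w (Or.inl hw)
      · filter_upwards [(continuous_snd.abs.tendsto z).eventually_const_lt h] with w hw
          using hL w (Or.inr hw)
    rw [this.fderiv_eq]; simp
  rw [(per_eventuallyEq hL z).fderiv_eq, per_eq_sum hL' (Y := |z.2| + 1) (by linarith),
    fderiv_fun_sum fun k _ => (contDiff_comp_shift hζ k).differentiable (by simp) z]
  simp only [_root_.sum_apply]
  refine Finset.sum_congr rfl fun k _ => ?_
  rw [fderiv_comp_add_right]

/-- Unfolding: the integral over the plane is a sum over strips, and periodicity of `u` moves each
strip back to the fundamental one, collecting the translates of `ζ`. -/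
lemma integral_mul_per {u ζ : ℝ × ℝ → ℝ} (hu : PeriodicY u) (lu : LocallyIntegrable u volume)
    (hζ : Continuous ζ) (hc : HasCompactSupport ζ) :
    ∫ z, u z * ζ z = ∫ z, u z * per ζ z ∂cyl := by
  obtain ⟨L, hL0, hL⟩ := exists_bound_of_hasCompactSupport hc
  have hi := integrable_mul_test lu hζ hc
  have h2 : ∀ k, ∫ z in strip k, u z * ζ z = ∫ z, u z * ζ (z + shift k) ∂cyl := by
    intro k
    rw [setIntegral_strip]
    simp_rw [hu.shift_eq]
  have hz : ∀ z ∈ strip 0, |z.2| ≤ 2 * Real.pi := by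
    intro z hz
    rw [mem_strip] at hz
    rw [abs_le]; constructor <;> push_cast at hz <;> linarith [Real.pi_pos]
  have hint : ∀ k : ℤ, Integrable (fun z => u z * ζ (z + shift k)) cyl := by
    intro k
    have h3 : IntegrableOn (fun z => u z * ζ z) (strip k) := hi.integrableOn
    have h4 := (measurePreserving_shift k).integrable_comp_emb (measurableEmbedding_shift k)
      (g := fun z => u z * ζ z)
    rw [cyl_eq]
    have h5 := h4.2 h3
    simpa [Function.comp_def, hu.shift_eq] using h5
  calc ∫ z, u z * ζ z = ∫ z in ⋃ k, strip k, u z * ζ z := by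
        rw [iUnion_strip, Measure.restrict_univ]
    _ = ∑' k, ∫ z in strip k, u z * ζ z :=
        integral_iUnion measurableSet_strip pairwise_disjoint_strip hi.integrableOn
    _ = ∑' k, ∫ z, u z * ζ (z + shift k) ∂cyl := by simp_rw [h2]
    _ = ∑ k ∈ Finset.Icc (-⌈L + 2 * Real.pi⌉) ⌈L + 2 * Real.pi⌉,
          ∫ z, u z * ζ (z + shift k) ∂cyl := by
        refine tsum_eq_sum fun k hk => ?_
        rw [cyl_eq]
        refine setIntegral_eq_zero_of_forall_eq_zero fun z hz' => ?_
        rw [shift_eq_zero_of_large hL (hz z hz') hk, mul_zero]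
    _ = ∫ z, ∑ k ∈ Finset.Icc (-⌈L + 2 * Real.pi⌉) ⌈L + 2 * Real.pi⌉,
          u z * ζ (z + shift k) ∂cyl := (integral_finsetSum _ fun k _ => hint k).symm
    _ = _ := by
        rw [cyl_eq]
        refine setIntegral_congr_fun (measurableSet_strip 0) fun z hz' => ?_
        rw [per_eq_sum hL (hz z hz'), Finset.mul_sum]

/-- Weak derivatives on the cylinder are distributional derivatives of the periodic functions. -/
lemma HasWeakDeriv.isWD {e : ℝ × ℝ} {u w : ℝ × ℝ → ℝ} (hu : MemL2 u) (hw : MemL2 w)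
    (h : HasWeakDeriv e u w) : IsWD e u w := by
  intro ζ hζ hc
  rw [integral_mul_per hu.1 hu.locallyIntegrable (contDiff_fderiv_apply hζ e).continuous
    (hasCompactSupport_fderiv_apply hc e), integral_mul_per hw.1 hw.locallyIntegrable
    hζ.continuous hc, ← h _ (isTest_per hζ hc)]
  simp_rw [fderiv_per hζ hc]

lemma WeakDiff.memL2 {e : ℝ × ℝ} {u : ℝ × ℝ → ℝ} (h : WeakDiff e u) : MemL2 (wd e u) := by
  rw [wd, dif_pos h]; exact h.choose_spec.1

lemma WeakDiff.hasWeakDeriv {e : ℝ × ℝ} {u : ℝ × ℝ → ℝ} (h : WeakDiff e u) :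
    HasWeakDeriv e u (wd e u) := by
  rw [wd, dif_pos h]; exact h.choose_spec.2

/-! ### Sobolev embedding of H² into L^∞. -/

lemma abs_le_lintegral_unit {q q' : ℝ → ℝ} (hq : ∀ t, HasDerivAt q (q' t) t)
    (hc : Continuous q') (a : ℝ) :
    ENNReal.ofReal |q a|
      ≤ ∫⁻ t in Set.Icc a (a + 1), (ENNReal.ofReal |q t| + ENNReal.ofReal |q' t|) := by
  have hqc : Continuous q := continuous_iff_continuousAt.2 fun t => (hq t).continuousAt
  have h1 : ∀ t ∈ Set.Icc a (a + 1), |q a| ≤ |q t| + ∫ r in Set.Icc a (a + 1), |q' r| := by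
    intro t ht
    have h2 : ∫ r in a..t, q' r = q t - q a :=
      intervalIntegral.integral_eq_sub_of_hasDerivAt (fun r _ => hq r) (hc.intervalIntegrable _ _)
    have h3 : |∫ r in a..t, q' r| ≤ ∫ r in Set.Icc a (a + 1), |q' r| := by
      refine (intervalIntegral.abs_integral_le_integral_abs ht.1).trans ?_
      rw [intervalIntegral.integral_of_le ht.1]
      refine setIntegral_mono_set (hc.abs.integrableOn_Icc) (Eventually.of_forall fun r =>
        abs_nonneg _) ?_
      exact (Set.Ioc_subset_Icc_self.trans (Set.Icc_subset_Icc_right ht.2)).eventuallyLE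
    have h4 : q a = q t - ∫ r in a..t, q' r := by linarith
    rw [h4]
    exact (abs_sub _ _).trans (by linarith)
  have h5 : ∫⁻ t in Set.Icc a (a + 1), ENNReal.ofReal |q a| = ENNReal.ofReal |q a| := by
    simp
  rw [← h5]
  calc _ ≤ ∫⁻ t in Set.Icc a (a + 1), (ENNReal.ofReal |q t|
          + ENNReal.ofReal (∫ r in Set.Icc a (a + 1), |q' r|)) := by
        refine setLIntegral_mono' measurableSet_Icc fun t ht => ?_
        rw [← ENNReal.ofReal_add (abs_nonneg _) (integral_nonneg fun r => abs_nonneg _)]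
        exact ENNReal.ofReal_le_ofReal (h1 t ht)
    _ = (∫⁻ t in Set.Icc a (a + 1), ENNReal.ofReal |q t|)
          + ∫⁻ r in Set.Icc a (a + 1), ENNReal.ofReal |q' r| := by
        rw [lintegral_add_left hqc.abs.measurable.ennreal_ofReal,
          ofReal_integral_eq_lintegral_ofReal hc.abs.integrableOn_Icc
            (Eventually.of_forall fun r => abs_nonneg _)]
        simp
    _ = _ := (lintegral_add_left hqc.abs.measurable.ennreal_ofReal _).symm

/-- The one-dimensional estimate is used in y for `U`, then in x for `U` and `Uy`. The mixed
derivative is therefore the only second derivative needed. -/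
lemma abs_le_lintegral_box {U Ux Uy Uxy : ℝ × ℝ → ℝ} (hU : Continuous U) (hUx : Continuous Ux)
    (hUy : Continuous Uy) (hUxy : Continuous Uxy)
    (hx : ∀ x y, HasDerivAt (fun t => U (t, y)) (Ux (x, y)) x)
    (hy : ∀ x y, HasDerivAt (fun t => U (x, t)) (Uy (x, y)) y)
    (hxy : ∀ x y, HasDerivAt (fun t => Uy (t, y)) (Uxy (x, y)) x) (z : ℝ × ℝ) :
    ENNReal.ofReal |U z| ≤ (∫⁻ t in box z, ENNReal.ofReal |U t|)
      + (∫⁻ t in box z, ENNReal.ofReal |Ux t|) + (∫⁻ t in box z, ENNReal.ofReal |Uy t|)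
      + ∫⁻ t in box z, ENNReal.ofReal |Uxy t| := by
  have m : ∀ {f : ℝ × ℝ → ℝ}, Continuous f → Measurable fun t => ENNReal.ofReal |f t| :=
    fun hf => hf.abs.measurable.ennreal_ofReal
  rw [← lintegral_add_left (m hU), ← lintegral_add_left (by exact (m hU).add (m hUx)),
    ← lintegral_add_left (by exact ((m hU).add (m hUx)).add (m hUy))]
  obtain ⟨x, y⟩ := z
  have h1 := abs_le_lintegral_unit (q := fun t => U (x, t)) (q' := fun t => Uy (x, t))
    (fun t => hy x t) (by fun_prop) y
  refine h1.trans ?_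
  rw [box, Measure.volume_eq_prod, ← Measure.prod_restrict, lintegral_prod_symm' _
    (by exact (((m hU).add (m hUx)).add (m hUy)).add (m hUxy))]
  refine lintegral_mono fun t => ?_
  have h2 := abs_le_lintegral_unit (q := fun r => U (r, t)) (q' := fun r => Ux (r, t))
    (fun r => hx r t) (by fun_prop) x
  have h3 := abs_le_lintegral_unit (q := fun r => Uy (r, t)) (q' := fun r => Uxy (r, t))
    (fun r => hxy r t) (by fun_prop) x
  refine (add_le_add h2 h3).trans ?_
  have c : ∀ {f : ℝ × ℝ → ℝ}, Continuous f → Measurable fun r : ℝ => ENNReal.ofReal |f (r, t)| :=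
    fun {f} hf => (by fun_prop : Continuous fun r : ℝ => |f (r, t)|).measurable.ennreal_ofReal
  rw [← lintegral_add_left (by exact (c hU).add (c hUx))]
  refine lintegral_mono fun r => ?_
  simp only [add_assoc, le_refl]

/-- A mollification averages translates, and translating a box gives another box; a bound uniform
over all boxes survives. -/
lemma lintegral_box_moll_le {w : ℝ × ℝ → ℝ} (lw : LocallyIntegrable w volume) {M : ℝ≥0∞}
    (hM : ∀ z, ∫⁻ t in box z, ENNReal.ofReal |w t| ≤ M) (n : ℕ) (z : ℝ × ℝ) :
    ∫⁻ t in box z, ENNReal.ofReal |moll n w t| ≤ M := by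
  have hwm : AEMeasurable (fun t => ENNReal.ofReal |w t|) :=
    lw.aestronglyMeasurable.aemeasurable.abs.ennreal_ofReal
  have hkm : Measurable (fun t : ℝ × ℝ => ENNReal.ofReal (kern n t)) :=
    (kern_contDiff n).continuous.measurable.ennreal_ofReal
  have hk1 : ∫⁻ t : ℝ × ℝ, ENNReal.ofReal (kern n t) = 1 := by
    rw [← ofReal_integral_eq_lintegral_ofReal (integrable_kern n)
      (Eventually.of_forall fun t => kern_nonneg n t), integral_kern, ENNReal.ofReal_one]
  have hpt : ∀ x, ENNReal.ofReal |moll n w x|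
      ≤ ∫⁻ t, ENNReal.ofReal (kern n t) * ENNReal.ofReal |w (x - t)| := by
    intro x
    refine (ENNReal.ofReal_le_ofReal (abs_integral_le_integral_abs)).trans ?_
    rw [ofReal_integral_eq_lintegral_ofReal (integrable_kern_sub_mul lw n x).abs
      (Eventually.of_forall fun t => abs_nonneg _)]
    rw [← lintegral_sub_left_eq_self _ x]
    refine lintegral_mono fun t => ?_
    simp only [sub_sub_cancel]
    rw [abs_mul, abs_of_nonneg (kern_nonneg n _), ENNReal.ofReal_mul (kern_nonneg n _)]
  have hm : AEMeasurable (Function.uncurry fun (x t : ℝ × ℝ) =>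
      ENNReal.ofReal (kern n t) * ENNReal.ofReal |w (x - t)|)
      ((volume.restrict (box z)).prod volume) := by
    refine AEMeasurable.mul (hkm.comp measurable_snd).aemeasurable ?_
    have h1 : AEMeasurable (fun q : (ℝ × ℝ) × (ℝ × ℝ) => ENNReal.ofReal |w (q.1 - q.2)|)
        ((volume : Measure (ℝ × ℝ)).prod volume) :=
      hwm.comp_quasiMeasurePreserving (quasiMeasurePreserving_sub volume volume)
    refine h1.mono_measure ?_
    exact Measure.prod_mono Measure.restrict_le_self le_rfl
  calc _ ≤ ∫⁻ x in box z, ∫⁻ t, ENNReal.ofReal (kern n t) * ENNReal.ofReal |w (x - t)| :=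
        lintegral_mono hpt
    _ = ∫⁻ t, ∫⁻ x in box z, ENNReal.ofReal (kern n t) * ENNReal.ofReal |w (x - t)| :=
        lintegral_lintegral_swap hm
    _ ≤ ∫⁻ t, ENNReal.ofReal (kern n t) * M := by
        refine lintegral_mono fun t => ?_
        simp only
        rw [lintegral_const_mul' _ _ ENNReal.ofReal_ne_top]
        gcongr
        refine le_trans (le_of_eq ?_) (hM (z - t))
        have h1 : box z = (fun x => x - t) ⁻¹' box (z - t) := by
          ext x
          simp only [box, Set.mem_prod, Set.mem_Icc, Set.mem_preimage, Prod.fst_sub, Prod.snd_sub]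
          constructor <;> rintro ⟨⟨a1, a2⟩, a3, a4⟩ <;> refine ⟨⟨?_, ?_⟩, ?_, ?_⟩ <;> linarith
        rw [h1]
        exact (measurePreserving_sub_right (volume : Measure (ℝ × ℝ)) t).setLIntegral_comp_preimage_emb
          (MeasurableEquiv.subRight t).measurableEmbedding (fun x => ENNReal.ofReal |w x|) (box (z - t))
    _ = M := by rw [lintegral_mul_const _ hkm, hk1, one_mul]

lemma norm2_nonneg (u : ℝ × ℝ → ℝ) : 0 ≤ norm2 u := Real.sqrt_nonneg _

/-- The Sobolev embedding of `H²(ℝ × 𝕋)` into `L^∞`. -/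
lemma MemH2.ae_abs_le {u : ℝ × ℝ → ℝ} (hu : MemH2 u) : ∀ᵐ z, |u z| ≤ 8 * normH2 u := by
  obtain ⟨⟨hu0, hux, huy⟩, -, ⟨-, huyx, -⟩⟩ := hu
  have mx := hux.memL2
  have my := huy.memL2
  have mxy := huyx.memL2
  have wx := hux.hasWeakDeriv.isWD hu0 mx
  have wy := huy.hasWeakDeriv.isWD hu0 my
  have wxy := huyx.hasWeakDeriv.isWD my mxy
  have l0 := hu0.locallyIntegrable
  have lx := mx.locallyIntegrable
  have ly := my.locallyIntegrable
  have lxy := mxy.locallyIntegrable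
  -- Four box integrals, each at most twice an L² norm controlled by the H² norm: 4 · 2 = 8.
  have hb : ∀ n z, |moll n u z| ≤ 8 * normH2 u := by
    intro n z
    have dd : ∀ {f : ℝ × ℝ → ℝ}, LocallyIntegrable f volume → Differentiable ℝ (moll n f) :=
      fun hf => (moll_contDiff hf n).differentiable (by simp)
    have h1 := abs_le_lintegral_box (U := moll n u) (Ux := moll n (wd (1, 0) u))
      (Uy := moll n (wd (0, 1) u)) (Uxy := moll n (wd (1, 0) (dy u)))
      (moll_contDiff l0 n).continuous (moll_contDiff lx n).continuous
      (moll_contDiff ly n).continuous (moll_contDiff lxy n).continuous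
      (fun x y => by rw [← fderiv_moll l0 wx n]; exact hasDerivAt_fst (dd l0) x y)
      (fun x y => by rw [← fderiv_moll l0 wy n]; exact hasDerivAt_snd (dd l0) x y)
      (fun x y => by
        rw [← fderiv_moll (u := dy u) ly wxy n]
        exact hasDerivAt_fst (dd (f := dy u) ly) x y) z
    have h2 := h1.trans (add_le_add (add_le_add (add_le_add
      (lintegral_box_moll_le l0 (lintegral_box_le hu0) n z)
      (lintegral_box_moll_le lx (lintegral_box_le mx) n z))
      (lintegral_box_moll_le ly (lintegral_box_le my) n z))
      (lintegral_box_moll_le lxy (lintegral_box_le mxy) n z))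
    have n0 := norm2_nonneg u
    have nx := norm2_nonneg (wd (1, 0) u)
    have ny := norm2_nonneg (wd (0, 1) u)
    have nxy := norm2_nonneg (wd (1, 0) (dy u))
    rw [← ENNReal.ofReal_add (by positivity) (by positivity),
      ← ENNReal.ofReal_add (by positivity) (by positivity),
      ← ENNReal.ofReal_add (by positivity) (by positivity),
      ENNReal.ofReal_le_ofReal_iff (by positivity)] at h2
    have e0 : norm2 u ≤ normH2 u := by
      refine Real.le_sqrt_of_sq_le ?_
      nlinarith [sq_nonneg (norm2 (dx u)), sq_nonneg (norm2 (dy u)),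
        sq_nonneg (norm2 (dx (dx u))), sq_nonneg (norm2 (dx (dy u))), sq_nonneg (norm2 (dy (dy u)))]
    have ex : norm2 (dx u) ≤ normH2 u := by
      refine Real.le_sqrt_of_sq_le ?_
      nlinarith [sq_nonneg (norm2 u), sq_nonneg (norm2 (dy u)),
        sq_nonneg (norm2 (dx (dx u))), sq_nonneg (norm2 (dx (dy u))), sq_nonneg (norm2 (dy (dy u)))]
    have ey : norm2 (dy u) ≤ normH2 u := by
      refine Real.le_sqrt_of_sq_le ?_
      nlinarith [sq_nonneg (norm2 (dx u)), sq_nonneg (norm2 u),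
        sq_nonneg (norm2 (dx (dx u))), sq_nonneg (norm2 (dx (dy u))), sq_nonneg (norm2 (dy (dy u)))]
    have exy : norm2 (dx (dy u)) ≤ normH2 u := by
      refine Real.le_sqrt_of_sq_le ?_
      nlinarith [sq_nonneg (norm2 (dx u)), sq_nonneg (norm2 (dy u)),
        sq_nonneg (norm2 (dx (dx u))), sq_nonneg (norm2 u), sq_nonneg (norm2 (dy (dy u)))]
    simp only [dx, dy] at ex ey exy h2
    linarith
  filter_upwards [moll_tendsto_ae l0] with z hz
  exact le_of_tendsto hz.abs (Eventually.of_forall fun n => hb n z)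

/-! ### Fourier modes in y and Parseval's identity. -/

/-- Lebesgue measure on a period. -/
abbrev circ : Measure ℝ := volume.restrict (Set.Ioc 0 (2 * Real.pi))

lemma cyl_eq_prod : cyl = (volume : Measure ℝ).prod circ := by
  rw [cyl, Measure.volume_eq_prod, ← Measure.prod_restrict, Measure.restrict_univ]

/-- The `k`-th cosine coefficient in `y`, up to normalization. -/
def mode (u : ℝ × ℝ → ℝ) (k : ℤ) (x : ℝ) : ℝ := ∫ y, u (x, y) * Real.cos (k * y) ∂circ

lemma memLp_of_bdd_circ {f : ℝ → ℝ} (hc : Continuous f) (hb : ∀ y, |f y| ≤ 1) :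
    MemLp f 2 circ :=
  MemLp.of_bound hc.aestronglyMeasurable 1 (Eventually.of_forall hb)

lemma memLp_cos (k : ℤ) : MemLp (fun y : ℝ => Real.cos (k * y)) 2 circ :=
  memLp_of_bdd_circ (by fun_prop) fun _ => Real.abs_cos_le_one _

lemma memLp_sin (k : ℤ) : MemLp (fun y : ℝ => Real.sin (k * y)) 2 circ :=
  memLp_of_bdd_circ (by fun_prop) fun _ => Real.abs_sin_le_one _

lemma ae_slice {P : ℝ × ℝ → Prop} (h : ∀ᵐ z ∂cyl, P z) :
    ∀ᵐ x : ℝ, ∀ᵐ y ∂circ, P (x, y) := by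
  rw [cyl_eq_prod] at h
  exact Measure.ae_ae_of_ae_prod h

lemma ae_memLp_slice {u : ℝ × ℝ → ℝ} (hu : MemLp u 2 cyl) :
    ∀ᵐ x : ℝ, MemLp (fun y => u (x, y)) 2 circ := by
  rw [cyl_eq_prod] at hu
  have h1 := hu.aestronglyMeasurable.prodMk_left
  have h2 := hu.integrable_sq.prod_right_ae
  filter_upwards [h1, h2] with x hx1 hx2
  exact (memLp_two_iff_integrable_sq hx1).2 hx2

lemma integral_sq_cyl {u : ℝ × ℝ → ℝ} (hu : MemLp u 2 cyl) :
    ∫ z, u z ^ 2 ∂cyl = ∫ x, ∫ y, u (x, y) ^ 2 ∂circ := by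
  have h := hu.integrable_sq
  rw [cyl_eq_prod] at h ⊢
  exact integral_prod _ h

lemma integrable_slice_sq {u : ℝ × ℝ → ℝ} (hu : MemLp u 2 cyl) :
    Integrable (fun x => ∫ y, u (x, y) ^ 2 ∂circ) := by
  have h := hu.integrable_sq
  rw [cyl_eq_prod] at h
  exact h.integral_prod_left

lemma integral_cos_sq_le (k : ℤ) : ∫ y, Real.cos (k * y) ^ 2 ∂circ ≤ 2 * Real.pi := by
  calc _ ≤ ∫ _, (1 : ℝ) ∂circ := by
        refine integral_mono (memLp_cos k).integrable_sq (integrable_const _) fun y => ?_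
        exact Real.cos_sq_le_one _
    _ = _ := by simp [Real.pi_pos.le]

lemma aestronglyMeasurable_mode {u : ℝ × ℝ → ℝ} (hu : AEStronglyMeasurable u cyl) (k : ℤ) :
    AEStronglyMeasurable (mode u k) volume := by
  rw [cyl_eq_prod] at hu
  have : AEStronglyMeasurable (fun z : ℝ × ℝ => u z * Real.cos (k * z.2)) (volume.prod circ) :=
    hu.mul (by fun_prop : Continuous fun z : ℝ × ℝ => Real.cos (k * z.2)).aestronglyMeasurable
  exact this.integral_prod_right'

lemma memLp_mode {u : ℝ × ℝ → ℝ} (hu : MemLp u 2 cyl) (k : ℤ) : MemLp (mode u k) 2 := by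
  have hm := aestronglyMeasurable_mode hu.aestronglyMeasurable k
  rw [memLp_two_iff_integrable_sq hm]
  refine ((integrable_slice_sq hu).mul_const (2 * Real.pi)).mono' (hm.pow 2) ?_
  filter_upwards [ae_memLp_slice hu] with x hx
  rw [Real.norm_of_nonneg (sq_nonneg _)]
  refine (sq_integral_mul_le hx (memLp_cos k)).trans ?_
  exact mul_le_mul_of_nonneg_left (integral_cos_sq_le k) (integral_nonneg fun y => sq_nonneg _)

lemma memLp_prod_mul {ξ c : ℝ → ℝ} (hξ : MemLp ξ 2) (hc : MemLp c 2 circ) :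
    MemLp (fun z : ℝ × ℝ => ξ z.1 * c z.2) 2 cyl := by
  rw [cyl_eq_prod]
  have hm : AEStronglyMeasurable (fun z : ℝ × ℝ => ξ z.1 * c z.2) (volume.prod circ) :=
    hξ.aestronglyMeasurable.comp_fst.mul hc.aestronglyMeasurable.comp_snd
  rw [memLp_two_iff_integrable_sq hm]
  have := hξ.integrable_sq.mul_prod hc.integrable_sq
  refine this.congr (Eventually.of_forall fun z => ?_)
  simp only; ring

lemma integral_mode_mul {u : ℝ × ℝ → ℝ} (hu : MemLp u 2 cyl) {ξ : ℝ → ℝ} (hξ : MemLp ξ 2)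
    (k : ℤ) : ∫ x, mode u k x * ξ x = ∫ z, u z * (ξ z.1 * Real.cos (k * z.2)) ∂cyl := by
  have hi := integrable_mul_L2 hu (memLp_prod_mul hξ (memLp_cos k))
  rw [cyl_eq_prod] at hi ⊢
  rw [integral_prod _ hi]
  refine integral_congr_ae (Eventually.of_forall fun x => ?_)
  simp only [mode]
  rw [← integral_mul_const]
  congr 1; ext y; ring

lemma memLp_of_test {ξ : ℝ → ℝ} (hξ : Continuous ξ) (hc : HasCompactSupport ξ) :
    MemLp ξ 2 := hξ.memLp_of_hasCompactSupport hc

lemma isTest_mul_cos {ξ : ℝ → ℝ} (hξ : ContDiff ℝ (⊤ : ℕ∞) ξ) (hc : HasCompactSupport ξ) {c : ℝ → ℝ}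
    (hcd : ContDiff ℝ (⊤ : ℕ∞) c) (hp : Function.Periodic c (2 * Real.pi)) :
    IsTest (fun z => ξ z.1 * c z.2) := by
  refine ⟨(hξ.comp contDiff_fst).mul (hcd.comp contDiff_snd), fun x y => by simp only [hp y], ?_⟩
  obtain ⟨L, hL⟩ := hc.isCompact.isBounded.exists_norm_le
  refine ⟨L + 1, fun x y hx => ?_⟩
  have : ξ x = 0 := by
    by_contra hne
    have := hL x (subset_tsupport _ hne)
    rw [Real.norm_eq_abs] at this
    linarith
  simp [this]

lemma fderiv_mul_fst {ξ c : ℝ → ℝ} (hξ : ContDiff ℝ (⊤ : ℕ∞) ξ) (hc : ContDiff ℝ (⊤ : ℕ∞) c)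
    (z : ℝ × ℝ) : fderiv ℝ (fun z : ℝ × ℝ => ξ z.1 * c z.2) z (1, 0) = deriv ξ z.1 * c z.2 := by
  have hd : Differentiable ℝ (fun z : ℝ × ℝ => ξ z.1 * c z.2) :=
    ((hξ.comp contDiff_fst).mul (hc.comp contDiff_snd)).differentiable (by simp)
  have h1 := hasDerivAt_fst hd z.1 z.2
  have h2 : HasDerivAt (fun t => ξ t * c z.2) (deriv ξ z.1 * c z.2) z.1 :=
    (hξ.differentiable (by simp) z.1).hasDerivAt.mul_const _
  exact h1.unique h2

lemma fderiv_mul_snd {ξ c : ℝ → ℝ} (hξ : ContDiff ℝ (⊤ : ℕ∞) ξ) (hc : ContDiff ℝ (⊤ : ℕ∞) c)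
    (z : ℝ × ℝ) : fderiv ℝ (fun z : ℝ × ℝ => ξ z.1 * c z.2) z (0, 1) = ξ z.1 * deriv c z.2 := by
  have hd : Differentiable ℝ (fun z : ℝ × ℝ => ξ z.1 * c z.2) :=
    ((hξ.comp contDiff_fst).mul (hc.comp contDiff_snd)).differentiable (by simp)
  have h1 := hasDerivAt_snd hd z.1 z.2
  have h2 : HasDerivAt (fun t => ξ z.1 * c t) (ξ z.1 * deriv c z.2) z.2 :=
    (hc.differentiable (by simp) z.2).hasDerivAt.const_mul _
  exact h1.unique h2

lemma periodic_cos (k : ℤ) : Function.Periodic (fun y : ℝ => Real.cos (k * y)) (2 * Real.pi) := by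
  intro y
  simp only
  rw [mul_add]; exact Real.cos_add_int_mul_two_pi _ k

lemma periodic_sin (k : ℤ) : Function.Periodic (fun y : ℝ => Real.sin (k * y)) (2 * Real.pi) := by
  intro y
  simp only
  rw [mul_add]; exact Real.sin_add_int_mul_two_pi _ k

lemma contDiff_cos_mul {n : WithTop ℕ∞} (k : ℝ) : ContDiff ℝ n (fun y : ℝ => Real.cos (k * y)) :=
  Real.contDiff_cos.comp (contDiff_const.mul contDiff_id)

lemma contDiff_sin_mul {n : WithTop ℕ∞} (k : ℝ) : ContDiff ℝ n (fun y : ℝ => Real.sin (k * y)) :=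
  Real.contDiff_sin.comp (contDiff_const.mul contDiff_id)

lemma deriv_cos_mul (k y : ℝ) : deriv (fun y : ℝ => Real.cos (k * y)) y = -k * Real.sin (k * y) := by
  have h : HasDerivAt (fun y : ℝ => Real.cos (k * y)) (-Real.sin (k * y) * (k * 1)) y :=
    (Real.hasDerivAt_cos (k * y)).comp y ((hasDerivAt_id y).const_mul k)
  rw [h.deriv]; ring

lemma deriv_sin_mul (k y : ℝ) : deriv (fun y : ℝ => Real.sin (k * y)) y = k * Real.cos (k * y) := by
  have h : HasDerivAt (fun y : ℝ => Real.sin (k * y)) (Real.cos (k * y) * (k * 1)) y :=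
    (Real.hasDerivAt_sin (k * y)).comp y ((hasDerivAt_id y).const_mul k)
  rw [h.deriv]; ring

lemma isWD_mode {u w : ℝ × ℝ → ℝ} (hu : MemLp u 2 cyl) (hw : MemLp w 2 cyl)
    (h : HasWeakDeriv (1, 0) u w) (k : ℤ) : IsWD (1 : ℝ) (mode u k) (mode w k) := by
  intro ξ hξ hc
  have h1 := h _ (isTest_mul_cos hξ hc (contDiff_cos_mul k) (periodic_cos k))
  simp_rw [fderiv_mul_fst hξ (contDiff_cos_mul k)] at h1
  simp_rw [fderiv_apply_one_eq_deriv]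
  rw [integral_mode_mul hu (memLp_of_test (hξ.continuous_deriv (by simp)) hc.deriv),
    integral_mode_mul hw (memLp_of_test hξ.continuous hc)]
  exact h1

/-- The weak derivative in y is tested twice, against ξ(x) cos(ky) and its y-derivative. Arbitrary ξ
gives the identity almost everywhere. -/
lemma mode_second_deriv_ae {u w v : ℝ × ℝ → ℝ} (hu : MemLp u 2 cyl) (hv : MemLp v 2 cyl)
    (h1 : HasWeakDeriv (0, 1) u w) (h2 : HasWeakDeriv (0, 1) w v) (k : ℤ) :
    ∀ᵐ x, mode v k x = -(k : ℝ) ^ 2 * mode u k x := by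
  have hmv := memLp_mode hv k
  have hmu := memLp_mode hu k
  have := ae_eq_of_integral_contDiff_smul_eq (μ := (volume : Measure ℝ)) (f := mode v k)
    (f' := fun x => -(k : ℝ) ^ 2 * mode u k x) (hmv.locallyIntegrable (by norm_num))
    ((hmu.const_mul _).locallyIntegrable (by norm_num)) ?_
  · exact this
  intro ξ hξ hc
  have hξL := memLp_of_test hξ.continuous hc
  have a2 := h2 _ (isTest_mul_cos hξ hc (contDiff_cos_mul k) (periodic_cos k))
  have hsin : ContDiff ℝ (⊤ : ℕ∞) (fun y : ℝ => -(k : ℝ) * Real.sin (k * y)) :=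
    contDiff_const.mul (contDiff_sin_mul k)
  have a1 := h1 _ (isTest_mul_cos hξ hc hsin
    (fun y => by simp only [(periodic_sin k) y]))
  simp_rw [fderiv_mul_snd hξ (contDiff_cos_mul k), deriv_cos_mul] at a2
  simp_rw [fderiv_mul_snd hξ hsin] at a1
  have hd : ∀ y : ℝ, deriv (fun y : ℝ => -(k : ℝ) * Real.sin (k * y)) y
      = -(k : ℝ) ^ 2 * Real.cos (k * y) := by
    intro y
    rw [deriv_const_mul _ ((contDiff_sin_mul (n := 1) (k : ℝ)).differentiable (by simp) y),
      deriv_sin_mul]; ring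
  simp_rw [hd] at a1
  have e1 : ∫ x, ξ x • mode v k x = ∫ z, v z * (ξ z.1 * Real.cos (k * z.2)) ∂cyl := by
    rw [← integral_mode_mul hv hξL]; congr 1; ext x; simp [mul_comm]
  have e2 : ∫ x, ξ x • (-(k : ℝ) ^ 2 * mode u k x)
      = ∫ z, u z * (ξ z.1 * (-(k : ℝ) ^ 2 * Real.cos (k * z.2))) ∂cyl := by
    have : ∀ z : ℝ × ℝ, u z * (ξ z.1 * (-(k : ℝ) ^ 2 * Real.cos (k * z.2)))
        = -(k : ℝ) ^ 2 * (u z * (ξ z.1 * Real.cos (k * z.2))) := fun z => by ring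
    simp_rw [this]
    rw [integral_const_mul, ← integral_mode_mul hu hξL, ← integral_const_mul]
    congr 1; ext x; simp only [smul_eq_mul]; ring
  rw [e1, e2, a1]
  linarith

/-- Parseval's identity with cosine and sine coefficients. -/
lemma hasSum_parseval {f : ℝ → ℝ} (hf : MemLp f 2 circ) :
    HasSum (fun k : ℤ => ((∫ y, f y * Real.cos (k * y) ∂circ) ^ 2
      + (∫ y, f y * Real.sin (k * y) ∂circ) ^ 2) / (2 * Real.pi)) (∫ y, f y ^ 2 ∂circ) := by
  have h2pi := Real.two_pi_pos
  have hfc : MemLp (fun y => (f y : ℂ)) 2 (volume.restrict (Set.Ioc 0 (2 * Real.pi))) := hf.ofReal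
  have h := hasSum_sq_fourierCoeffOn h2pi hfc
  have hcoef : ∀ k : ℤ, ‖fourierCoeffOn h2pi (fun y => (f y : ℂ)) k‖ ^ 2
      = ((∫ y, f y * Real.cos (k * y) ∂circ) ^ 2
      + (∫ y, f y * Real.sin (k * y) ∂circ) ^ 2) / (2 * Real.pi) ^ 2 := by
    intro k
    have hc : Integrable (fun y => f y * Real.cos (k * y)) circ := integrable_mul_L2 hf (memLp_cos k)
    have hs : Integrable (fun y => f y * Real.sin (k * y)) circ := integrable_mul_L2 hf (memLp_sin k)
    have e1 : ∀ y : ℝ, fourier (-k) (y : AddCircle (2 * Real.pi - 0)) • (f y : ℂ)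
        = ((f y * Real.cos (k * y) : ℝ) : ℂ)
          + ((f y * Real.sin (k * y) : ℝ) : ℂ) * (-Complex.I) := by
      intro y
      rw [fourier_coe_apply]
      have : (2 * Real.pi * Complex.I * ((-k : ℤ) : ℂ) * y / ((2 * Real.pi - 0 : ℝ) : ℂ) : ℂ)
          = ((-(k * y) : ℝ) : ℂ) * Complex.I := by
        have hpi : (Real.pi : ℂ) ≠ 0 := by exact_mod_cast Real.pi_ne_zero
        push_cast
        rw [sub_zero]
        field_simp
      rw [this, Complex.exp_mul_I, ← Complex.ofReal_cos, ← Complex.ofReal_sin, Real.cos_neg,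
        Real.sin_neg, smul_eq_mul]
      push_cast; ring
    rw [fourierCoeffOn_eq_integral, intervalIntegral.integral_of_le h2pi.le]
    simp_rw [e1]
    rw [integral_add hc.ofReal (hs.ofReal.mul_const _), integral_mul_const, integral_complex_ofReal,
      integral_complex_ofReal, norm_smul, mul_pow]
    rw [← Complex.normSq_eq_norm_sq]
    have : ∀ a c : ℝ, Complex.normSq ((a : ℂ) + (c : ℂ) * (-Complex.I)) = a ^ 2 + c ^ 2 := by
      intro a c
      rw [Complex.normSq_apply]; simp; ring
    erw [this]
    rw [sub_zero, Real.norm_of_nonneg (by positivity)]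
    field_simp
  simp_rw [hcoef] at h
  rw [intervalIntegral.integral_of_le h2pi.le] at h
  have h' := h.mul_left (2 * Real.pi)
  have e1 : (∫ y, f y ^ 2 ∂circ) = 2 * Real.pi * ((2 * Real.pi - 0)⁻¹ •
      ∫ y in Set.Ioc 0 (2 * Real.pi), ‖(f y : ℂ)‖ ^ 2) := by
    have : ∀ y, ‖(f y : ℂ)‖ ^ 2 = f y ^ 2 := fun y => by
      rw [Complex.norm_real, Real.norm_eq_abs, sq_abs]
    simp_rw [this]
    rw [sub_zero, smul_eq_mul, mul_inv_cancel_left₀ h2pi.ne']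
  rw [e1]
  refine h'.congr_fun fun k => ?_
  field_simp

/-- Sine coefficients of even periodic functions vanish. -/
lemma integral_mul_sin_eq_zero {q : ℝ → ℝ} (hp : Function.Periodic q (2 * Real.pi))
    (he : ∀ᵐ y ∂circ, q (-y) = q y) (k : ℤ) : ∫ y, q y * Real.sin (k * y) ∂circ = 0 := by
  have h2pi := Real.two_pi_pos
  have hper : Function.Periodic (fun y => q y * Real.sin (k * y)) (2 * Real.pi) := by
    intro y
    have h1 := hp y
    have h2 := periodic_sin k y
    simp only at h1 h2 ⊢
    rw [h1, h2]
  have h1 := hper.intervalIntegral_add_eq 0 (-(2 * Real.pi))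
  rw [zero_add, neg_add_cancel] at h1
  have h2 := intervalIntegral.integral_comp_neg (a := 0) (b := 2 * Real.pi)
    (fun y => q y * Real.sin (k * y))
  rw [neg_zero, ← h1] at h2
  rw [intervalIntegral.integral_of_le h2pi.le, intervalIntegral.integral_of_le h2pi.le] at h2
  have h3 : ∫ y, q (-y) * Real.sin (k * (-y)) ∂circ = - ∫ y, q y * Real.sin (k * y) ∂circ := by
    rw [← integral_neg]
    refine integral_congr_ae ?_
    filter_upwards [he] with y hy
    rw [hy, mul_neg, Real.sin_neg]; ring
  linarith

/-- Summation of modewise bounds. -/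
lemma integral_sq_le_of_modes {d E : ℝ × ℝ → ℝ} (hd : MemLp d 2 cyl) (hE : MemLp E 2 cyl)
    (hsin : ∀ᵐ x : ℝ, ∀ k : ℤ, ∫ y, d (x, y) * Real.sin (k * y) ∂circ = 0) {K J : ℝ} (hK : 0 ≤ K)
    (hJ : 0 ≤ J)
    (h : ∀ k : ℤ, ∫ x, mode d k x ^ 2
      ≤ K * (∫ x, mode E k x ^ 2) + if k ∈ ({1, -1} : Finset ℤ) then J else 0) :
    ∫ z, d z ^ 2 ∂cyl ≤ K * (∫ z, E z ^ 2 ∂cyl) + 2 * J := by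
  have h2pi := Real.two_pi_pos
  have hnE : 0 ≤ ∫ z, E z ^ 2 ∂cyl := integral_nonneg fun z => sq_nonneg _
  have hpars : ∀ᵐ x : ℝ, ENNReal.ofReal (∫ y, d (x, y) ^ 2 ∂circ)
      = ∑' k : ℤ, ENNReal.ofReal (mode d k x ^ 2 / (2 * Real.pi)) := by
    filter_upwards [ae_memLp_slice hd, hsin] with x hx hs
    have hp := hasSum_parseval hx
    have e : ∀ k : ℤ, ((∫ y, d (x, y) * Real.cos (k * y) ∂circ) ^ 2
        + (∫ y, d (x, y) * Real.sin (k * y) ∂circ) ^ 2) / (2 * Real.pi)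
        = mode d k x ^ 2 / (2 * Real.pi) := by
      intro k; rw [hs k, mode]; ring
    simp_rw [e] at hp
    rw [← hp.tsum_eq, ENNReal.ofReal_tsum_of_nonneg (fun k => by positivity) hp.summable]
  -- For `E` Bessel's inequality suffices, so its sine coefficients need not vanish.
  have hBessel : ∀ S : Finset ℤ, ∑ k ∈ S, (∫ x, mode E k x ^ 2) / (2 * Real.pi)
      ≤ ∫ z, E z ^ 2 ∂cyl := by
    intro S
    rw [integral_sq_cyl hE]
    have hi : ∀ k ∈ S, Integrable (fun x => mode E k x ^ 2 / (2 * Real.pi)) := fun k _ =>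
      (memLp_mode hE k).integrable_sq.div_const _
    simp_rw [← integral_div]
    rw [← integral_finsetSum S hi]
    refine integral_mono_ae (integrable_finsetSum S hi) (integrable_slice_sq hE) ?_
    filter_upwards [ae_memLp_slice hE] with x hx
    have hp := hasSum_parseval hx
    refine le_trans ?_ (sum_le_hasSum S (fun k _ => by positivity) hp)
    refine Finset.sum_le_sum fun k _ => ?_
    rw [mode]
    gcongr
    exact le_add_of_nonneg_right (sq_nonneg _)
  have hmain : ENNReal.ofReal (∫ z, d z ^ 2 ∂cyl)
      ≤ ENNReal.ofReal (K * (∫ z, E z ^ 2 ∂cyl) + 2 * J) := by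
    rw [integral_sq_cyl hd, ofReal_integral_eq_lintegral_ofReal (integrable_slice_sq hd)
      (Eventually.of_forall fun x => integral_nonneg fun y => sq_nonneg _),
      lintegral_congr_ae hpars, lintegral_tsum]
    swap
    · exact fun k => (((memLp_mode hd k).aestronglyMeasurable.aemeasurable.pow_const 2).div_const
        _).ennreal_ofReal
    have e : ∀ k : ℤ, ∫⁻ x, ENNReal.ofReal (mode d k x ^ 2 / (2 * Real.pi))
        = ENNReal.ofReal ((∫ x, mode d k x ^ 2) / (2 * Real.pi)) := by
      intro k
      rw [← integral_div, ofReal_integral_eq_lintegral_ofReal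
        ((memLp_mode hd k).integrable_sq.div_const _) (Eventually.of_forall fun x => by positivity)]
    simp_rw [e]
    rw [ENNReal.tsum_eq_iSup_sum]
    refine iSup_le fun S => ?_
    rw [← ENNReal.ofReal_sum_of_nonneg fun k _ => div_nonneg (integral_nonneg fun x => sq_nonneg _)
      h2pi.le]
    refine ENNReal.ofReal_le_ofReal ?_
    calc ∑ k ∈ S, (∫ x, mode d k x ^ 2) / (2 * Real.pi)
        ≤ ∑ k ∈ S, (K * ((∫ x, mode E k x ^ 2) / (2 * Real.pi))
            + if k ∈ ({1, -1} : Finset ℤ) then J else 0) := by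
          refine Finset.sum_le_sum fun k _ => ?_
          have h1 := h k
          have hj : (0 : ℝ) ≤ if k ∈ ({1, -1} : Finset ℤ) then J else 0 := by split_ifs <;> simp [hJ]
          rw [← mul_div_assoc, div_le_iff₀ h2pi, add_mul, div_mul_cancel₀ _ h2pi.ne']
          have : (1 : ℝ) ≤ 2 * Real.pi := by linarith [Real.pi_gt_three]
          nlinarith
      _ = K * (∑ k ∈ S, (∫ x, mode E k x ^ 2) / (2 * Real.pi))
            + ∑ k ∈ S, if k ∈ ({1, -1} : Finset ℤ) then J else 0 := by
          rw [Finset.sum_add_distrib, Finset.mul_sum]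
      _ ≤ K * (∫ z, E z ^ 2 ∂cyl) + 2 * J := by
          refine add_le_add (mul_le_mul_of_nonneg_left (hBessel S) hK) ?_
          rw [← Finset.sum_filter]
          calc ∑ k ∈ S with k ∈ ({1, -1} : Finset ℤ), J ≤ ∑ k ∈ ({1, -1} : Finset ℤ), J := by
                refine Finset.sum_le_sum_of_subset_of_nonneg ?_ fun _ _ _ => hJ
                intro k hk
                exact (Finset.mem_filter.1 hk).2
            _ = 2 * J := by
                rw [Finset.sum_const, show ({1, -1} : Finset ℤ).card = 2 from rfl]; simp
  exact (ENNReal.ofReal_le_ofReal_iff (by positivity)).1 hmain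

/-! ### Comparison with barriers depending on x. -/

/-- `u ∈ L²` has weak derivatives `∂ₓ u, ∂ₓ² u, ∂ᵧ u, ∂ᵧ² u` in `L²(ℝ × 𝕋)`. -/
structure IsReg (u : ℝ × ℝ → ℝ) : Prop where
  memL2 : MemL2 u
  x : WeakDiff (1, 0) u
  xx : WeakDiff (1, 0) (dx u)
  y : WeakDiff (0, 1) u
  yy : WeakDiff (0, 1) (dy u)

lemma MemH2.isReg {u : ℝ × ℝ → ℝ} (hu : MemH2 u) : IsReg u :=
  ⟨hu.1.1, hu.1.2.1, hu.2.1.2.1, hu.1.2.2, hu.2.2.2.2⟩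

section Comparison

/-- Comparison with a function of `x`, for the operator `ω - Δ`. -/
lemma IsReg.ae_nonpos {v : ℝ × ℝ → ℝ} (hv : IsReg v) {ω B s : ℝ} (hω : 0 < ω) {W W₁ W₂ : ℝ → ℝ}
    (hW : ∀ x, HasDerivAt W (W₁ x) x) (hW₁ : ∀ x, HasDerivAt W₁ (W₂ x) x) (hW₂ : Continuous W₂)
    (hB : ∀ᵐ z ∂cyl, s * v z + W z.1 ≤ B)
    (hsub : ∀ᵐ z ∂cyl, s * (ω * v z - dx (dx v) z - dy (dy v) z) + (ω * W z.1 - W₂ z.1) ≤ 0) :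
    ∀ᵐ z ∂cyl, s * v z + W z.1 ≤ 0 := by
  have cW : Continuous W := continuous_iff_continuousAt.2 fun x => (hW x).continuousAt
  have cW₁ : Continuous W₁ := continuous_iff_continuousAt.2 fun x => (hW₁ x).continuousAt
  have mx := hv.x.memL2
  have mxx := hv.xx.memL2
  have my := hv.y.memL2
  have myy := hv.yy.memL2
  have lift : ∀ {f : ℝ → ℝ}, Continuous f → LocallyIntegrable (fun z : ℝ × ℝ => f z.1) volume :=
    fun hf => (hf.comp continuous_fst).locallyIntegrable
  have fd : ∀ {f f' : ℝ → ℝ}, (∀ x, HasDerivAt f (f' x) x) → ∀ z e : ℝ × ℝ,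
      HasFDerivAt (fun z : ℝ × ℝ => f z.1) (f' z.1 • ContinuousLinearMap.fst ℝ ℝ ℝ) z :=
    fun hf z _ => (hf z.1).comp_hasFDerivAt z hasFDerivAt_fst
  have wdx : ∀ {f f' : ℝ → ℝ}, (∀ x, HasDerivAt f (f' x) x) → Continuous f' →
      IsWD ((1, 0) : ℝ × ℝ) (fun z : ℝ × ℝ => f z.1) (fun z => f' z.1) := by
    intro f f' hf hc
    refine IsWD.of_contDiff (fun z => (fd hf z 0).differentiableAt) (hc.comp continuous_fst)
      fun z => ?_
    rw [(fd hf z 0).fderiv]; simp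
  have wdy : ∀ {f f' : ℝ → ℝ}, (∀ x, HasDerivAt f (f' x) x) →
      IsWD ((0, 1) : ℝ × ℝ) (fun z : ℝ × ℝ => f z.1) (fun _ => 0) := by
    intro f f' hf
    refine IsWD.of_contDiff (fun z => (fd hf z 0).differentiableAt) continuous_const fun z => ?_
    rw [(fd hf z 0).fderiv]; simp
  have wdz : IsWD ((0, 1) : ℝ × ℝ) (fun _ : ℝ × ℝ => (0 : ℝ)) (fun _ => 0) :=
    fun ζ _ _ => by simp
  have per' : ∀ {f : ℝ × ℝ → ℝ}, MemL2 f → ∀ z k, f (z + shift k) = f z := fun hf z k =>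
    hf.1.shift_eq k z
  have sh1 : ∀ (z : ℝ × ℝ) k, (z + shift k).1 = z.1 := fun z k => by simp [shift]
  have ls : ∀ {f : ℝ × ℝ → ℝ}, MemL2 f → LocallyIntegrable (fun z => s * f z) volume :=
    fun hf => hf.locallyIntegrable.smul s
  -- The comparison takes place on the plane, where the periodic function and the barrier are both
  -- bounded above in the required combination; the barrier contributes nothing to the
  -- y-derivatives.
  refine ae_cyl_of_ae_volume (ae_nonpos_of_weak_subsolution (ω := ω) (B := B) hω
    (u := fun z => s * v z + W z.1) (ux := fun z => s * dx v z + W₁ z.1)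
    (uy := fun z => s * dy v z + 0) (uxx := fun z => s * dx (dx v) z + W₂ z.1)
    (uyy := fun z => s * dy (dy v) z + 0)
    ((ls hv.memL2).add (lift cW)) ((ls mx).add (lift cW₁))
    ((ls my).add (locallyIntegrable_const 0)) ((ls mxx).add (lift hW₂))
    ((ls myy).add (locallyIntegrable_const 0)) ?_ ?_ ?_ ?_ ?_ ?_)
  · exact IsWD.add ((hv.x.hasWeakDeriv.isWD hv.memL2 mx).const_mul s) (wdx hW cW₁)
      (ls hv.memL2) (ls mx) (lift cW) (lift cW₁)
  · exact IsWD.add ((hv.xx.hasWeakDeriv.isWD mx mxx).const_mul s) (wdx hW₁ hW₂)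
      (ls mx) (ls mxx) (lift cW₁) (lift hW₂)
  · exact IsWD.add ((hv.y.hasWeakDeriv.isWD hv.memL2 my).const_mul s) (wdy hW)
      (ls hv.memL2) (ls my) (lift cW) (locallyIntegrable_const 0)
  · exact IsWD.add ((hv.yy.hasWeakDeriv.isWD my myy).const_mul s) wdz
      (ls my) (ls myy) (locallyIntegrable_const 0) (locallyIntegrable_const 0)
  · refine ae_volume_of_ae_cyl (fun z k h => ?_) hB
    rwa [per' hv.memL2, sh1] at h
  · refine ae_volume_of_ae_cyl (fun z k h => ?_)
      (P := fun z => ω * (s * v z + W z.1) - (s * dx (dx v) z + W₂ z.1)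
        - (s * dy (dy v) z + 0) ≤ 0) ?_
    · rwa [per' hv.memL2, per' (f := dx (dx v)) mxx, per' (f := dy (dy v)) myy, sh1] at h
    · filter_upwards [hsub] with z hz
      linarith

/-- The second derivative of sech(αx) is α² sech(αx) minus a positive term. That term helps an upper
barrier; a lower barrier has to compensate it. -/
lemma hasDerivAt_sech_deriv (α x : ℝ) :
    HasDerivAt (fun x => -(1 * α) * th α x * sechPow α 1 x)
      ((α ^ 2 - 2 * α ^ 2 * (1 - th α x ^ 2)) * sechPow α 1 x) x :=
  (hasDerivAt_sechPow_deriv α 1 x).congr_deriv (by ring)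

lemma continuous_sech_second (α : ℝ) :
    Continuous (fun x => (α ^ 2 - 2 * α ^ 2 * (1 - th α x ^ 2)) * sechPow α 1 x) := by
  have := continuous_th α
  have := continuous_sechPow α 1
  fun_prop

/-- Closes the iterations below: a bound known up to a geometrically small error, for every `n`,
holds exactly off a countable union of null sets. -/
lemma ae_le_of_geometric {X : Type*} [MeasurableSpace X] {μ : Measure X} {f g : X → ℝ}
    {κ r : ℝ} (hr0 : 0 ≤ r) (hr : r < 1) (h : ∀ n : ℕ, ∀ᵐ z ∂μ, f z ≤ g z + r ^ n * κ) :
    ∀ᵐ z ∂μ, f z ≤ g z := by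
  rw [← ae_all_iff] at h
  filter_upwards [h] with z hz
  have h1 : Tendsto (fun n : ℕ => g z + r ^ n * κ) atTop (𝓝 (g z + 0 * κ)) :=
    ((tendsto_pow_atTop_nhds_zero_of_lt_one hr0 hr).mul_const κ).const_add _
  rw [zero_mul, add_zero] at h1
  exact ge_of_tendsto' h1 hz

/-- Exponential decay for bounded solutions of `(ω - Δ) v = O(η |v|) + O(sech (α x))`. -/
lemma IsReg.ae_abs_le_sech {v : ℝ × ℝ → ℝ} (hv : IsReg v) {ω α η B K₀ : ℝ} (hω : 0 < ω)
    (hη : 0 ≤ η) (hK : 0 ≤ K₀) (hgap : η < ω - α ^ 2) (hB : ∀ᵐ z ∂cyl, |v z| ≤ B)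
    (heq : ∀ᵐ z ∂cyl, |ω * v z - dx (dx v) z - dy (dy v) z|
      ≤ η * |v z| + K₀ * sechPow α 1 z.1) :
    ∀ᵐ z ∂cyl, |v z| ≤ K₀ / (ω - α ^ 2 - η) * sechPow α 1 z.1 := by
  set K := K₀ / (ω - α ^ 2 - η) with hKdef
  have hgap' : 0 < ω - α ^ 2 - η := by linarith
  have hKK : K * (ω - α ^ 2 - η) = K₀ := div_mul_cancel₀ _ hgap'.ne'
  have hK0 : 0 ≤ K := by positivity
  set B' := max B 0 with hB'
  have hB'0 : 0 ≤ B' := le_max_right _ _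
  have hr1 : η / ω < 1 := by rw [div_lt_one hω]; nlinarith [sq_nonneg α]
  -- The maximum principle is available for ω - Δ without potential, so η|v| is treated as a source.
  -- Inserting |v| ≤ K sech + κ returns the same bound with κ replaced by (η/ω)κ, starting from the
  -- L^∞ bound.
  refine ae_le_of_geometric (κ := B') (r := η / ω) (by positivity) hr1 fun n => ?_
  induction n with
  | zero =>
    filter_upwards [hB] with z hz
    have := sechPow_pos α 1 z.1
    have : B ≤ B' := le_max_left _ _
    have : 0 ≤ K * sechPow α 1 z.1 := by positivity
    simp only [pow_zero, one_mul]
    linarith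
  | succ n ih =>
    set κ := (η / ω) ^ n * B' with hκ
    have hκ0 : 0 ≤ κ := by positivity
    have hκ1 : (η / ω) ^ (n + 1) * B' = η / ω * κ := by rw [hκ]; ring
    have hωκ : ω * (η / ω * κ) = η * κ := by field_simp
    rw [hκ1]
    have main : ∀ s : ℝ, |s| = 1 →
        ∀ᵐ z ∂cyl, s * v z + (-K * sechPow α 1 z.1 - η / ω * κ) ≤ 0 := by
      intro s hs
      refine hv.ae_nonpos (B := B') hω (W := fun x => -K * sechPow α 1 x - η / ω * κ)
        (W₁ := fun x => -K * (-(1 * α) * th α x * sechPow α 1 x))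
        (W₂ := fun x => -K * ((α ^ 2 - 2 * α ^ 2 * (1 - th α x ^ 2)) * sechPow α 1 x))
        (fun x => ((hasDerivAt_sechPow α 1 x).const_mul (-K)).sub_const _)
        (fun x => (hasDerivAt_sech_deriv α x).const_mul (-K))
        (continuous_const.mul (continuous_sech_second α)) ?_ ?_
      · filter_upwards [hB] with z hz
        have h1 : s * v z ≤ |v z| := by
          calc s * v z ≤ |s * v z| := le_abs_self _
            _ = _ := by rw [abs_mul, hs, one_mul]
        have := sechPow_pos α 1 z.1
        have : B ≤ B' := le_max_left _ _
        have : 0 ≤ K * sechPow α 1 z.1 := by positivity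
        have : 0 ≤ η / ω * κ := by positivity
        linarith
      · filter_upwards [heq, ih] with z hz hz2
        set S := sechPow α 1 z.1
        have hS : 0 < S := sechPow_pos _ _ _
        have h1 : s * (ω * v z - dx (dx v) z - dy (dy v) z) ≤ η * |v z| + K₀ * S := by
          refine le_trans ?_ hz
          calc _ ≤ |s * (ω * v z - dx (dx v) z - dy (dy v) z)| := le_abs_self _
            _ = _ := by rw [abs_mul, hs, one_mul]
        have h2 : η * |v z| ≤ η * (K * S + κ) := mul_le_mul_of_nonneg_left hz2 hη
        have h3 : 0 ≤ K * S * (2 * α ^ 2 * (1 - th α z.1 ^ 2)) := by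
          have := th_sq_le_one α z.1
          have : 0 ≤ 1 - th α z.1 ^ 2 := by linarith
          positivity
        have h4 : ω * (-K * S - η / ω * κ) = -(ω * K * S) - η * κ := by
          rw [mul_sub, hωκ]; ring
        rw [h4]
        nlinarith
    filter_upwards [main 1 (by simp), main (-1) (by simp)] with z h1 h2
    rw [abs_le]
    constructor <;> linarith

/-- A lower exponential bound. -/
lemma IsReg.sech_le_ae {φ : ℝ × ℝ → ℝ} (hφ : IsReg φ) {p ω l η B M m κ : ℝ} (hp : 1 < p)
    (hω : 0 < ω) (hη : 0 ≤ η) (hηω : η < ω) (hl : ω < l ^ 2) (hm : 0 < m)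
    (hB : ∀ᵐ z ∂cyl, |φ z| ≤ B)
    (heq : ∀ᵐ z ∂cyl, |ω * φ z - dx (dx φ) z - dy (dy φ) z - |φ z| ^ (p - 1) * φ z|
      ≤ κ * sechPow l 1 z.1)
    (hin : ∀ᵐ z ∂cyl, |z.1| ≤ M → m ≤ φ z)
    (hout : ∀ᵐ z ∂cyl, M ≤ |z.1| → |φ z| ^ (p - 1) ≤ η)
    (hM : ∀ x : ℝ, M ≤ |x| → 2 * l ^ 2 * (1 - th l x ^ 2) ≤ (l ^ 2 - ω) / 2)
    (hκ : κ ≤ m ^ p * (l ^ 2 - ω) / (8 * l ^ 2)) :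
    ∀ᵐ z ∂cyl, m ^ p / (4 * l ^ 2) * sechPow l 1 z.1 ≤ φ z := by
  have hl2 : 0 < l ^ 2 := by linarith
  have hmp : 0 < m ^ p := Real.rpow_pos_of_pos hm p
  -- For |x| ≤ `M` the unfavourable sech² term of the barrier is at most 2 l² σ = m^p/2, half of the
  -- source m^p. The hypothesis on `κ` is κ ≤ σ(l² - ω)/2: the forcing uses at most half of the gap.
  set σ := m ^ p / (4 * l ^ 2) with hσ
  have hσ0 : 0 < σ := by positivity
  have hl0 : l ≠ 0 := fun h => by simp [h] at hl2
  have hσl : σ * l ^ 2 = m ^ p / 4 := by rw [hσ]; field_simp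
  have hκσ : κ ≤ σ * ((l ^ 2 - ω) / 2) := by
    refine hκ.trans (le_of_eq ?_); rw [hσ]; field_simp; ring
  set B' := max B 0 with hB'
  have hB'0 : 0 ≤ B' := le_max_right _ _
  have hr1 : η / ω < 1 := by rw [div_lt_one hω]; exact hηω
  have hS1 : ∀ x, sechPow l 1 x ≤ 1 := fun x => sechPow_le_one zero_le_one x
  -- The sign of φ outside the core is not known beforehand. The bound σ sech - t ≤ φ improves from
  -- t to (η/ω)t at each round.
  refine ae_le_of_geometric (κ := B' + σ) (r := η / ω) (by positivity) hr1 fun n => ?_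
  induction n with
  | zero =>
    filter_upwards [hB] with z hz
    have h1 : B ≤ B' := le_max_left _ _
    have h2 := hS1 z.1
    have h3 := neg_abs_le (φ z)
    simp only [pow_zero, one_mul]
    nlinarith
  | succ n ih =>
    set t := (η / ω) ^ n * (B' + σ) with ht
    have ht0 : 0 ≤ t := by positivity
    have ht1 : (η / ω) ^ (n + 1) * (B' + σ) = η / ω * t := by rw [ht]; ring
    have hωt : ω * (η / ω * t) = η * t := by field_simp
    rw [ht1]
    have main : ∀ᵐ z ∂cyl, (-1) * φ z + (σ * sechPow l 1 z.1 - η / ω * t) ≤ 0 := by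
      refine hφ.ae_nonpos (B := B' + σ) hω (W := fun x => σ * sechPow l 1 x - η / ω * t)
        (W₁ := fun x => σ * (-(1 * l) * th l x * sechPow l 1 x))
        (W₂ := fun x => σ * ((l ^ 2 - 2 * l ^ 2 * (1 - th l x ^ 2)) * sechPow l 1 x))
        (fun x => ((hasDerivAt_sechPow l 1 x).const_mul σ).sub_const _)
        (fun x => (hasDerivAt_sech_deriv l x).const_mul σ)
        (continuous_const.mul (continuous_sech_second l)) ?_ ?_
      · filter_upwards [hB] with z hz
        have h1 : B ≤ B' := le_max_left _ _
        have h2 := hS1 z.1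
        have h3 := neg_abs_le (φ z)
        have : 0 ≤ η / ω * t := by positivity
        nlinarith
      · filter_upwards [heq, ih, hin, hout] with z hz hz2 hz3 hz4
        set S := sechPow l 1 z.1
        have hS : 0 < S := sechPow_pos _ _ _
        have hS' : S ≤ 1 := hS1 z.1
        have h1 := (abs_le.1 hz).1
        have hth : 0 ≤ 1 - th l z.1 ^ 2 := by linarith [th_sq_le_one l z.1]
        have h4 : ω * (σ * S - η / ω * t) = ω * σ * S - η * t := by rw [mul_sub, hωt]; ring
        rw [h4]
        have hκS : κ * S ≤ σ * ((l ^ 2 - ω) / 2) * S := mul_le_mul_of_nonneg_right hκσ hS.le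
        -- In the core the source pays for the sech² term; outside, that term and the forcing each
        -- take half of the gap l² - ω.
        rcases le_total |z.1| M with hx | hx
        · have hφm := hz3 hx
          have hφ0 : 0 < φ z := hm.trans_le hφm
          have hN : m ^ p ≤ |φ z| ^ (p - 1) * φ z := by
            rw [abs_of_pos hφ0]
            calc m ^ p ≤ φ z ^ p := Real.rpow_le_rpow hm.le hφm (by linarith)
              _ = _ := by
                rw [← Real.rpow_add_one hφ0.ne']; congr 1; ring
          have h5 : σ * S * (2 * l ^ 2 * (1 - th l z.1 ^ 2)) ≤ σ * S * (2 * l ^ 2) := by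
            refine mul_le_mul_of_nonneg_left ?_ (by positivity)
            nlinarith [sq_nonneg (th l z.1)]
          have h6 : σ * l ^ 2 * S ≤ σ * l ^ 2 := by
            have : 0 < σ * l ^ 2 := by positivity
            nlinarith
          have h7 : 0 ≤ σ * S * (l ^ 2 - ω) := by
            have : 0 ≤ l ^ 2 - ω := by linarith
            positivity
          have h8 : 0 ≤ η * t := by positivity
          linarith
        · have hη' := hz4 hx
          have hN : -(η * t) ≤ |φ z| ^ (p - 1) * φ z := by
            have hpow : 0 ≤ |φ z| ^ (p - 1) := Real.rpow_nonneg (abs_nonneg _) _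
            rcases le_total 0 (φ z) with h0 | h0
            · have : 0 ≤ |φ z| ^ (p - 1) * φ z := mul_nonneg hpow h0
              have : 0 ≤ η * t := by positivity
              linarith
            -- Where φ is negative, the previous round and |φ|^(p-1) ≤ η limit the loss to ηt,
            -- exactly what the constant (η/ω)t in the barrier supplies.
            · have h9 : -t ≤ φ z := by
                have : 0 ≤ σ * S := by positivity
                linarith
              have h10 := mul_le_mul_of_nonneg_right hη' ht0
              have h11 := mul_le_mul_of_nonneg_left h9 hpow
              linarith
          have h5 : σ * S * (2 * l ^ 2 * (1 - th l z.1 ^ 2)) ≤ σ * S * ((l ^ 2 - ω) / 2) :=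
            mul_le_mul_of_nonneg_left (hM z.1 hx) (by positivity)
          linarith
    filter_upwards [main] with z h1
    linarith

end Comparison

/-! ### Weak derivatives of classical functions; stability under sums. -/

section Regularity

lemma IsTest.fderiv_apply {ζ : ℝ × ℝ → ℝ} (h : IsTest ζ) (e : ℝ × ℝ) :
    IsTest (fun z => fderiv ℝ ζ z e) := by
  refine ⟨contDiff_fderiv_apply h.smooth e, fun x y => ?_, ?_⟩
  · have h1 : (fun z : ℝ × ℝ => ζ (z + (0, 2 * Real.pi))) = ζ := by
      ext z
      have := h.periodic z.1 z.2
      simpa [Prod.add_def] using this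
    have h2 := fderiv_comp_add_right (𝕜 := ℝ) (f := ζ) (x := (x, y)) (0, 2 * Real.pi)
    rw [h1] at h2
    have h3 : ((x, y) : ℝ × ℝ) + (0, 2 * Real.pi) = (x, y + 2 * Real.pi) := by simp
    rw [h3] at h2
    rw [h2]
  · obtain ⟨M, hM⟩ := h.support
    refine ⟨M + 1, fun x y hx => ?_⟩
    have : ζ =ᶠ[𝓝 (x, y)] fun _ => 0 := by
      have h1 : M < |((x, y) : ℝ × ℝ).1| := by simp only; linarith
      filter_upwards [(continuous_fst.abs.tendsto (x, y)).eventually_const_lt h1] with w hw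
        using hM w.1 w.2 hw.le
    rw [this.fderiv_eq]; simp

lemma IsTest.continuous_fderiv {ζ : ℝ × ℝ → ℝ} (h : IsTest ζ) (e : ℝ × ℝ) :
    Continuous (fun z => fderiv ℝ ζ z e) := (h.fderiv_apply e).smooth.continuous

lemma integrable_cyl_of_continuous {f : ℝ × ℝ → ℝ} (hf : Continuous f) {M : ℝ}
    (hM : ∀ x y : ℝ, M ≤ |x| → f (x, y) = 0) : Integrable f cyl := by
  have h1 : IntegrableOn f (Set.Icc (-M) M ×ˢ Set.Icc 0 (2 * Real.pi)) volume :=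
    hf.continuousOn.integrableOn_compact (isCompact_Icc.prod isCompact_Icc)
  rw [cyl]
  refine IntegrableOn.of_forall_sdiff_eq_zero (s := Set.Icc (-M) M ×ˢ Set.Ioc 0 (2 * Real.pi))
    (h1.mono_set (Set.prod_mono le_rfl Set.Ioc_subset_Icc_self))
    (MeasurableSet.univ.prod measurableSet_Ioc) ?_
  rintro ⟨x, y⟩ ⟨h2, h3⟩
  refine hM x y ?_
  by_contra! hlt
  rw [abs_lt] at hlt
  exact h3 ⟨⟨hlt.1.le, hlt.2.le⟩, h2.2⟩

lemma IsTest.integrable_mul {ζ u : ℝ × ℝ → ℝ} (h : IsTest ζ) (hu : Continuous u) :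
    Integrable (fun z => u z * ζ z) cyl := by
  obtain ⟨M, hM⟩ := h.support
  exact integrable_cyl_of_continuous (hu.mul h.smooth.continuous) (M := M)
    fun x y hx => by rw [hM x y hx, mul_zero]

lemma IsTest.integrable_mul_memLp {ζ u : ℝ × ℝ → ℝ} (h : IsTest ζ) (hu : MemL2 u) :
    Integrable (fun z => u z * ζ z) cyl := by
  have hζ : MemLp ζ 2 cyl := by
    rw [memLp_two_iff_integrable_sq h.smooth.continuous.aestronglyMeasurable]
    simpa [sq] using h.integrable_mul h.smooth.continuous
  exact integrable_mul_L2 hu.2 hζ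

lemma hasWeakDeriv_fst {u ux : ℝ × ℝ → ℝ} (hu : Continuous u) (hux : Continuous ux)
    (hd : ∀ x y, HasDerivAt (fun t => u (t, y)) (ux (x, y)) x) : HasWeakDeriv (1, 0) u ux := by
  intro ζ hζ
  have i1 := (hζ.fderiv_apply (1, 0)).integrable_mul hu
  have i2 := hζ.integrable_mul hux
  rw [cyl_eq_prod] at i1 i2 ⊢
  rw [integral_prod_symm _ i1, integral_prod_symm _ i2, ← integral_neg]
  congr 1; ext y
  obtain ⟨M, hM⟩ := hζ.support
  have cs : ∀ {f : ℝ → ℝ}, Continuous f → (∀ x, M + 1 ≤ |x| → f x = 0) → Integrable f := by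
    intro f hf hz
    refine hf.integrable_of_hasCompactSupport (HasCompactSupport.intro
      (isCompact_Icc (a := -(M + 1)) (b := M + 1)) fun x hx => hz x ?_)
    by_contra! hlt
    rw [abs_lt] at hlt
    exact hx ⟨hlt.1.le, hlt.2.le⟩
  have hM' : ∀ x y, M + 1 ≤ |x| → fderiv ℝ ζ (x, y) (1, 0) = 0 := by
    intro x y hx
    have : ζ =ᶠ[𝓝 (x, y)] fun _ => 0 := by
      have h1 : M < |((x, y) : ℝ × ℝ).1| := by simp only; linarith
      filter_upwards [(continuous_fst.abs.tendsto (x, y)).eventually_const_lt h1] with w hw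
        using hM w.1 w.2 hw.le
    rw [this.fderiv_eq]; simp
  have cζ := hζ.smooth.continuous
  have cζ' := hζ.continuous_fderiv (1, 0)
  have := integral_mul_deriv_eq_deriv_mul_of_integrable (u := fun t => u (t, y))
    (v := fun t => ζ (t, y)) (u' := fun t => ux (t, y))
    (v' := fun t => fderiv ℝ ζ (t, y) (1, 0)) (fun x _ => hd x y)
    (fun x _ => hasDerivAt_fst (hζ.smooth.differentiable (by simp)) x y)
    (cs ((hu.comp (by fun_prop)).mul (cζ'.comp (by fun_prop : Continuous fun t : ℝ => (t, y))))
      fun x hx => by simp [hM' x y hx])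
    (cs ((hux.comp (by fun_prop)).mul (cζ.comp (by fun_prop : Continuous fun t : ℝ => (t, y))))
      fun x hx => by simp [hM x y (by linarith)])
    (cs ((hu.comp (by fun_prop)).mul (cζ.comp (by fun_prop : Continuous fun t : ℝ => (t, y))))
      fun x hx => by simp [hM x y (by linarith)])
  exact this

lemma hasWeakDeriv_snd {u uy : ℝ × ℝ → ℝ} (hu : Continuous u) (huy : Continuous uy)
    (hp : PeriodicY u)
    (hd : ∀ x y, HasDerivAt (fun t => u (x, t)) (uy (x, y)) y) : HasWeakDeriv (0, 1) u uy := by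
  intro ζ hζ
  have i1 := (hζ.fderiv_apply (0, 1)).integrable_mul hu
  have i2 := hζ.integrable_mul huy
  rw [cyl_eq_prod] at i1 i2 ⊢
  rw [integral_prod _ i1, integral_prod _ i2, ← integral_neg]
  congr 1; ext x
  have cζ' := hζ.continuous_fderiv (0, 1)
  have := intervalIntegral.integral_mul_deriv_eq_deriv_mul (a := 0) (b := 2 * Real.pi)
    (u := fun t => u (x, t)) (v := fun t => ζ (x, t)) (u' := fun t => uy (x, t))
    (v' := fun t => fderiv ℝ ζ (x, t) (0, 1)) (fun y _ => hd x y)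
    (fun y _ => hasDerivAt_snd (hζ.smooth.differentiable (by simp)) x y)
    ((huy.comp (by fun_prop)).intervalIntegrable _ _)
    ((cζ'.comp (by fun_prop : Continuous fun t : ℝ => (x, t))).intervalIntegrable _ _)
  have e1 := hp x 0
  have e2 := hζ.periodic x 0
  rw [zero_add] at e1 e2
  rw [intervalIntegral.integral_of_le Real.two_pi_pos.le,
    intervalIntegral.integral_of_le Real.two_pi_pos.le, e1, e2, sub_self, zero_sub] at this
  exact this

/-- `wd` is an arbitrary representative. Any two representatives pair equally with test functions,
so a second weak derivative transfers from `w` to `wd e u`. -/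
lemma HasWeakDeriv.weakDiff_wd {e : ℝ × ℝ} {u w w' : ℝ × ℝ → ℝ} (hw : MemL2 w)
    (h : HasWeakDeriv e u w) (hw' : MemL2 w') (h' : HasWeakDeriv e w w') :
    WeakDiff e u ∧ WeakDiff e (wd e u) := by
  have h1 : WeakDiff e u := ⟨w, hw, h⟩
  refine ⟨h1, w', hw', fun ζ hζ => ?_⟩
  have a1 := h1.hasWeakDeriv _ (hζ.fderiv_apply e)
  have a2 := h _ (hζ.fderiv_apply e)
  rw [← h' ζ hζ]
  linarith

lemma MemL2.add {u v : ℝ × ℝ → ℝ} (hu : MemL2 u) (hv : MemL2 v) :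
    MemL2 (fun z => u z + v z) :=
  ⟨fun x y => by simp only [hu.1 x y, hv.1 x y], hu.2.add hv.2⟩

lemma MemL2.const_mul {u : ℝ × ℝ → ℝ} (hu : MemL2 u) (c : ℝ) : MemL2 (fun z => c * u z) :=
  ⟨fun x y => by simp only [hu.1 x y], hu.2.const_mul c⟩

lemma HasWeakDeriv.add {e : ℝ × ℝ} {u w u' w' : ℝ × ℝ → ℝ} (hu : MemL2 u) (hw : MemL2 w)
    (hu' : MemL2 u') (hw' : MemL2 w') (h : HasWeakDeriv e u w) (h' : HasWeakDeriv e u' w') :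
    HasWeakDeriv e (fun z => u z + u' z) (fun z => w z + w' z) := by
  intro ζ hζ
  have hd := hζ.fderiv_apply e
  simp_rw [add_mul]
  rw [integral_add (hd.integrable_mul_memLp hu) (hd.integrable_mul_memLp hu'),
    integral_add (hζ.integrable_mul_memLp hw) (hζ.integrable_mul_memLp hw'), h ζ hζ, h' ζ hζ]
  ring

lemma HasWeakDeriv.const_mul {e : ℝ × ℝ} {u w : ℝ × ℝ → ℝ} (h : HasWeakDeriv e u w) (c : ℝ) :
    HasWeakDeriv e (fun z => c * u z) (fun z => c * w z) := by
  intro ζ hζ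
  simp_rw [mul_assoc, integral_const_mul, h ζ hζ]
  ring

lemma IsReg.of_hasWeakDeriv {u ux uxx uy uyy : ℝ × ℝ → ℝ} (hu : MemL2 u) (mx : MemL2 ux)
    (mxx : MemL2 uxx) (my : MemL2 uy) (myy : MemL2 uyy)
    (hx : HasWeakDeriv (1, 0) u ux) (hxx : HasWeakDeriv (1, 0) ux uxx)
    (hy : HasWeakDeriv (0, 1) u uy) (hyy : HasWeakDeriv (0, 1) uy uyy) : IsReg u := by
  obtain ⟨a1, a2⟩ := hx.weakDiff_wd mx mxx hxx
  obtain ⟨b1, b2⟩ := hy.weakDiff_wd my myy hyy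
  exact ⟨hu, a1, a2, b1, b2⟩

lemma IsReg.add {u v : ℝ × ℝ → ℝ} (hu : IsReg u) (hv : IsReg v) :
    IsReg (fun z => u z + v z) :=
  IsReg.of_hasWeakDeriv (hu.memL2.add hv.memL2) (hu.x.memL2.add hv.x.memL2)
    (hu.xx.memL2.add hv.xx.memL2) (hu.y.memL2.add hv.y.memL2) (hu.yy.memL2.add hv.yy.memL2)
    (hu.x.hasWeakDeriv.add hu.memL2 hu.x.memL2 hv.memL2 hv.x.memL2 hv.x.hasWeakDeriv)
    (hu.xx.hasWeakDeriv.add hu.x.memL2 hu.xx.memL2 hv.x.memL2 hv.xx.memL2 hv.xx.hasWeakDeriv)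
    (hu.y.hasWeakDeriv.add hu.memL2 hu.y.memL2 hv.memL2 hv.y.memL2 hv.y.hasWeakDeriv)
    (hu.yy.hasWeakDeriv.add hu.y.memL2 hu.yy.memL2 hv.y.memL2 hv.yy.memL2 hv.yy.hasWeakDeriv)

lemma IsReg.const_mul {u : ℝ × ℝ → ℝ} (hu : IsReg u) (c : ℝ) : IsReg (fun z => c * u z) :=
  IsReg.of_hasWeakDeriv (hu.memL2.const_mul c) (hu.x.memL2.const_mul c) (hu.xx.memL2.const_mul c)
    (hu.y.memL2.const_mul c) (hu.yy.memL2.const_mul c) (hu.x.hasWeakDeriv.const_mul c)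
    (hu.xx.hasWeakDeriv.const_mul c) (hu.y.hasWeakDeriv.const_mul c)
    (hu.yy.hasWeakDeriv.const_mul c)

/-- The functions `sech (b x) ^ s cos (k y)` are regular. -/
lemma isReg_sechPow_mul_cos {b s : ℝ} (hb : 0 < b) (hs : 0 < s) (k : ℤ) :
    IsReg (fun z => sechPow b s z.1 * Real.cos (k * z.2)) := by
  have hg := memLp_two_sechPow hb hs
  have hg₁ := memLp_th_mul (b := b) hg (-(s * b))
  have hg₂ : MemLp (fun x => ((s * b) ^ 2 * th b x ^ 2 - s * b * b * (1 - th b x ^ 2))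
      * sechPow b s x) 2 := by
    have := memLp_pot_mul (b := b) (s := s) hg
    simpa only [pot, mul_pow] using this
  have ct := continuous_th b
  have cg := continuous_sechPow b s
  have pc : ∀ (q c : ℝ → ℝ), Function.Periodic c (2 * Real.pi) →
      PeriodicY (fun z => q z.1 * c z.2) := fun q c hc x y => by simp only [hc y]
  have hcos := memLp_cos k
  have hsin := (memLp_sin k).const_mul (-(k : ℝ))
  have hcos2 := (memLp_cos k).const_mul (-(k : ℝ) ^ 2)
  have psin : Function.Periodic (fun y : ℝ => -(k : ℝ) * Real.sin (k * y)) (2 * Real.pi) :=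
    fun y => by simp only [(periodic_sin k) y]
  have pcos2 : Function.Periodic (fun y : ℝ => -(k : ℝ) ^ 2 * Real.cos (k * y)) (2 * Real.pi) :=
    fun y => by simp only [(periodic_cos k) y]
  have dcos : ∀ y : ℝ, HasDerivAt (fun y : ℝ => Real.cos (k * y)) (-(k : ℝ) * Real.sin (k * y)) y :=
    fun y => by
      rw [← deriv_cos_mul]
      exact ((contDiff_cos_mul (n := 1) (k : ℝ)).differentiable (by simp) y).hasDerivAt
  have dsin : ∀ y : ℝ, HasDerivAt (fun y : ℝ => -(k : ℝ) * Real.sin (k * y))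
      (-(k : ℝ) ^ 2 * Real.cos (k * y)) y := fun y => by
    have h1 := ((contDiff_sin_mul (n := 1) (k : ℝ)).differentiable (by simp) y).hasDerivAt
    rw [deriv_sin_mul] at h1
    exact (h1.const_mul (-(k : ℝ))).congr_deriv (by ring)
  refine IsReg.of_hasWeakDeriv
    (ux := fun z => -(s * b) * th b z.1 * sechPow b s z.1 * Real.cos (k * z.2))
    (uxx := fun z => ((s * b) ^ 2 * th b z.1 ^ 2 - s * b * b * (1 - th b z.1 ^ 2))
      * sechPow b s z.1 * Real.cos (k * z.2))
    (uy := fun z => sechPow b s z.1 * (-(k : ℝ) * Real.sin (k * z.2)))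
    (uyy := fun z => sechPow b s z.1 * (-(k : ℝ) ^ 2 * Real.cos (k * z.2)))
    ⟨pc _ _ (periodic_cos k), memLp_prod_mul hg hcos⟩
    ⟨pc (fun x => -(s * b) * th b x * sechPow b s x) _ (periodic_cos k), memLp_prod_mul hg₁ hcos⟩
    ⟨pc (fun x => ((s * b) ^ 2 * th b x ^ 2 - s * b * b * (1 - th b x ^ 2)) * sechPow b s x) _
      (periodic_cos k), memLp_prod_mul hg₂ hcos⟩
    ⟨pc (sechPow b s) _ psin, memLp_prod_mul hg hsin⟩
    ⟨pc (sechPow b s) _ pcos2, memLp_prod_mul hg hcos2⟩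
    (hasWeakDeriv_fst (by fun_prop) (by fun_prop)
      fun x y => (hasDerivAt_sechPow b s x).mul_const (Real.cos (k * y)))
    (hasWeakDeriv_fst (by fun_prop) (by fun_prop)
      fun x y => (hasDerivAt_sechPow_deriv b s x).mul_const (Real.cos (k * y)))
    (hasWeakDeriv_snd (by fun_prop) (by fun_prop) (pc _ _ (periodic_cos k))
      fun x y => (dcos y).const_mul (sechPow b s x))
    (hasWeakDeriv_snd (by fun_prop) (by fun_prop) (pc (sechPow b s) _ psin)
      fun x y => (dsin y).const_mul (sechPow b s x))

end Regularity

/-! ### The soliton, the profile Ψ and the Darboux potential. -/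

section Soliton

variable {p : ℝ}

/-- The inverse length scale of the soliton at `ω_p`. -/
def bSol (p : ℝ) : ℝ := (p - 1) / 2 * √(omegaP p)

/-- The decay exponent of `R_{ω_p}`, in units of `bSol`. -/
def sSol (p : ℝ) : ℝ := 2 / (p - 1)

/-- The decay exponent of `R_{ω_p} ^ ((p + 1) / 2)`, in units of `bSol`. -/
def sPsi (p : ℝ) : ℝ := (p + 1) / (p - 1)

/-- The amplitude of `R_{ω_p}`. -/
def ampSol (p : ℝ) : ℝ := omegaP p ^ (1 / (p - 1)) * ((p + 1) / 2) ^ (1 / (p - 1))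

lemma omegaP_pos (hp : 1 < p) : 0 < omegaP p := by
  have : 0 < p - 1 := by linarith
  unfold omegaP; positivity

lemma bSol_pos (hp : 1 < p) : 0 < bSol p := by
  have : 0 < p - 1 := by linarith
  have := Real.sqrt_pos.2 (omegaP_pos hp)
  unfold bSol; positivity

lemma sSol_pos (hp : 1 < p) : 0 < sSol p := by
  have : 0 < p - 1 := by linarith
  unfold sSol; positivity

lemma sPsi_pos (hp : 1 < p) : 0 < sPsi p := by
  have : 0 < p - 1 := by linarith
  unfold sPsi; positivity

lemma ampSol_pos (hp : 1 < p) : 0 < ampSol p := by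
  have := omegaP_pos hp
  unfold ampSol; positivity

lemma sSol_mul_bSol (hp : 1 < p) : sSol p * bSol p = √(omegaP p) := by
  have : p - 1 ≠ 0 := by linarith
  unfold sSol bSol; field_simp

/-- The decay rate of Ψ exceeds that of the soliton by `bSol p`; this margin makes the multiplier
term harmless at infinity. -/
lemma sPsi_mul_bSol (hp : 1 < p) : sPsi p * bSol p = √(omegaP p) + bSol p := by
  have : p - 1 ≠ 0 := by linarith
  unfold sPsi bSol; field_simp; ring

/-- The bifurcation condition that singles out ω_p: it places the ground state of the linearized
operator in x at energy -1, cancelled by the transverse energy of cos y. -/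
lemma sq_sPsi_mul_bSol (hp : 1 < p) : (sPsi p * bSol p) ^ 2 = omegaP p + 1 := by
  have h1 : p - 1 ≠ 0 := by linarith
  have h2 : p + 3 ≠ 0 := by linarith
  have h3 : sPsi p * bSol p = (p + 1) / 2 * √(omegaP p) := by
    unfold sPsi bSol; field_simp
  rw [h3, mul_pow, Real.sq_sqrt (omegaP_pos hp).le, omegaP]
  field_simp; ring

lemma soliton_eq (x : ℝ) :
    soliton p (omegaP p) x = ampSol p * sechPow (bSol p) (sSol p) x := by
  rw [soliton, ampSol, sechPow, sSol, bSol, one_div (Real.cosh _),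
    Real.inv_rpow (Real.cosh_pos _).le, Real.rpow_neg (Real.cosh_pos _).le]

lemma soliton_pos (hp : 1 < p) (x : ℝ) : 0 < soliton p (omegaP p) x := by
  rw [soliton_eq]; exact mul_pos (ampSol_pos hp) (sechPow_pos _ _ _)

lemma sechPow_rpow (b s r x : ℝ) : sechPow b s x ^ r = sechPow b (s * r) x := by
  rw [sechPow, sechPow, ← Real.rpow_mul (Real.cosh_pos _).le]; congr 1; ring

lemma sechPow_two (b x : ℝ) : sechPow b 2 x = 1 - th b x ^ 2 := by
  rw [one_sub_th_sq, sechPow, Real.rpow_neg (Real.cosh_pos _).le, one_div, inv_pow]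
  norm_cast

lemma soliton_rpow_half (hp : 1 < p) (x : ℝ) : soliton p (omegaP p) x ^ ((p + 1) / 2)
    = ampSol p ^ ((p + 1) / 2) * sechPow (bSol p) (sPsi p) x := by
  rw [soliton_eq, Real.mul_rpow (ampSol_pos hp).le (sechPow_pos _ _ _).le, sechPow_rpow]
  congr 2
  have : p - 1 ≠ 0 := by linarith
  unfold sSol sPsi; field_simp

/-- The linearized potential in terms of the Darboux potential. -/
lemma mul_soliton_rpow (hp : 1 < p) (x : ℝ) :
    p * soliton p (omegaP p) x ^ (p - 1) = omegaP p + 1 - pot (bSol p) (sPsi p) x := by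
  have h1 : p - 1 ≠ 0 := by linarith
  have h2 : p + 3 ≠ 0 := by linarith
  have hω := omegaP_pos hp
  have hA : ampSol p ^ (p - 1) = omegaP p * ((p + 1) / 2) := by
    rw [ampSol, Real.mul_rpow (by positivity) (by positivity), ← Real.rpow_mul hω.le,
      ← Real.rpow_mul (by positivity), one_div, inv_mul_cancel₀ h1, Real.rpow_one, Real.rpow_one]
  have hS : sechPow (bSol p) (sSol p) x ^ (p - 1) = 1 - th (bSol p) x ^ 2 := by
    rw [sechPow_rpow, ← sechPow_two]; congr 1; unfold sSol; field_simp
  rw [soliton_eq, Real.mul_rpow (ampSol_pos hp).le (sechPow_pos _ _ _).le, hA, hS, pot,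
    mul_pow, sq_sPsi_mul_bSol hp]
  have h3 : sPsi p * bSol p * bSol p = (p + 1) * (p - 1) / 4 * omegaP p := by
    have : √(omegaP p) * √(omegaP p) = omegaP p := Real.mul_self_sqrt hω.le
    unfold sPsi bSol
    field_simp
    rw [sq, this]; ring
  rw [h3]
  have h4 : omegaP p * ((p + 1) ^ 2 / 4) = omegaP p + 1 := by
    unfold omegaP; field_simp; ring
  linear_combination (-(1 - th (bSol p) x ^ 2)) * (-h4)

lemma integral_cos_sq_circ : ∫ y, Real.cos y ^ 2 ∂circ = Real.pi := by
  rw [← intervalIntegral.integral_of_le Real.two_pi_pos.le, integral_cos_sq]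
  simp

/-- The profile of `psiCos`. -/
lemma exists_psiCos_eq (hp : 1 < p) : ∃ κ : ℝ, 0 < κ ∧
    (∀ z, psiCos p z = κ * (sechPow (bSol p) (sPsi p) z.1 * Real.cos z.2)) ∧
    inner2 (psiCos p) (psiCos p) = 1 := by
  set f : ℝ × ℝ → ℝ := fun w => soliton p (omegaP p) w.1 ^ ((p + 1) / 2) * Real.cos w.2 with hf
  have hfe : ∀ z, f z = ampSol p ^ ((p + 1) / 2)
      * (sechPow (bSol p) (sPsi p) z.1 * Real.cos z.2) := by
    intro z; simp only [hf]; rw [soliton_rpow_half hp]; ring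
  have hA : 0 < ampSol p ^ ((p + 1) / 2) := Real.rpow_pos_of_pos (ampSol_pos hp) _
  have hg := memLp_two_sechPow (bSol_pos hp) (sPsi_pos hp)
  have hG : 0 < ∫ x, sechPow (bSol p) (sPsi p) x ^ 2 := by
    refine (integral_pos_iff_support_of_nonneg (fun x => sq_nonneg _) hg.integrable_sq).2 ?_
    have : Function.support (fun x => sechPow (bSol p) (sPsi p) x ^ 2) = Set.univ := by
      ext t
      have := sechPow_pos (bSol p) (sPsi p) t
      simp only [Function.mem_support, Set.mem_univ, iff_true]; positivity
    rw [this]; simp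
  have hff : 0 < inner2 f f := by
    have h1 : inner2 f f = (ampSol p ^ ((p + 1) / 2)) ^ 2
        * ((∫ x, sechPow (bSol p) (sPsi p) x ^ 2) * Real.pi) := by
      rw [inner2, cyl_eq_prod, ← integral_cos_sq_circ, ← integral_prod_mul, ← integral_const_mul]
      congr 1; ext z; rw [hfe]; ring
    rw [h1]
    have := Real.pi_pos
    positivity
  have hn : 0 < norm2 f := Real.sqrt_pos.2 hff
  refine ⟨ampSol p ^ ((p + 1) / 2) / norm2 f, by positivity, ?_, ?_⟩
  · intro z
    have : psiCos p z = f z / norm2 f := rfl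
    rw [this, hfe]; ring
  · have h1 : inner2 (psiCos p) (psiCos p) = inner2 f f / norm2 f ^ 2 := by
      rw [inner2, inner2, ← integral_div]
      congr 1; ext z
      have : psiCos p z = f z / norm2 f := rfl
      rw [this]; ring
    rw [h1, norm2, Real.sq_sqrt hff.le, div_self hff.ne']

lemma isReg_soliton (hp : 1 < p) : IsReg (fun z => soliton p (omegaP p) z.1) := by
  have h := (isReg_sechPow_mul_cos (bSol_pos hp) (sSol_pos hp) 0).const_mul (ampSol p)
  simpa [soliton_eq] using h

lemma isReg_psiCos (hp : 1 < p) : IsReg (psiCos p) := by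
  obtain ⟨κ, -, h, -⟩ := exists_psiCos_eq hp
  have h1 := (isReg_sechPow_mul_cos (bSol_pos hp) (sPsi_pos hp) 1).const_mul κ
  rw [show psiCos p = _ from funext h]
  simpa using h1

lemma isReg_phi (hp : 1 < p) {h : ℝ × ℝ → ℝ} (hh : MemH2 h) (a : ℝ) : IsReg (phi p a h) :=
  ((isReg_soliton hp).add ((isReg_psiCos hp).const_mul a)).add hh.isReg

end Soliton

/-! ### Modewise analysis: the Lagrange multiplier is O(a). -/

section Transverse

lemma integral_cos_int_mul {k : ℤ} (hk : k ≠ 0) : ∫ y, Real.cos (k * y) ∂circ = 0 := by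
  have hk' : (k : ℝ) ≠ 0 := by exact_mod_cast hk
  rw [← intervalIntegral.integral_of_le Real.two_pi_pos.le,
    intervalIntegral.integral_comp_mul_left _ hk']
  have : Real.sin (k * (2 * Real.pi)) = 0 := by
    have := (periodic_sin k) 0
    simpa using this
  simp [this]

lemma integral_cos_mul_cos {k : ℤ} (h1 : k ≠ 1) (h2 : k ≠ -1) :
    ∫ y, Real.cos y * Real.cos (k * y) ∂circ = 0 := by
  have e : ∀ y : ℝ, Real.cos y * Real.cos (k * y)
      = (Real.cos ((k + 1 : ℤ) * y) + Real.cos ((k - 1 : ℤ) * y)) * (1 / 2) := by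
    intro y
    push_cast
    rw [show ((k : ℝ) + 1) * y = k * y + y by ring, show ((k : ℝ) - 1) * y = k * y - y by ring,
      Real.cos_add, Real.cos_sub]
    ring
  have i : ∀ j : ℤ, Integrable (fun y : ℝ => Real.cos (j * y)) circ := fun j =>
    (memLp_cos j).integrable (by norm_num)
  simp_rw [e]
  rw [integral_mul_const, integral_add (i _) (i _), integral_cos_int_mul (by omega),
    integral_cos_int_mul (by omega)]
  simp

lemma mode_neg (u : ℝ × ℝ → ℝ) (k : ℤ) : mode u (-k) = mode u k := by
  funext x
  simp [mode]

lemma integral_sq_mode_le {u : ℝ × ℝ → ℝ} (hu : MemLp u 2 cyl) (k : ℤ) :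
    ∫ x, mode u k x ^ 2 ≤ 2 * Real.pi * ∫ z, u z ^ 2 ∂cyl := by
  rw [integral_sq_cyl hu, ← integral_const_mul]
  refine integral_mono_ae (memLp_mode hu k).integrable_sq ((integrable_slice_sq hu).const_mul _) ?_
  filter_upwards [ae_memLp_slice hu] with x hx
  refine (sq_integral_mul_le hx (memLp_cos k)).trans ?_
  rw [mul_comm]
  exact mul_le_mul_of_nonneg_right (integral_cos_sq_le k) (integral_nonneg fun y => sq_nonneg _)

/-- The mean over a period. -/
def meanY (u : ℝ × ℝ → ℝ) (x : ℝ) : ℝ := mode u 0 x / (2 * Real.pi)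

lemma memLp_fst {ξ : ℝ → ℝ} (hξ : MemLp ξ 2) : MemLp (fun z : ℝ × ℝ => ξ z.1) 2 cyl := by
  simpa using memLp_prod_mul hξ (memLp_cos 0)

lemma memLp_meanY {u : ℝ × ℝ → ℝ} (hu : MemLp u 2 cyl) : MemLp (meanY u) 2 := by
  have := (memLp_mode hu 0).mul_const (2 * Real.pi)⁻¹
  exact this

lemma mode_sub_meanY {u : ℝ × ℝ → ℝ} (hu : MemLp u 2 cyl) (k : ℤ) :
    ∀ᵐ x, mode (fun z => u z - meanY u z.1) k x = if k = 0 then 0 else mode u k x := by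
  filter_upwards [ae_memLp_slice hu] with x hx
  have i1 : Integrable (fun y => u (x, y) * Real.cos (k * y)) circ :=
    integrable_mul_L2 hx (memLp_cos k)
  have i2 : Integrable (fun y => meanY u x * Real.cos (k * y)) circ :=
    ((memLp_cos k).integrable (by norm_num)).const_mul _
  have e : mode (fun z => u z - meanY u z.1) k x
      = mode u k x - meanY u x * ∫ y, Real.cos (k * y) ∂circ := by
    rw [mode, mode, ← integral_const_mul, ← integral_sub i1 i2]
    congr 1; ext y; ring
  rw [e]
  split_ifs with hk
  · subst hk
    have hp := Real.two_pi_pos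
    have : ∫ y : ℝ, Real.cos ((0 : ℤ) * y) ∂circ = 2 * Real.pi := by simp [Real.pi_pos.le]
    rw [this, meanY, div_mul_cancel₀ _ hp.ne', sub_self]
  · rw [integral_cos_int_mul hk]; ring

variable {p : ℝ}

lemma inner2_soliton_psiCos (hp : 1 < p) :
    inner2 (fun z => soliton p (omegaP p) z.1) (psiCos p) = 0 := by
  obtain ⟨κ, -, h, -⟩ := exists_psiCos_eq hp
  have e : ∀ z : ℝ × ℝ, soliton p (omegaP p) z.1 * psiCos p z
      = (soliton p (omegaP p) z.1 * (κ * sechPow (bSol p) (sPsi p) z.1)) * Real.cos z.2 := by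
    intro z; rw [h]; ring
  have hc : ∫ y, Real.cos y ∂circ = 0 := by
    simpa using integral_cos_int_mul (k := 1) one_ne_zero
  rw [inner2, cyl_eq_prod]
  simp_rw [e]
  rw [integral_prod_mul (fun x => soliton p (omegaP p) x * (κ * sechPow (bSol p) (sPsi p) x))
    Real.cos, hc, mul_zero]

/-- The parameter `a` is the coordinate along Ψ, the only direction in which the resonant mode is
not controlled by its equation. -/
lemma inner2_phi_psiCos (hp : 1 < p) {h : ℝ × ℝ → ℝ} (hh : MemX2 p h) (a : ℝ) :
    inner2 (phi p a h) (psiCos p) = a := by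
  have hΨ := (isReg_psiCos hp).memL2.2
  have i1 := integrable_mul_L2 (isReg_soliton hp).memL2.2 hΨ
  have i2 := integrable_mul_L2 (hΨ.const_mul a) hΨ
  have i3 := integrable_mul_L2 hh.1.isReg.memL2.2 hΨ
  obtain ⟨κ, -, -, hn⟩ := exists_psiCos_eq hp
  have e : inner2 (phi p a h) (psiCos p) = inner2 (fun z => soliton p (omegaP p) z.1) (psiCos p)
      + (∫ z, a * psiCos p z * psiCos p z ∂cyl) + inner2 h (psiCos p) := by
    have s1 := integral_add i1 i2
    have s2 := integral_add (i1.add i2) i3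
    simp only [Pi.add_apply] at s1 s2
    rw [inner2, inner2, inner2, ← s1, ← s2]
    congr 1; ext z; simp only [phi]; ring
  rw [e, inner2_soliton_psiCos hp, hh.2.2]
  simp_rw [mul_assoc]
  rw [integral_const_mul]
  rw [inner2] at hn
  rw [hn]; ring

lemma phi_even (hp : 1 < p) {h : ℝ × ℝ → ℝ} (hh : MemX2 p h) (a : ℝ) :
    ∀ᵐ x : ℝ, ∀ᵐ y ∂circ, phi p a h (x, -y) = phi p a h (x, y) := by
  obtain ⟨κ, -, hΨ, -⟩ := exists_psiCos_eq hp
  filter_upwards [ae_slice hh.2.1] with x hx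
  filter_upwards [hx] with y hy
  have : h (x, -y) = h (x, y) := hy.2
  simp only [phi, hΨ, Real.cos_neg, this]

lemma continuous_power (hp : 1 < p) : Continuous fun t : ℝ => |t| ^ (p - 1) * t :=
  (continuous_abs.rpow_const fun _ => Or.inr (by linarith)).mul continuous_id

lemma continuous_pot (b s : ℝ) : Continuous (pot b s) := by
  have := continuous_th b
  unfold pot; fun_prop

/-- The equation satisfied by the modes of `φ`. -/
lemma mode_equation (hp : 1 < p) {c : ℝ} {φ E : ℝ × ℝ → ℝ} (hφ : IsReg φ) (hE : MemLp E 2 cyl)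
    {F : ℝ → ℝ} (heq : ∀ᵐ z ∂cyl, E z = -dx (dx φ) z - dy (dy φ) z
      + (pot (bSol p) (sPsi p) z.1 - 1) * φ z - c * psiCos p z + F z.1) {k : ℤ} (hk : k ≠ 0) :
    ∀ᵐ x, -mode (dx (dx φ)) k x + (((k : ℝ) ^ 2 - 1) + pot (bSol p) (sPsi p) x) * mode φ k x
      = mode E k x + c * mode (psiCos p) k x := by
  have hxx : MemLp (dx (dx φ)) 2 cyl := hφ.xx.memL2.2
  have hyy : MemLp (dy (dy φ)) 2 cyl := hφ.yy.memL2.2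
  have hΨ := (isReg_psiCos hp).memL2.2
  filter_upwards [ae_memLp_slice hφ.memL2.2, ae_memLp_slice hxx, ae_memLp_slice hyy,
    ae_memLp_slice hΨ, ae_memLp_slice hE, ae_slice heq,
    mode_second_deriv_ae hφ.memL2.2 hyy hφ.y.hasWeakDeriv hφ.yy.hasWeakDeriv k]
    with x h1 h2 h3 h4 h5 h6 h7
  have hc := memLp_cos k
  have i1 := integrable_mul_L2 h1 hc
  have i2 := integrable_mul_L2 h2 hc
  have i3 := integrable_mul_L2 h3 hc
  have i4 := integrable_mul_L2 h4 hc
  have i6 : Integrable (fun y => F x * Real.cos (k * y)) circ :=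
    (hc.integrable (by norm_num)).const_mul _
  have e : mode E k x = -mode (dx (dx φ)) k x - mode (dy (dy φ)) k x
      + (pot (bSol p) (sPsi p) x - 1) * mode φ k x - c * mode (psiCos p) k x
      + F x * ∫ y, Real.cos (k * y) ∂circ := by
    have s1 := integral_sub i2.neg i3
    have s2 := integral_add (i2.neg.sub i3) (i1.const_mul (pot (bSol p) (sPsi p) x - 1))
    have s3 := integral_sub ((i2.neg.sub i3).add (i1.const_mul (pot (bSol p) (sPsi p) x - 1)))
      (i4.const_mul c)
    have s4 := integral_add (((i2.neg.sub i3).add (i1.const_mul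
      (pot (bSol p) (sPsi p) x - 1))).sub (i4.const_mul c)) i6
    simp only [Pi.add_apply, Pi.sub_apply, Pi.neg_apply] at s1 s2 s3 s4
    simp only [mode]
    rw [← integral_const_mul, ← integral_const_mul, ← integral_const_mul, ← integral_neg,
      ← s1, ← s2, ← s3, ← s4]
    refine integral_congr_ae ?_
    filter_upwards [h6] with y hy
    rw [hy]; ring
  rw [e, h7, integral_cos_int_mul hk]; ring

/-- The Lagrange multiplier is controlled by `a`. -/
lemma exists_abs_multiplier_le (hp : 1 < p) : ∃ s₀ C : ℝ, 0 < s₀ ∧ 0 < C ∧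
    ∀ (ω a c : ℝ) (h : ℝ × ℝ → ℝ), MemX2 p h →
    (∀ᵐ z ∂cyl, nlF p ω (phi p a h) z = c * psiCos p z) →
    (∀ᵐ z ∂cyl, |(|phi p a h z| ^ (p - 1) * phi p a h z
        - |meanY (phi p a h) z.1| ^ (p - 1) * meanY (phi p a h) z.1)
        - (p * soliton p (omegaP p) z.1 ^ (p - 1) + (ω - omegaP p))
          * (phi p a h z - meanY (phi p a h) z.1)|
        ≤ s₀ * |phi p a h z - meanY (phi p a h) z.1|) →
    |c| ≤ C * |a| := by
  obtain ⟨K, hK, hres⟩ := exists_resonant_mode_bound (bSol_pos hp) (sPsi_pos hp)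
  obtain ⟨κ, hκ, hΨe, -⟩ := exists_psiCos_eq hp
  -- The first constant allows absorption of the error. The second comes from (cκπ)² ≤ 8πK²(a/κ)² at
  -- the end, with 8/π < 9.
  refine ⟨1 / (2 * (K + 1)), 3 * K / κ ^ 2, by positivity, by positivity, ?_⟩
  intro ω a c h hh heq hosc
  set φ := phi p a h with hφdef
  have hφ : IsReg φ := isReg_phi hp hh.1 a
  have hφL := hφ.memL2.2
  set d : ℝ × ℝ → ℝ := fun z => φ z - meanY φ z.1 with hd
  set E : ℝ × ℝ → ℝ := fun z => (|φ z| ^ (p - 1) * φ z - |meanY φ z.1| ^ (p - 1) * meanY φ z.1)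
        - (p * soliton p (omegaP p) z.1 ^ (p - 1) + (ω - omegaP p)) * (φ z - meanY φ z.1) with hEdef
  set s₀ := 1 / (2 * (K + 1)) with hs₀
  have hs₀pos : 0 < s₀ := by positivity
  have hs₀1 : s₀ ≤ 1 := by rw [hs₀, div_le_one (by positivity)]; linarith
  have hmL := memLp_fst (memLp_meanY hφL)
  have hdL : MemLp d 2 cyl := hφL.sub hmL
  have hEL : MemLp E 2 cyl := by
    refine MemLp.of_le_mul (c := s₀) hdL ?_ hosc
    have hc := continuous_power hp
    have hR : Continuous fun z : ℝ × ℝ => p * soliton p (omegaP p) z.1 ^ (p - 1)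
        + (ω - omegaP p) := by
      simp_rw [mul_soliton_rpow hp]
      have := continuous_pot (bSol p) (sPsi p)
      fun_prop
    exact ((hc.comp_aestronglyMeasurable hφL.aestronglyMeasurable).sub
      (hc.comp_aestronglyMeasurable hmL.aestronglyMeasurable)).sub
      (hR.aestronglyMeasurable.mul hdL.aestronglyMeasurable)
  have hE2 : ∫ z, E z ^ 2 ∂cyl ≤ s₀ ^ 2 * ∫ z, d z ^ 2 ∂cyl := by
    rw [← integral_const_mul]
    refine integral_mono_ae hEL.integrable_sq (hdL.integrable_sq.const_mul _) ?_
    filter_upwards [hosc] with z hz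
    have : |E z| ^ 2 ≤ (s₀ * |d z|) ^ 2 := pow_le_pow_left₀ (abs_nonneg _) hz 2
    rwa [mul_pow, sq_abs, sq_abs] at this
  -- All terms in the mean depend on x alone and are invisible to modes k ≠ 0. The equation for the
  -- mean is never needed, and the shift ω - ω_p has been absorbed in `E`.
  have hEeq : ∀ᵐ z ∂cyl, E z = -dx (dx φ) z - dy (dy φ) z
      + (pot (bSol p) (sPsi p) z.1 - 1) * φ z - c * psiCos p z
      + (-(|meanY φ z.1| ^ (p - 1) * meanY φ z.1)
        + (ω + 1 - pot (bSol p) (sPsi p) z.1) * meanY φ z.1) := by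
    filter_upwards [heq] with z hz
    rw [nlF] at hz
    simp only [hEdef]
    rw [mul_soliton_rpow hp]
    linear_combination (-1 : ℝ) * hz
  have hmode := fun k hk => mode_equation (k := k) hp hφ hEL
    (F := fun x => -(|meanY φ x| ^ (p - 1) * meanY φ x)
        + (ω + 1 - pot (bSol p) (sPsi p) x) * meanY φ x) hEeq hk
  have hΨmode : ∀ (k : ℤ) x, mode (psiCos p) k x
      = κ * sechPow (bSol p) (sPsi p) x * ∫ y, Real.cos y * Real.cos (k * y) ∂circ := by
    intro k x
    rw [mode, ← integral_const_mul]
    congr 1; ext y; rw [hΨe]; ring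
  have hmL1 := fun k : ℤ => memLp_mode hφL k
  have hmL2 : ∀ k : ℤ, MemLp (mode (dx φ) k) 2 := fun k => memLp_mode hφ.x.memL2.2 k
  have hmL3 : ∀ k : ℤ, MemLp (mode (dx (dx φ)) k) 2 := fun k => memLp_mode hφ.xx.memL2.2 k
  have hw1 := fun k : ℤ => isWD_mode hφL hφ.x.memL2.2 hφ.x.hasWeakDeriv k
  have hw2 := fun k : ℤ => isWD_mode hφ.x.memL2.2 hφ.xx.memL2.2 hφ.xx.hasWeakDeriv k
  have hdm : ∀ k : ℤ, k ≠ 0 → ∫ x, mode d k x ^ 2 = ∫ x, mode φ k x ^ 2 := by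
    intro k hk
    refine integral_congr_ae ?_
    filter_upwards [mode_sub_meanY hφL k] with x hx
    rw [if_neg hk] at hx
    simp only [hd]
    rw [hx]
  have hra : ∫ x, mode φ 1 x * sechPow (bSol p) (sPsi p) x = a / κ := by
    rw [integral_mode_mul hφL (memLp_two_sechPow (bSol_pos hp) (sPsi_pos hp)),
      ← inner2_phi_psiCos hp hh a, inner2, ← integral_div]
    congr 1; ext z
    rw [hΨe]
    simp only [Int.cast_one, one_mul]
    rw [← hφdef]
    field_simp
  obtain ⟨hγ, hf1⟩ := hres (c * κ * Real.pi) _ _ _ _ (hmL1 1) (hmL2 1) (hmL3 1) (memLp_mode hEL 1)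
    (hw1 1) (hw2 1) (by
      filter_upwards [hmode 1 one_ne_zero] with x hx
      have hcc : ∫ y, Real.cos y * Real.cos ((1 : ℤ) * y) ∂circ = Real.pi := by
        rw [← integral_cos_sq_circ]; congr 1; ext y; simp [sq]
      rw [hΨmode, hcc] at hx
      push_cast at hx
      linear_combination hx)
  rw [hra] at hf1
  -- Mode 0 of `d` vanishes, modes ±1 cost `K` and the term in `a`, higher modes cost 1; sine
  -- coefficients vanish by evenness in y.
  have hsum := integral_sq_le_of_modes (K := K + 1) (J := K * (a / κ) ^ 2) hdL hEL (by
      have hev := phi_even hp hh a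
      rw [← hφdef] at hev
      filter_upwards [hev] with x hx k
      refine integral_mul_sin_eq_zero (q := fun y => d (x, y)) (fun y => ?_) ?_ k
      · simp only [hd]
        rw [hφ.memL2.1 x y]
      · filter_upwards [hx] with y hy
        simp only [hd]
        rw [hy])
    (by positivity) (by positivity) (by
      intro k
      have hEk : 0 ≤ ∫ x, mode E k x ^ 2 := integral_nonneg fun x => sq_nonneg _
      by_cases hk0 : k = 0
      · have : ∫ x, mode d k x ^ 2 = 0 := by
          rw [← integral_zero ℝ ℝ (μ := volume)]
          refine integral_congr_ae ?_
          filter_upwards [mode_sub_meanY hφL k] with x hx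
          rw [if_pos hk0] at hx
          simp only [hd]
          rw [hx]; simp
        rw [this]
        have : (0 : ℝ) ≤ if k ∈ ({1, -1} : Finset ℤ) then K * (a / κ) ^ 2 else 0 := by
          split_ifs <;> positivity
        positivity
      rw [hdm k hk0]
      by_cases hk1 : k ∈ ({1, -1} : Finset ℤ)
      · rw [if_pos hk1]
        have hk : ∀ u : ℝ × ℝ → ℝ, mode u k = mode u 1 := by
          intro u
          simp only [Finset.mem_insert, Finset.mem_singleton] at hk1
          rcases hk1 with rfl | rfl
          · rfl
          · exact mode_neg u 1
        rw [hk] at hEk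
        rw [hk, hk]
        linarith
      · rw [if_neg hk1]
        simp only [Finset.mem_insert, Finset.mem_singleton, not_or] at hk1
        have hk2 : (3 : ℝ) ≤ (k : ℝ) ^ 2 - 1 := by
          have : 2 ≤ |k| := by
            rcases le_total 0 k with h0 | h0
            · rw [abs_of_nonneg h0]; omega
            · rw [abs_of_nonpos h0]; omega
          have h4 : (4 : ℤ) ≤ k ^ 2 := by rw [← sq_abs]; nlinarith
          have : (4 : ℝ) ≤ (k : ℝ) ^ 2 := by exact_mod_cast h4
          linarith
        have := sq_le_of_high_mode hk2 (hmL1 k) (hmL2 k) (hmL3 k) (memLp_mode hEL k) (hw1 k)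
          (hw2 k) (b := bSol p) (s := sPsi p) (by
            filter_upwards [hmode k hk0] with x hx
            rw [hx, hΨmode, integral_cos_mul_cos hk1.1 hk1.2]; ring)
        nlinarith)
  set D := ∫ z, d z ^ 2 ∂cyl with hD
  have hD0 : 0 ≤ D := integral_nonneg fun z => sq_nonneg _
  -- Hence (K + 1)‖E‖² ≤ ‖d‖²/4 is absorbed by the left-hand side, leaving ‖d‖ bounded by |a|.
  have hs2 : (K + 1) * s₀ ^ 2 ≤ 1 / 4 := by
    rw [hs₀, div_pow, one_pow, mul_pow, mul_one_div, div_le_div_iff₀ (by positivity) (by norm_num)]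
    nlinarith
  have hDle : D ≤ 4 * (K * (a / κ) ^ 2) := by
    have h1 : (K + 1) * ∫ z, E z ^ 2 ∂cyl ≤ (K + 1) * (s₀ ^ 2 * D) :=
      mul_le_mul_of_nonneg_left hE2 (by positivity)
    have h2 : 0 ≤ K * (a / κ) ^ 2 := by positivity
    nlinarith [mul_le_mul_of_nonneg_right hs2 hD0]
  have hEle : ∫ z, E z ^ 2 ∂cyl ≤ 4 * (K * (a / κ) ^ 2) := by
    refine hE2.trans (le_trans ?_ hDle)
    exact mul_le_of_le_one_left hD0 (pow_le_one₀ hs₀pos.le hs₀1)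
  have hpi := Real.pi_pos
  have h1 : (c * κ * Real.pi) ^ 2 ≤ K * (2 * Real.pi * (4 * (K * (a / κ) ^ 2))) :=
    hγ.trans (mul_le_mul_of_nonneg_left ((integral_sq_mode_le hEL 1).trans
      (mul_le_mul_of_nonneg_left hEle (by positivity))) hK.le)
  have h2 : c ^ 2 ≤ (3 * K / κ ^ 2 * a) ^ 2 := by
    have e1 : (3 * K / κ ^ 2 * a) ^ 2 = 9 * (K * (K * (a / κ) ^ 2)) / κ ^ 2 := by
      field_simp; ring
    rw [e1, le_div_iff₀ (by positivity)]
    have h3 : 0 ≤ K * (K * (a / κ) ^ 2) := by positivity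
    have h4 : (c ^ 2 * κ ^ 2) * Real.pi ≤ 8 * (K * (K * (a / κ) ^ 2)) := by
      by_contra! hlt
      nlinarith [mul_lt_mul_of_pos_right hlt hpi]
    have h5 : 0 ≤ c ^ 2 * κ ^ 2 := by positivity
    nlinarith [Real.pi_gt_three]
  have h3 := sq_le_sq.1 h2
  rwa [abs_mul, abs_of_nonneg (show (0 : ℝ) ≤ 3 * K / κ ^ 2 by positivity)] at h3

end Transverse

/-! ### Linearizing the nonlinearity; smallness of the multiplier term. -/

section Multiplier

variable {p : ℝ}

lemma hasDerivAt_power (hp : 1 < p) (t : ℝ) :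
    HasDerivAt (fun t : ℝ => |t| ^ (p - 1) * t) (p * |t| ^ (p - 1)) t := by
  have pos : ∀ t : ℝ, 0 < t →
      HasDerivAt (fun t : ℝ => |t| ^ (p - 1) * t) (p * |t| ^ (p - 1)) t := by
    intro t ht
    rw [abs_of_pos ht]
    refine (Real.hasDerivAt_rpow_const (p := p) (Or.inl ht.ne')).congr_of_eventuallyEq ?_
    filter_upwards [eventually_gt_nhds ht] with u hu
    rw [abs_of_pos hu]
    nth_rewrite 2 [← Real.rpow_one u]
    rw [← Real.rpow_add hu]; congr 1; ring
  rcases lt_trichotomy t 0 with ht | rfl | ht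
  · have h1 := (pos (-t) (by linarith)).comp t (hasDerivAt_neg t)
    have h2 := h1.neg
    rw [abs_neg] at h2
    refine (h2.congr_deriv (by ring)).congr_of_eventuallyEq (Eventually.of_forall fun u => ?_)
    simp
  · rw [abs_zero, Real.zero_rpow (by linarith), mul_zero, hasDerivAt_iff_tendsto_slope]
    have hc : Continuous fun t : ℝ => |t| ^ (p - 1) :=
      continuous_abs.rpow_const fun _ => Or.inr (by linarith)
    have h0 : Tendsto (fun t : ℝ => |t| ^ (p - 1)) (𝓝[≠] 0) (𝓝 0) := by
      have := hc.tendsto 0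
      rw [abs_zero, Real.zero_rpow (by linarith)] at this
      exact this.mono_left nhdsWithin_le_nhds
    refine h0.congr' ?_
    filter_upwards [self_mem_nhdsWithin] with u hu
    have hu' : u ≠ 0 := hu
    rw [slope_def_field]
    field_simp
    simp
  · exact pos t ht

/-- Uniform linearization of the nonlinearity on bounded sets. -/
lemma exists_power_linearization (hp : 1 < p) (L : ℝ) {s : ℝ} (hs : 0 < s) :
    ∃ τ : ℝ, 0 < τ ∧ ∀ R u v : ℝ, 0 ≤ R → R ≤ L → |u - R| ≤ τ → |v - R| ≤ τ →
      |(|u| ^ (p - 1) * u - |v| ^ (p - 1) * v) - p * R ^ (p - 1) * (u - v)| ≤ s * |u - v| := by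
  have hc : Continuous fun t : ℝ => p * |t| ^ (p - 1) :=
    continuous_const.mul (continuous_abs.rpow_const fun _ => Or.inr (by linarith))
  -- Only uniform continuity of the derivative p|t|^(p-1) enters, so p < 2 needs no special
  -- treatment. Points within distance 1 of R ∈ [0, L] stay in this interval.
  have huc := (isCompact_Icc (a := -1) (b := L + 1)).uniformContinuousOn_of_continuous
    hc.continuousOn
  rw [Metric.uniformContinuousOn_iff_le] at huc
  obtain ⟨δ, hδ, hδs⟩ := huc s hs
  refine ⟨min δ 1, lt_min hδ one_pos, fun R u v hR hRL hu hv => ?_⟩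
  have hder : ∀ t ∈ Set.Icc (R - min δ 1) (R + min δ 1),
      HasDerivWithinAt (fun t : ℝ => |t| ^ (p - 1) * t - p * R ^ (p - 1) * t)
        (p * |t| ^ (p - 1) - p * R ^ (p - 1) * 1) (Set.Icc (R - min δ 1) (R + min δ 1)) t :=
    fun t _ => ((hasDerivAt_power hp t).sub ((hasDerivAt_id t).const_mul _)).hasDerivWithinAt
  have hbd : ∀ t ∈ Set.Icc (R - min δ 1) (R + min δ 1),
      ‖p * |t| ^ (p - 1) - p * R ^ (p - 1) * 1‖ ≤ s := by
    intro t ht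
    have h1 := min_le_right δ 1
    have h2 := min_le_left δ 1
    have h3 := hδs t ⟨by linarith [ht.1], by linarith [ht.2]⟩ R ⟨by linarith, by linarith⟩ (by
      rw [Real.dist_eq, abs_le]; constructor <;> linarith [ht.1, ht.2])
    rw [Real.dist_eq, abs_of_nonneg hR] at h3
    rwa [mul_one, Real.norm_eq_abs]
  have hmem : ∀ t : ℝ, |t - R| ≤ min δ 1 → t ∈ Set.Icc (R - min δ 1) (R + min δ 1) := by
    intro t ht
    rw [abs_le] at ht
    constructor <;> linarith [ht.1, ht.2]
  have := (convex_Icc _ _).norm_image_sub_le_of_norm_hasDerivWithin_le hder hbd (hmem v hv)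
    (hmem u hu)
  rw [Real.norm_eq_abs, Real.norm_eq_abs] at this
  refine le_trans (le_of_eq ?_) this
  congr 1; ring

lemma abs_meanY_sub_le {u : ℝ × ℝ → ℝ} (hu : MemLp u 2 cyl) {R : ℝ → ℝ} {τ : ℝ}
    (h : ∀ᵐ z ∂cyl, |u z - R z.1| ≤ τ) : ∀ᵐ x, |meanY u x - R x| ≤ τ := by
  have hp := Real.two_pi_pos
  filter_upwards [ae_slice h, ae_memLp_slice hu] with x hx hux
  have h1 := norm_integral_le_of_norm_le_const (μ := circ) (f := fun y => u (x, y) - R x) hx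
  rw [integral_sub (hux.integrable (by norm_num)) (integrable_const _)] at h1
  have hr : circ.real Set.univ = 2 * Real.pi := by simp [Real.pi_pos.le]
  rw [integral_const, hr, Real.norm_eq_abs, smul_eq_mul] at h1
  have e : meanY u x - R x = ((∫ y, u (x, y) ∂circ) - 2 * Real.pi * R x) / (2 * Real.pi) := by
    rw [meanY, mode, sub_div, mul_div_cancel_left₀ _ hp.ne']
    simp
  rw [e, abs_div, abs_of_pos hp, div_le_iff₀ hp]
  exact h1

lemma ae_cyl_fst {P : ℝ → Prop} (h : ∀ᵐ x, P x) : ∀ᵐ z ∂cyl, P z.1 := by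
  rw [cyl_eq_prod]
  exact Measure.quasiMeasurePreserving_fst.ae h

lemma soliton_le (hp : 1 < p) (x : ℝ) : soliton p (omegaP p) x ≤ ampSol p := by
  rw [soliton_eq]
  exact mul_le_of_le_one_right (ampSol_pos hp).le (sechPow_le_one (sSol_pos hp).le x)

/-- Solutions of the auxiliary equation are close to the soliton, and solve the equation up to
a small multiple of `psiCos`. -/
lemma exists_auxSol_estimates (hp : 1 < p) {τ : ℝ} (hτ : 0 < τ) :
    ∃ r δ a₀ C : ℝ, 0 < r ∧ 0 < δ ∧ 0 < a₀ ∧ 0 < C ∧ ∀ (ω a : ℝ) (h : ℝ × ℝ → ℝ),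
      |ω - omegaP p| < δ → |a| < a₀ → IsAuxSol p r ω a h →
      (∀ᵐ z ∂cyl, |phi p a h z - soliton p (omegaP p) z.1| ≤ τ) ∧
      ∀ᵐ z ∂cyl, |ω * phi p a h z - dx (dx (phi p a h)) z - dy (dy (phi p a h)) z
        - |phi p a h z| ^ (p - 1) * phi p a h z|
        ≤ C * |a| * Real.exp (-(√(omegaP p) + bSol p) * |z.1|) := by
  obtain ⟨s₀, C, hs₀, hC, hmult⟩ := exists_abs_multiplier_le hp
  obtain ⟨τ₁, hτ₁, hlin⟩ := exists_power_linearization hp (ampSol p) (half_pos hs₀)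
  obtain ⟨κ, hκ, hΨe, -⟩ := exists_psiCos_eq hp
  set t := min τ τ₁ with ht
  have htpos : 0 < t := lt_min hτ hτ₁
  have hΨ : ∀ z, |psiCos p z| ≤ κ * sechPow (bSol p) (sPsi p) z.1 := by
    intro z
    have hpos := sechPow_pos (bSol p) (sPsi p) z.1
    rw [hΨe, abs_mul, abs_mul, abs_of_pos hκ, abs_of_pos hpos]
    exact mul_le_mul_of_nonneg_left
      (mul_le_of_le_one_right hpos.le (Real.abs_cos_le_one _)) hκ.le
  -- The Sobolev constant 8 turns t/16 into t/2, and |aΨ| ≤ |a|κ gives the other t/2. The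
  -- linearization error and |ω - ω_p| contribute s₀/2 each.
  refine ⟨t / 16, s₀ / 2, t / (2 * κ), C * (κ * 2 ^ sPsi p), by positivity, by positivity,
    by positivity, by positivity, ?_⟩
  intro ω a h hω ha hsol
  obtain ⟨hX, hnorm, hproj⟩ := hsol
  have hφ := isReg_phi hp hX.1 a
  have hclose : ∀ᵐ z ∂cyl, |phi p a h z - soliton p (omegaP p) z.1| ≤ t := by
    filter_upwards [ae_cyl_of_ae_volume hX.1.ae_abs_le] with z hz
    have e : phi p a h z - soliton p (omegaP p) z.1 = a * psiCos p z + h z := by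
      simp only [phi]; ring
    rw [e]
    refine (abs_add_le _ _).trans ?_
    have h1 : |psiCos p z| ≤ κ := (hΨ z).trans
      (mul_le_of_le_one_right hκ.le (sechPow_le_one (sPsi_pos hp).le _))
    have h2 : |a * psiCos p z| ≤ t / 2 := by
      rw [abs_mul]
      calc |a| * |psiCos p z| ≤ t / (2 * κ) * κ :=
            mul_le_mul ha.le h1 (abs_nonneg _) (by positivity)
        _ = t / 2 := by field_simp
    linarith
  refine ⟨hclose.mono fun z hz => hz.trans (min_le_left _ _), ?_⟩
  set c := inner2 (nlF p ω (phi p a h)) (psiCos p) with hc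
  have heq : ∀ᵐ z ∂cyl, nlF p ω (phi p a h) z = c * psiCos p z := by
    filter_upwards [hproj] with z hz
    simp only [projPerp, Pi.zero_apply] at hz
    linarith
  have hca : |c| ≤ C * |a| := by
    refine hmult ω a c h hX heq ?_
    filter_upwards [hclose, ae_cyl_fst (abs_meanY_sub_le hφ.memL2.2 hclose)] with z h1 h2
    have h3 := hlin _ _ _ (soliton_pos hp z.1).le (soliton_le hp z.1) (h1.trans (min_le_right _ _))
      (h2.trans (min_le_right _ _))
    set u := phi p a h z
    set v := meanY (phi p a h) z.1
    have e : (|u| ^ (p - 1) * u - |v| ^ (p - 1) * v)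
        - (p * soliton p (omegaP p) z.1 ^ (p - 1) + (ω - omegaP p)) * (u - v)
        = ((|u| ^ (p - 1) * u - |v| ^ (p - 1) * v)
          - p * soliton p (omegaP p) z.1 ^ (p - 1) * (u - v)) - (ω - omegaP p) * (u - v) := by ring
    rw [e]
    refine (abs_sub _ _).trans ?_
    rw [abs_mul (ω - omegaP p)]
    nlinarith [mul_le_mul_of_nonneg_right hω.le (abs_nonneg (u - v))]
  filter_upwards [heq] with z hz
  have e : ω * phi p a h z - dx (dx (phi p a h)) z - dy (dy (phi p a h)) z
        - |phi p a h z| ^ (p - 1) * phi p a h z = c * psiCos p z := by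
    rw [← hz, nlF]; ring
  rw [e, abs_mul]
  have h1 := sechPow_le_exp (bSol_pos hp).le (sPsi_pos hp).le z.1
  rw [sPsi_mul_bSol hp] at h1
  calc |c| * |psiCos p z| ≤ (C * |a|)
        * (κ * (2 ^ sPsi p * Real.exp (-(√(omegaP p) + bSol p) * |z.1|))) :=
        mul_le_mul hca ((hΨ z).trans (mul_le_mul_of_nonneg_left h1 hκ.le)) (abs_nonneg _)
          (by positivity)
    _ = _ := by ring

end Multiplier

/-! ### Exponential decay when the potential is small at infinity. -/

section Decay

lemma exists_mul_exp_le {K α t : ℝ} (hα : 0 < α) (ht : 0 < t) :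
    ∃ M : ℝ, 0 ≤ M ∧ ∀ x : ℝ, M ≤ |x| → K * Real.exp (-α * |x|) ≤ t := by
  have h : Tendsto (fun y : ℝ => K * Real.exp (-(α * y))) atTop (𝓝 (K * 0)) :=
    ((Real.tendsto_exp_neg_atTop_nhds_zero.comp (tendsto_id.const_mul_atTop hα)).const_mul K)
  rw [mul_zero] at h
  obtain ⟨M, hM⟩ := (h.eventually_le_const ht).exists_forall_of_atTop
  refine ⟨max M 0, le_max_right _ _, fun x hx => ?_⟩
  have := hM |x| ((le_max_left _ _).trans hx)
  rwa [← neg_mul] at this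

lemma exists_rpow_le {p K α η : ℝ} (hp : 1 < p) (hα : 0 < α) (hη : 0 < η) :
    ∃ M : ℝ, 0 ≤ M ∧ ∀ x t : ℝ, M ≤ |x| → |t| ≤ K * Real.exp (-α * |x|) → |t| ^ (p - 1) ≤ η := by
  have hp' : 0 < p - 1 := by linarith
  obtain ⟨M, hM0, hM⟩ := exists_mul_exp_le (K := K) hα (Real.rpow_pos_of_pos hη (1 / (p - 1)))
  refine ⟨M, hM0, fun x t hx ht => ?_⟩
  calc |t| ^ (p - 1) ≤ (η ^ (1 / (p - 1))) ^ (p - 1) :=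
        Real.rpow_le_rpow (abs_nonneg _) (ht.trans (hM x hx)) hp'.le
    _ = η := by rw [← Real.rpow_mul hη.le, one_div, inv_mul_cancel₀ hp'.ne', Real.rpow_one]

/-- The threshold `M` is uniform over rates `t` in [l, Λ], because the rate √ω + ε varies with ω
while constants must not. -/
lemma exists_sech_sq_le {l Λ g : ℝ} (hl : 0 < l) (hg : 0 < g) :
    ∃ M : ℝ, 0 ≤ M ∧ ∀ x t : ℝ, M ≤ |x| → l ≤ t → t ≤ Λ → 2 * t ^ 2 * (1 - th t x ^ 2) ≤ g := by
  obtain ⟨M, hM0, hM⟩ := exists_mul_exp_le (K := 8 * Λ ^ 2)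
    (by positivity : 0 < 2 * l) hg
  refine ⟨M, hM0, fun x t hx hlt htΛ => le_trans ?_ (hM x hx)⟩
  have ht : 0 ≤ t := hl.le.trans hlt
  have h1 := sechPow_le_exp ht (by norm_num : (0 : ℝ) ≤ 2) x
  rw [sechPow_two] at h1
  have h2 : Real.exp (-(2 * t) * |x|) ≤ Real.exp (-(2 * l) * |x|) := by
    apply Real.exp_le_exp.2
    nlinarith [abs_nonneg x]
  have h3 : t ^ 2 ≤ Λ ^ 2 := pow_le_pow_left₀ ht htΛ 2
  have h4 : (2 : ℝ) ^ (2 : ℝ) = 4 := by norm_num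
  rw [h4] at h1
  have h5 : 0 ≤ Real.exp (-(2 * l) * |x|) := (Real.exp_pos _).le
  calc 2 * t ^ 2 * (1 - th t x ^ 2) ≤ 2 * t ^ 2 * (4 * Real.exp (-(2 * l) * |x|)) :=
        mul_le_mul_of_nonneg_left (by linarith) (by positivity)
    _ ≤ 2 * Λ ^ 2 * (4 * Real.exp (-(2 * l) * |x|)) :=
        mul_le_mul_of_nonneg_right (by linarith) (by positivity)
    _ = _ := by ring

/-- Exponential decay of bounded solutions of `(ω - Δ) v = V v + O(e^{-α|x|})`, where the
potential is small at infinity. -/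
lemma IsReg.ae_abs_le_exp {v V : ℝ × ℝ → ℝ} (hv : IsReg v) {ω α η g B Q H M : ℝ} (hω : 0 < ω)
    (hα : 0 ≤ α) (hη : 0 ≤ η) (hg : 0 < g) (hgap : η + g ≤ ω - α ^ 2) (hB0 : 0 ≤ B) (hQ0 : 0 ≤ Q)
    (hH : 0 ≤ H) (hB : ∀ᵐ z ∂cyl, |v z| ≤ B) (hQ : ∀ᵐ z ∂cyl, V z ≤ Q)
    (hVη : ∀ᵐ z ∂cyl, M ≤ |z.1| → V z ≤ η)
    (heq : ∀ᵐ z ∂cyl, |ω * v z - dx (dx v) z - dy (dy v) z|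
      ≤ V z * |v z| + H * Real.exp (-α * |z.1|)) :
    ∀ᵐ z ∂cyl, |v z| ≤ 2 * ((Q * B * Real.exp (α * M) + H) / g) * Real.exp (-α * |z.1|) := by
  -- On |x| ≤ `M`, where the potential is not small, V|v| ≤ QB ≤ QB e^{αM} e^{-α|x|} is counted as
  -- source.
  set K₀ := Q * B * Real.exp (α * M) + H with hK₀
  have hQB : 0 ≤ Q * B := by positivity
  have hK₀0 : 0 ≤ K₀ := by positivity
  have key := hv.ae_abs_le_sech (α := α) (η := η) (K₀ := K₀) hω hη hK₀0 (by linarith) hB (by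
    filter_upwards [hB, hQ, hVη, heq] with z h1 h2 h3 h4
    refine h4.trans ?_
    have he := exp_le_sechPow hα zero_le_one z.1
    rw [one_mul] at he
    have hKe : K₀ * Real.exp (-α * |z.1|) ≤ K₀ * sechPow α 1 z.1 :=
      mul_le_mul_of_nonneg_left he hK₀0
    have hep := Real.exp_pos (-α * |z.1|)
    rcases le_total M |z.1| with hM | hM
    · have h5 := mul_le_mul_of_nonneg_right (h3 hM) (abs_nonneg (v z))
      have h6 : H * Real.exp (-α * |z.1|) ≤ K₀ * Real.exp (-α * |z.1|) := by
        apply mul_le_mul_of_nonneg_right _ hep.le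
        have : 0 ≤ Q * B * Real.exp (α * M) := by positivity
        linarith
      linarith
    · have h5 : V z * |v z| ≤ Q * B :=
        (mul_le_mul_of_nonneg_right h2 (abs_nonneg _)).trans (mul_le_mul_of_nonneg_left h1 hQ0)
      have h6 : 1 ≤ Real.exp (α * M) * Real.exp (-α * |z.1|) := by
        rw [← Real.exp_add, Real.one_le_exp_iff]; nlinarith
      have h7 : 0 ≤ η * |v z| := by positivity
      have h8 : Q * B ≤ Q * B * (Real.exp (α * M) * Real.exp (-α * |z.1|)) :=
        le_mul_of_one_le_right hQB h6
      have h9 : K₀ * Real.exp (-α * |z.1|) = Q * B * (Real.exp (α * M) * Real.exp (-α * |z.1|))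
          + H * Real.exp (-α * |z.1|) := by rw [hK₀]; ring
      linarith)
  filter_upwards [key] with z hz
  refine hz.trans ?_
  have h1 := sechPow_le_exp hα zero_le_one z.1
  rw [one_mul, Real.rpow_one] at h1
  calc K₀ / (ω - α ^ 2 - η) * sechPow α 1 z.1
      ≤ K₀ / g * (2 * Real.exp (-α * |z.1|)) :=
        mul_le_mul (div_le_div_of_nonneg_left hK₀0 hg (by linarith)) h1 (sechPow_pos _ _ _).le
          (by positivity)
    _ = _ := by ring

end Decay

/-! ### First stage: bounds with fixed rates, independent of ε. -/

section Uniform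

variable {p : ℝ}

lemma exp_neg_mul_abs_le {α β : ℝ} (h : α ≤ β) (x : ℝ) :
    Real.exp (-β * |x|) ≤ Real.exp (-α * |x|) :=
  Real.exp_le_exp.2 (mul_le_mul_of_nonneg_right (neg_le_neg h) (abs_nonneg x))

/-- Pointwise lower bound by an exponential, for approximate solutions. -/
lemma IsReg.exp_le_ae {φ : ℝ × ℝ → ℝ} (hφ : IsReg φ) {ω l η B M m κ β g Λ : ℝ} (hp : 1 < p)
    (hω : 0 < ω) (hη : 0 ≤ η) (hηω : η < ω) (hl0 : 0 < l) (hg : 0 < g) (hl : g ≤ l ^ 2 - ω)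
    (hlβ : l ≤ β) (hlΛ : l ≤ Λ) (hm : 0 < m) (hκ0 : 0 ≤ κ) (hB : ∀ᵐ z ∂cyl, |φ z| ≤ B)
    (heq : ∀ᵐ z ∂cyl, |ω * φ z - dx (dx φ) z - dy (dy φ) z - |φ z| ^ (p - 1) * φ z|
      ≤ κ * Real.exp (-β * |z.1|))
    (hin : ∀ᵐ z ∂cyl, |z.1| ≤ M → m ≤ φ z)
    (hout : ∀ᵐ z ∂cyl, M ≤ |z.1| → |φ z| ^ (p - 1) ≤ η)
    (hM : ∀ x, M ≤ |x| → 2 * l ^ 2 * (1 - th l x ^ 2) ≤ g / 2)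
    (hκ : κ ≤ m ^ p * g / (8 * Λ ^ 2)) :
    ∀ᵐ z ∂cyl, m ^ p / (4 * Λ ^ 2) * Real.exp (-l * |z.1|) ≤ φ z := by
  have hlL : l ^ 2 ≤ Λ ^ 2 := pow_le_pow_left₀ hl0.le hlΛ 2
  have hmp : 0 < m ^ p := Real.rpow_pos_of_pos hm p
  have hexp : ∀ x, Real.exp (-l * |x|) ≤ sechPow l 1 x := fun x => by
    simpa using exp_le_sechPow hl0.le zero_le_one x
  have key := hφ.sech_le_ae (κ := κ) hp hω hη hηω (by linarith : ω < l ^ 2) hm hB (by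
      filter_upwards [heq] with z hz
      refine hz.trans (mul_le_mul_of_nonneg_left 
        ((exp_neg_mul_abs_le hlβ z.1).trans (hexp z.1)) hκ0)) hin hout
    (fun x hx => (hM x hx).trans (by linarith)) 
    (hκ.trans (div_le_div₀ (mul_nonneg hmp.le (by linarith))
      (mul_le_mul_of_nonneg_left hl hmp.le) (by positivity) (by linarith)))
  filter_upwards [key] with z hz
  refine le_trans ?_ hz
  have h1 := hexp z.1
  have h2 := Real.exp_pos (-l * |z.1|)
  gcongr

lemma le_soliton (hp : 1 < p) (x : ℝ) :
    ampSol p * Real.exp (-√(omegaP p) * |x|) ≤ soliton p (omegaP p) x := by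
  rw [soliton_eq]
  refine mul_le_mul_of_nonneg_left ?_ (ampSol_pos hp).le
  have := exp_le_sechPow (bSol_pos hp).le (sSol_pos hp).le x
  rwa [sSol_mul_bSol hp] at this

lemma soliton_le_exp (hp : 1 < p) (x : ℝ) :
    soliton p (omegaP p) x ≤ ampSol p * 2 ^ sSol p * Real.exp (-√(omegaP p) * |x|) := by
  rw [soliton_eq, mul_assoc]
  refine mul_le_mul_of_nonneg_left ?_ (ampSol_pos hp).le
  have := sechPow_le_exp (bSol_pos hp).le (sSol_pos hp).le x
  rwa [sSol_mul_bSol hp] at this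

/-- Bounds with fixed rates, uniform over the solutions of the auxiliary equation. -/
lemma exists_uniform_estimates (hp : 1 < p) : ∃ r δ a₀ C K m : ℝ, 0 < r ∧ 0 < δ ∧ δ < omegaP p ∧
    0 < a₀ ∧ a₀ < 1 ∧ 0 < C ∧ 0 < K ∧ 0 < m ∧ ∀ (ω a : ℝ) (h : ℝ × ℝ → ℝ),
      |ω - omegaP p| < δ → |a| < a₀ → IsAuxSol p r ω a h →
      omegaP p / 2 ≤ ω ∧ ω ≤ (√(omegaP p) + bSol p / 4) ^ 2 ∧
      (∀ᵐ z ∂cyl, |ω * phi p a h z - dx (dx (phi p a h)) z - dy (dy (phi p a h)) z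
        - |phi p a h z| ^ (p - 1) * phi p a h z|
        ≤ C * |a| * Real.exp (-(√(omegaP p) + bSol p) * |z.1|)) ∧
      (∀ᵐ z ∂cyl, |phi p a h z| ≤ K * Real.exp (-(√(omegaP p) / 4) * |z.1|)) ∧
      ∀ᵐ z ∂cyl, m * Real.exp (-(√(omegaP p) + 3 * bSol p / 4) * |z.1|) ≤ phi p a h z := by
  have hp' : 0 < p - 1 := by linarith
  have hΩ := omegaP_pos hp
  set Ω := omegaP p with hΩdef
  set w := √Ω with hw
  have hwpos : 0 < w := Real.sqrt_pos.2 hΩ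
  have hww : w ^ 2 = Ω := Real.sq_sqrt hΩ.le
  have hb := bSol_pos hp
  set b := bSol p with hbdef
  have hA := ampSol_pos hp
  -- A rate between √ω ≤ w + b/4 and the rate w + b of Ψ: the barrier has a gap at least w b and
  -- decays more slowly than the forcing.
  set l := w + 3 * b / 4 with hl
  have hlpos : 0 < l := by positivity
  set t₀ := (Ω / 8) ^ (1 / (p - 1)) with ht₀
  have ht₀pos : 0 < t₀ := by positivity
  have ht₀pow : t₀ ^ (p - 1) = Ω / 8 := by
    rw [ht₀, ← Real.rpow_mul (by positivity), one_div, inv_mul_cancel₀ hp'.ne', Real.rpow_one]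
  obtain ⟨M₁, hM₁0, hM₁⟩ := exists_mul_exp_le (K := ampSol p * 2 ^ sSol p) hwpos (half_pos ht₀pos)
  obtain ⟨M₂, hM₂0, hM₂⟩ := exists_sech_sq_le (Λ := l) hlpos (by positivity : 0 < w * b / 2)
  set M := max M₁ M₂ with hM
  have hM0 : 0 ≤ M := hM₁0.trans (le_max_left _ _)
  set m₀ := ampSol p * Real.exp (-w * M) with hm₀
  have hm₀pos : 0 < m₀ := by positivity
  -- `M` and `m₀` depend on the soliton alone. Closeness τ then gives |φ| ≤ t₀ for |x| ≥ `M` and φ ≥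
  -- m₀/2 for |x| ≤ `M`; the radius `r` is chosen last.
  set τ := min (t₀ / 2) (m₀ / 2) with hτ
  have hτpos : 0 < τ := lt_min (by positivity) (by positivity)
  obtain ⟨r, δ, a₀, C, hr, hδ, ha₀, hC, hsol⟩ := exists_auxSol_estimates hp hτpos
  set B := ampSol p + τ with hB
  have hBpos : 0 < B := by positivity
  set K := 2 * ((B ^ (p - 1) * B * Real.exp (w / 4 * M) + C) / (Ω / 4)) with hK
  have hKpos : 0 < K := by positivity
  have hmp : 0 < (m₀ / 2) ^ p := by positivity
  set G := (m₀ / 2) ^ p * (w * b) / (8 * l ^ 2) with hG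
  have hGpos : 0 < G := by positivity
  -- |ω - Ω| < Ω/2 keeps ω ≥ Ω/2, and w b/2 keeps √ω ≤ w + b/4. The restriction |a| < G/C makes the
  -- forcing small enough for the lower barrier.
  refine ⟨r, min δ (min (Ω / 2) (w * b / 2)), min a₀ (min (1 / 2) (G / C)), C, K,
    (m₀ / 2) ^ p / (4 * l ^ 2), hr, by positivity,
    lt_of_le_of_lt ((min_le_right _ _).trans (min_le_left _ _)) (by linarith), by positivity,
    lt_of_le_of_lt ((min_le_right _ _).trans (min_le_left _ _)) (by norm_num), hC, hKpos,
    by positivity, ?_⟩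
  intro ω a h hω ha haux
  obtain ⟨hω1, hω2⟩ := lt_min_iff.1 hω
  obtain ⟨hω2, hω3⟩ := lt_min_iff.1 hω2
  obtain ⟨ha1, ha2⟩ := lt_min_iff.1 ha
  obtain ⟨ha2, ha3⟩ := lt_min_iff.1 ha2
  obtain ⟨hclose, heq⟩ := hsol ω a h hω1 ha1 haux
  rw [abs_lt] at hω2 hω3
  have hlow : Ω / 2 ≤ ω := by linarith [hω2.1]
  have hωpos : 0 < ω := by linarith
  have hup : ω ≤ (w + b / 4) ^ 2 := by
    have : (w + b / 4) ^ 2 = Ω + w * b / 2 + b ^ 2 / 16 := by rw [← hww]; ring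
    linarith [hω3.2, sq_nonneg b]
  have hφ := isReg_phi hp haux.1.1 a
  set φ := phi p a h with hφdef
  have hφB : ∀ᵐ z ∂cyl, |φ z| ≤ B := by
    filter_upwards [hclose] with z hz
    have h1 := soliton_le hp z.1
    have h2 := soliton_pos hp z.1
    have h3 := abs_le.1 hz
    rw [abs_le]
    constructor <;> linarith [h3.1, h3.2]
  have hout : ∀ᵐ z ∂cyl, M ≤ |z.1| → |φ z| ^ (p - 1) ≤ Ω / 8 := by
    filter_upwards [hclose] with z hz hMz
    rw [← ht₀pow]
    refine Real.rpow_le_rpow (abs_nonneg _) ?_ hp'.le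
    have h1 := (soliton_le_exp hp z.1).trans (hM₁ z.1 ((le_max_left _ _).trans hMz))
    have h2 := soliton_pos hp z.1
    have h3 := abs_le.1 (hz.trans (min_le_left _ _))
    rw [abs_le]
    constructor <;> linarith [h3.1, h3.2]
  have hin : ∀ᵐ z ∂cyl, |z.1| ≤ M → m₀ / 2 ≤ φ z := by
    filter_upwards [hclose] with z hz hMz
    have h1 := le_soliton hp z.1
    have h2 : m₀ ≤ ampSol p * Real.exp (-w * |z.1|) := by
      refine mul_le_mul_of_nonneg_left (Real.exp_le_exp.2 ?_) hA.le
      exact mul_le_mul_of_nonpos_left hMz (by linarith)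
    have h3 := abs_le.1 (hz.trans (min_le_right _ _))
    linarith [h3.1]
  have hgap : Ω / 8 + Ω / 4 ≤ ω - (w / 4) ^ 2 := by
    rw [div_pow, hww]; linarith
  have hgap' : w * b ≤ l ^ 2 - ω := by
    have h1 : l ^ 2 = Ω + 3 * (w * b) / 2 + 9 * b ^ 2 / 16 := by rw [← hww, hl]; ring
    linarith [hω3.2, sq_nonneg b]
  refine ⟨hlow, hup, heq, ?_, ?_⟩
  · refine hφ.ae_abs_le_exp (V := fun z => |φ z| ^ (p - 1)) (η := Ω / 8) (M := M) hωpos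
      (by positivity) (by positivity) (by positivity) hgap hBpos.le (by positivity) hC.le
      hφB ?_ hout ?_
    · filter_upwards [hφB] with z hz
      exact Real.rpow_le_rpow (abs_nonneg _) hz hp'.le
    · filter_upwards [heq] with z hz
      set X := ω * φ z - dx (dx φ) z - dy (dy φ) z with hX
      have h1 : |X| ≤ |X - |φ z| ^ (p - 1) * φ z| + |(|φ z| ^ (p - 1) * φ z)| := by
        have := abs_add_le (X - |φ z| ^ (p - 1) * φ z) (|φ z| ^ (p - 1) * φ z)
        rwa [sub_add_cancel] at this
      rw [abs_mul, abs_of_nonneg (by positivity : (0 : ℝ) ≤ |φ z| ^ (p - 1))] at h1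
      have h2 : C * |a| * Real.exp (-(w + b) * |z.1|) ≤ C * Real.exp (-(w / 4) * |z.1|) := by
        refine mul_le_mul (mul_le_of_le_one_right hC.le (by linarith))
          (exp_neg_mul_abs_le (by linarith) z.1) (Real.exp_pos _).le hC.le
      linarith
  · refine hφ.exp_le_ae (η := Ω / 8) (M := M) (m := m₀ / 2) (κ := C * |a|) (β := w + b)
      (g := w * b) (Λ := l) hp hωpos (by positivity) (by linarith) hlpos (by positivity)
      hgap' (by linarith) le_rfl (by positivity) (by positivity) hφB heq hin hout
      (fun x hx => hM₂ x l ((le_max_right _ _).trans hx) le_rfl le_rfl) ?_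
    rw [mul_comm]
    exact ((lt_div_iff₀ hC).1 ha3).le

end Uniform

/-! ### Second stage: rates within ε of the optimal ones. -/

section SharpRates

/-- Approximate solutions of `-Δφ + ωφ = |φ|^(p-1) φ` with bounds of fixed exponential rates. -/
structure IsApproxSol (p C K m ω a : ℝ) (φ : ℝ × ℝ → ℝ) : Prop where
  reg : IsReg φ
  le_freq : omegaP p / 2 ≤ ω
  freq_le : ω ≤ (√(omegaP p) + bSol p / 4) ^ 2
  eqn : ∀ᵐ z ∂cyl, |ω * φ z - dx (dx φ) z - dy (dy φ) z - |φ z| ^ (p - 1) * φ z|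
    ≤ C * |a| * Real.exp (-(√(omegaP p) + bSol p) * |z.1|)
  upper : ∀ᵐ z ∂cyl, |φ z| ≤ K * Real.exp (-(√(omegaP p) / 4) * |z.1|)
  lower : ∀ᵐ z ∂cyl, m * Real.exp (-(√(omegaP p) + 3 * bSol p / 4) * |z.1|) ≤ φ z

variable {p C K m : ℝ}

lemma IsApproxSol.freq_pos {ω a : ℝ} {φ : ℝ × ℝ → ℝ} (h : IsApproxSol p C K m ω a φ)
    (hp : 1 < p) : 0 < ω := by
  linarith [omegaP_pos hp, h.le_freq]

lemma IsApproxSol.le_sqrt_freq {ω a : ℝ} {φ : ℝ × ℝ → ℝ} (h : IsApproxSol p C K m ω a φ)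
    (hp : 1 < p) : √(omegaP p) / 2 ≤ √ω := by
  have hΩ := omegaP_pos hp
  apply Real.le_sqrt_of_sq_le
  rw [div_pow, Real.sq_sqrt hΩ.le]
  linarith [h.le_freq]

lemma IsApproxSol.sqrt_freq_le {ω a : ℝ} {φ : ℝ × ℝ → ℝ} (h : IsApproxSol p C K m ω a φ)
    (hp : 1 < p) : √ω ≤ √(omegaP p) + bSol p / 4 := by
  have hb := bSol_pos hp
  rw [Real.sqrt_le_left (by positivity)]
  exact h.freq_le

lemma IsApproxSol.abs_le {ω a : ℝ} {φ : ℝ × ℝ → ℝ} (h : IsApproxSol p C K m ω a φ)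
    (hK : 0 ≤ K) : ∀ᵐ z ∂cyl, |φ z| ≤ K := by
  filter_upwards [h.upper] with z hz
  refine hz.trans (mul_le_of_le_one_right hK (Real.exp_le_one_iff.2 ?_))
  rw [neg_mul, neg_nonpos]
  positivity

/-- The spectral gap at a rate below `√ω`. -/
lemma IsApproxSol.gap {ω a ε α : ℝ} {φ : ℝ × ℝ → ℝ} (h : IsApproxSol p C K m ω a φ) (hp : 1 < p)
    (hε : 0 < ε) (hε' : ε < √(omegaP p) / 4) (hα : 0 ≤ α) (hαε : α ≤ √ω - ε) :
    ε * √(omegaP p) / 4 + ε * √(omegaP p) / 4 ≤ ω - α ^ 2 := by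
  have h1 := h.le_sqrt_freq hp
  have h2 : √ω ^ 2 = ω := Real.sq_sqrt (h.freq_pos hp).le
  have h3 : α ^ 2 ≤ (√ω - ε) ^ 2 := pow_le_pow_left₀ hα hαε 2
  -- Since √ω ≥ √ω_p/2 and ε < √ω_p/4, the gap is at least ε√ω_p/2: half for the potential, half for
  -- the barrier.
  have h4 : ε * (√(omegaP p) / 2) ≤ ε * (2 * √ω - ε) :=
    mul_le_mul_of_nonneg_left (by linarith) hε.le
  have h5 : (√ω - ε) ^ 2 = ω - ε * (2 * √ω - ε) := by
    linear_combination h2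
  linarith

/-- Decay of bounded solutions of the linearized equation, at a rate close to that of the
source. -/
lemma exists_linearized_decay (hp : 1 < p) (hK : 0 < K) {ε : ℝ} (hε : 0 < ε)
    (hε' : ε < √(omegaP p) / 4) {A B α : ℝ} (hA : 0 < A) (hB : 0 < B) :
    ∃ C' : ℝ, 0 < C' ∧ ∀ (ω a : ℝ) (φ : ℝ × ℝ → ℝ), IsApproxSol p C K m ω a φ → α < √ω →
      ∀ v G : ℝ × ℝ → ℝ, MemH2 v → LPlus p ω φ v =ᵐ[cyl] G →
      (∀ᵐ z ∂cyl, |G z| ≤ A * Real.exp (-α * |z.1|)) → (∀ᵐ z ∂cyl, |v z| ≤ B) →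
      ∀ᵐ z ∂cyl, |v z| ≤ C' * Real.exp (-(α - ε) * |z.1|) := by
  have hw : 0 < √(omegaP p) := Real.sqrt_pos.2 (omegaP_pos hp)
  set w := √(omegaP p) with hwdef
  have hp0 : 0 < p := by linarith
  obtain ⟨M, hM0, hM⟩ := exists_rpow_le (K := K) (α := w / 4) (η := ε * w / 4 / p) hp
    (by positivity) (by positivity)
  -- If `α ≤ ε`, the claimed bound does not decay and the L^∞ bound suffices.
  rcases le_or_gt α ε with hαε | hαε
  · refine ⟨B, hB, fun ω a φ _ _ v G _ _ _ hvB => ?_⟩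
    filter_upwards [hvB] with z hz
    refine hz.trans (le_mul_of_one_le_right hB.le (Real.one_le_exp_iff.2 ?_))
    exact mul_nonneg (by linarith) (abs_nonneg _)
  refine ⟨2 * ((p * K ^ (p - 1) * B * Real.exp ((α - ε) * M) + A) / (ε * w / 4)), by positivity,
    fun ω a φ hφ hαω v G hv hLv hG hvB => ?_⟩
  refine hv.isReg.ae_abs_le_exp (V := fun z => p * |φ z| ^ (p - 1)) (η := ε * w / 4) (M := M)
    (hφ.freq_pos hp) (by linarith) (by positivity) (by positivity)
    (hφ.gap hp hε hε' (by linarith) (by linarith)) hB.le (by positivity) hA.le hvB ?_ ?_ ?_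
  · filter_upwards [hφ.abs_le hK.le] with z hz
    exact mul_le_mul_of_nonneg_left (Real.rpow_le_rpow (abs_nonneg _) hz (by linarith)) hp0.le
  · filter_upwards [hφ.upper] with z hz hMz
    rw [mul_comm]
    exact (le_div_iff₀ hp0).1 (hM z.1 (φ z) hMz hz)
  · filter_upwards [hLv, hG] with z hz hGz
    have h1 : ω * v z - dx (dx v) z - dy (dy v) z = p * |φ z| ^ (p - 1) * v z + G z := by
      rw [← hz, LPlus]; ring
    rw [h1]
    refine (abs_add_le _ _).trans (add_le_add (le_of_eq ?_) (hGz.trans ?_))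
    · rw [abs_mul, abs_of_nonneg (by positivity : (0 : ℝ) ≤ p * |φ z| ^ (p - 1))]
    · exact mul_le_mul_of_nonneg_left (exp_neg_mul_abs_le (by linarith) z.1) hA.le

/-- Upper bound at a rate close to `√ω`. -/
lemma exists_sharp_upper (hp : 1 < p) (hC : 0 < C) (hK : 0 < K) {ε : ℝ} (hε : 0 < ε)
    (hε' : ε < √(omegaP p) / 4) :
    ∃ C' : ℝ, 0 < C' ∧ ∀ (ω a : ℝ) (φ : ℝ × ℝ → ℝ), IsApproxSol p C K m ω a φ → |a| ≤ 1 →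
      ∀ᵐ z ∂cyl, φ z ≤ C' * Real.exp (-(√ω - ε) * |z.1|) := by
  have hw : 0 < √(omegaP p) := Real.sqrt_pos.2 (omegaP_pos hp)
  have hb := bSol_pos hp
  set w := √(omegaP p) with hwdef
  obtain ⟨M, hM0, hM⟩ := exists_rpow_le (K := K) (α := w / 4) (η := ε * w / 4) hp
    (by positivity) (by positivity)
  -- The comparison produces e^{(√ω-ε)M}; w + b bounds the rate from above, so the constant does not
  -- depend on ω.
  refine ⟨2 * ((K ^ (p - 1) * K * Real.exp ((w + bSol p) * M) + C) / (ε * w / 4)), by positivity,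
    fun ω a φ hφ ha => ?_⟩
  have h1 := hφ.le_sqrt_freq hp
  have h2 := hφ.sqrt_freq_le hp
  have key := hφ.reg.ae_abs_le_exp (V := fun z => |φ z| ^ (p - 1)) (α := √ω - ε)
    (η := ε * w / 4) (g := ε * w / 4) (M := M) (Q := K ^ (p - 1)) (H := C) (hφ.freq_pos hp)
    (by linarith) (by positivity) (by positivity) (hφ.gap hp hε hε' (by linarith) le_rfl) hK.le
    (by positivity) hC.le (hφ.abs_le hK.le)
    (by
      filter_upwards [hφ.abs_le hK.le] with z hz
      exact Real.rpow_le_rpow (abs_nonneg _) hz (by linarith))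
    (by
      filter_upwards [hφ.upper] with z hz hMz
      exact hM z.1 (φ z) hMz hz)
    (by
      filter_upwards [hφ.eqn] with z hz
      set X := ω * φ z - dx (dx φ) z - dy (dy φ) z with hX
      have h3 := abs_add_le (X - |φ z| ^ (p - 1) * φ z) (|φ z| ^ (p - 1) * φ z)
      rw [sub_add_cancel, abs_mul (|φ z| ^ (p - 1)),
        abs_of_nonneg (by positivity : (0 : ℝ) ≤ |φ z| ^ (p - 1))] at h3
      have h4 : C * |a| * Real.exp (-(w + bSol p) * |z.1|) ≤ C * Real.exp (-(√ω - ε) * |z.1|) :=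
        mul_le_mul (mul_le_of_le_one_right hC.le ha) (exp_neg_mul_abs_le (by linarith) z.1)
          (Real.exp_pos _).le hC.le
      linarith)
  filter_upwards [key] with z hz
  refine (le_abs_self _).trans (hz.trans (mul_le_mul_of_nonneg_right ?_ (Real.exp_pos _).le))
  have h5 : Real.exp ((√ω - ε) * M) ≤ Real.exp ((w + bSol p) * M) :=
    Real.exp_le_exp.2 (mul_le_mul_of_nonneg_right (by linarith) hM0)
  have : 0 ≤ K ^ (p - 1) * K := by positivity
  gcongr

/-- Lower bound at a rate close to `√ω`, for small `a`. -/
lemma exists_sharp_lower (hp : 1 < p) (hC : 0 < C) (hK : 0 < K) (hm : 0 < m) {ε : ℝ} (hε : 0 < ε)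
    (hε' : ε < bSol p / 4) :
    ∃ aε σ : ℝ, 0 < aε ∧ 0 < σ ∧ ∀ (ω a : ℝ) (φ : ℝ × ℝ → ℝ), IsApproxSol p C K m ω a φ →
      |a| < aε → ∀ᵐ z ∂cyl, σ * Real.exp (-(√ω + ε) * |z.1|) ≤ φ z := by
  have hΩ := omegaP_pos hp
  have hw : 0 < √(omegaP p) := Real.sqrt_pos.2 hΩ
  have hb := bSol_pos hp
  set w := √(omegaP p) with hwdef
  set b := bSol p with hbdef
  obtain ⟨M₁, hM₁0, hM₁⟩ := exists_rpow_le (K := K) (α := w / 4) (η := omegaP p / 8) hp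
    (by positivity) (by positivity)
  obtain ⟨M₂, hM₂0, hM₂⟩ := exists_sech_sq_le (l := w / 2) (Λ := w + b) (g := ε * w / 2)
    (by positivity) (by positivity)
  set M := max M₁ M₂ with hM
  -- Here `M` grows as ε → 0. The fixed-rate lower bound still keeps φ positive on |x| ≤ `M`,
  -- without shrinking r₀.
  set m₁ := m * Real.exp (-(w + 3 * b / 4) * M) with hm₁
  have hm₁pos : 0 < m₁ := by positivity
  set G := m₁ ^ p * (ε * w) / (8 * (w + b) ^ 2) with hG
  have hGpos : 0 < G := by positivity
  -- a_ε is where the forcing C|a| stays below what the barrier of gap ε w tolerates.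
  refine ⟨G / C, m₁ ^ p / (4 * (w + b) ^ 2), by positivity, by positivity,
    fun ω a φ hφ ha => ?_⟩
  have h1 := hφ.le_sqrt_freq hp
  have h2 := hφ.sqrt_freq_le hp
  have hsq : √ω ^ 2 = ω := Real.sq_sqrt (hφ.freq_pos hp).le
  have hgap : ε * w ≤ (√ω + ε) ^ 2 - ω := by
    have e : (√ω + ε) ^ 2 - ω = ε * (2 * √ω + ε) := by
      linear_combination hsq
    rw [e]
    exact mul_le_mul_of_nonneg_left (by linarith) hε.le
  refine hφ.reg.exp_le_ae (η := omegaP p / 8) (M := M) (m := m₁) (κ := C * |a|) (β := w + b)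
    (g := ε * w) (Λ := w + b) hp (hφ.freq_pos hp) (by positivity) (by linarith [hφ.le_freq])
    (by positivity) (by positivity) hgap (by linarith) (by linarith) hm₁pos (by positivity)
    (hφ.abs_le hK.le) hφ.eqn ?_ ?_ ?_ ?_
  · filter_upwards [hφ.lower] with z hz hMz
    refine le_trans (mul_le_mul_of_nonneg_left (Real.exp_le_exp.2 ?_) hm.le) hz
    exact mul_le_mul_of_nonpos_left hMz (by linarith)
  · filter_upwards [hφ.upper] with z hz hMz
    exact hM₁ z.1 (φ z) ((le_max_left _ _).trans hMz) hz
  · exact fun x hx => hM₂ x _ ((le_max_right _ _).trans hx) (by linarith) (by linarith)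
  · rw [mul_comm]
    exact ((lt_div_iff₀ hC).1 ha).le

end SharpRates

end LineSoliton

end

theorem mainTheorem5 (p : ℝ) (hp : 1 < p) :
    ∃ r₀ δ₀ ε₁ : ℝ, 0 < r₀ ∧ 0 < δ₀ ∧ δ₀ < LineSoliton.omegaP p ∧ 0 < ε₁ ∧
      ∀ ε : ℝ, 0 < ε → ε < ε₁ → ∃ aε : ℝ, 0 < aε ∧ aε < 1 ∧
        -- `aε` is a constant for which the two-sided bound on `φ(ω, a)` holds
        (∃ C₁ : ℝ, 1 < C₁ ∧
          ∀ (ω a : ℝ) (h : ℝ × ℝ → ℝ), |ω - LineSoliton.omegaP p| < δ₀ → |a| < aε →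
            LineSoliton.IsAuxSol p r₀ ω a h →
            ∀ᵐ z ∂LineSoliton.cyl,
              C₁⁻¹ * Real.exp (-(Real.sqrt ω + ε) * |z.1|) ≤ LineSoliton.phi p a h z ∧
              LineSoliton.phi p a h z ≤ C₁ * Real.exp (-(Real.sqrt ω - ε) * |z.1|)) ∧
        -- the decay of the solutions of `L₊(ω, a) v = G`
        ∀ A B α : ℝ, 0 < A → 0 < B → 0 < α → ∃ C : ℝ, 0 < C ∧
          ∀ (ω a : ℝ) (h : ℝ × ℝ → ℝ), |ω - LineSoliton.omegaP p| < δ₀ → |a| < aε →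
            LineSoliton.IsAuxSol p r₀ ω a h → α < Real.sqrt ω →
            ∀ v G : ℝ × ℝ → ℝ, LineSoliton.MemH2 v →
              LineSoliton.LPlus p ω (LineSoliton.phi p a h) v =ᵐ[LineSoliton.cyl] G →
              (∀ᵐ z ∂LineSoliton.cyl, |G z| ≤ A * Real.exp (-α * |z.1|)) →
              (∀ᵐ z ∂LineSoliton.cyl, |v z| ≤ B) →
              ∀ᵐ z ∂LineSoliton.cyl, |v z| ≤ C * Real.exp (-(α - ε) * |z.1|) := by
  obtain ⟨r, δ, a₀, C, K, m, hr, hδ, hδ', ha₀, ha₀', hC, hK, hm, hsol⟩ :=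
    LineSoliton.exists_uniform_estimates hp
  have hw := Real.sqrt_pos.2 (LineSoliton.omegaP_pos hp)
  have hb := LineSoliton.bSol_pos hp
  -- ε < b/4 keeps √ω + ε below the rate of Ψ; ε < √ω_p/4 keeps √ω - ε positive.
  refine ⟨r, δ, min (LineSoliton.bSol p / 4) (√(LineSoliton.omegaP p) / 4), hr, hδ, hδ',
    by positivity, fun ε hε hε₁ => ?_⟩
  obtain ⟨hεb, hεw⟩ := lt_min_iff.1 hε₁
  obtain ⟨aε, σ, haε, hσ, hlow⟩ := LineSoliton.exists_sharp_lower hp hC hK hm hε hεb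
  obtain ⟨C', hC', hup⟩ := LineSoliton.exists_sharp_upper (m := m) hp hC hK hε hεw
  have happ : ∀ (ω a : ℝ) (h : ℝ × ℝ → ℝ), |ω - LineSoliton.omegaP p| < δ → |a| < min aε a₀ →
      LineSoliton.IsAuxSol p r ω a h →
      LineSoliton.IsApproxSol p C K m ω a (LineSoliton.phi p a h) := by
    intro ω a h hω ha haux
    obtain ⟨h1, h2, h3, h4, h5⟩ := hsol ω a h hω (ha.trans_le (min_le_right _ _)) haux
    exact ⟨LineSoliton.isReg_phi hp haux.1.1 a, h1, h2, h3, h4, h5⟩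
  refine ⟨min aε a₀, lt_min haε ha₀, (min_le_right _ _).trans_lt ha₀', ?_, ?_⟩
  · have hσi : 0 < σ⁻¹ := inv_pos.2 hσ
    refine ⟨1 + C' + σ⁻¹, by linarith, fun ω a h hω ha haux => ?_⟩
    have hφ := happ ω a h hω ha haux
    have ha1 : |a| ≤ 1 := (ha.le.trans (min_le_right _ _)).trans ha₀'.le
    filter_upwards [hlow ω a _ hφ (ha.trans_le (min_le_left _ _)), hup ω a _ hφ ha1] with z h1 h2
    refine ⟨le_trans (mul_le_mul_of_nonneg_right ?_ (Real.exp_pos _).le) h1,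
      h2.trans (mul_le_mul_of_nonneg_right (by linarith) (Real.exp_pos _).le)⟩
    exact inv_le_of_inv_le₀ hσ (by linarith)
  · intro A B α hA hB _
    obtain ⟨C'', hC'', hdec⟩ := LineSoliton.exists_linearized_decay (C := C) (m := m) (α := α) hp hK
      hε hεw hA hB
    exact ⟨C'', hC'', fun ω a h hω ha haux hαω v G hv hLv hG hvB =>
      hdec ω a _ (happ ω a h hω ha haux) hαω v G hv hLv hG hvB⟩
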